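/- A Gödel-type spacetime $\bar M=\bar M(H,D)$ is $\mathbb R\times I\times\mathbb R\times\mathbb R$ with coordinates $(x_1,x_2,x_3,x_4)=(t,r,\varphi,z)$, where $I\subseteq\mathbb R$ is an open interval and $H,D:I\to\mathbb R$ are smooth with $D\neq 0$ everywhere, equipped with the Lorentzian metric $$g=(dt+H(r)\,d\varphi)^2-dr^2-D(r)^2\,d\varphi^2-dz^2$$ of signature $(+,-,-,-)$. It is flat near radius $r$ if $f_1=\left(\frac{H'}{2D}\right)^2$, $f_2=-\left(\frac{H'}{2D}\right)'$ and $f_3=3f_1-\frac{D''}{D}$ (which determine its curvature) vanish for all radii close to $r$. For $\omega\neq0$ and $m=2|\omega|$, the limiting homogeneous spacetime $\bar M_\omega$ is the one with $I=(0,\infty)$, $H=\frac{2\omega}{m^2}(1-\cosh mr)$, $D=\frac1m\sinh mr$. **Theorem.** Let $F:M\to\bar M$ be a totally geodesic hypersurface, i.e. a smooth immersion of a smooth 3-manifold with nondegenerate induced metric and vanishing second fundamental form, and suppose that $\bar M$ is not flat near the radius of any point of $F(M)$. Then there is an open dense set $W\subseteq M$ such that every point of $W$ has an open neighbourhood $U$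 with local coordinates $(u_1,u_2,u_3)$ ranging over an open box, in which, up to isometries, the immersion $F|_U$ is given by one of the following expressions. (a) For any $H,D$: $F(u_1,u_2,u_3)=(u_1,u_2,u_3,0)$, and $U$ is timelike. (b) If $\frac{H'}{2D}$ is constant along $U$: $$F(u_1,u_2,u_3)=\left(u_1+\rho\int_0^{u_2}\frac{H}{D^2}\,ds,\ r_0+\int_0^{u_2}\sqrt{1-\left(\tfrac{\rho}{D}\right)^2}\,ds,\ -\rho\int_0^{u_2}\frac{1}{D^2}\,ds,\ u_3\right)$$ for real constants $\rho,r_0$, where $H,D$ in the integrals are evaluated along the hypersurface, i.e. at the radius $R(s)$ given by the second component at $u_2=s$, and $\rho^2\le D^2$ there; $U$ is timelike. (c) If $\left|\dfrac{(H'/D)'}{(H'/D)^2-D''/D}\right|<1$ (counted as satisfied where numerator and denominator both vanish) and $(D')^2>(H')^2$ along $U$: with $\theta=\frac14\ln\frac{D'+H'}{D'-H'}$ and $H,D,\theta$ evaluated at $r=u_1$, either $$F(u_1,u_2,u_3)=\left((D\tanh\theta-H)u_3,\ u_1,\ u_3,\ u_2\right)\quad\text{and } U \text{ is spacelike, or}$$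 $$F(u_1,u_2,u_3)=\left((D\coth\theta-H)u_3,\ u_1,\ u_3,\ u_2\right),\ \theta\neq0,\quad\text{and } U \text{ is timelike.}$$ (d) If $H$ is constant along $U$: for some real constant $\theta$, either $$F(u_1,u_2,u_3)=(\tanh\theta\,u_1-Hu_3,\ u_2,\ u_3,\ u_1)\quad\text{and } U \text{ is spacelike, or}$$ $$F(u_1,u_2,u_3)=(\coth\theta\,u_1-Hu_3,\ u_2,\ u_3,\ u_1),\ \theta\neq0,\quad\text{and } U \text{ is timelike.}$$ Here "up to isometries" means: after composing $F$ with an isometry of $\bar M$ onto itself; or else, if for some constant $\omega\ne0$ one has $H'=-2\omega D$ and $D''=4\omega^2D$ on an open set $O\subseteq\bar M$ containing $F(U)$, after composing $F$ with an isometry of $O$ onto an open subset of $\bar M_\omega$ (the conditions and expressions then refer to the functions $H,D$ of $\bar M_\omega$). -/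

import Mathlib

open Set Filter Topology
open scoped Manifold ContDiff

noncomputable section

/-- Coordinates `(t, r, φ, z) = (x 0, x 1, x 2, x 3)` on the ambient four-dimensional spacetime. -/
abbrev E4 := EuclideanSpace ℝ (Fin 4)

/-- The model space of three-dimensional manifolds. -/
abbrev E3 := EuclideanSpace ℝ (Fin 3)

/-- A Gödel-type spacetime: smooth functions `H`, `D` on an open interval of radii `r`, with `D`
nowhere zero. It is the set `{r ∈ interval}` in `ℝ⁴` with the metric
`(dt + H dφ)² - dr² - D² dφ² - dz²`. -/
structure GodelType where
  interval : Set ℝ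
  H : ℝ → ℝ
  D : ℝ → ℝ
  isOpen_interval : IsOpen interval
  ordConnected_interval : interval.OrdConnected
  smooth_H : ContDiffOn ℝ ∞ H interval
  smooth_D : ContDiffOn ℝ ∞ D interval
  D_ne_zero : ∀ r ∈ interval, D r ≠ 0

namespace GodelType

variable (S : GodelType)

/-- The underlying open set of `ℝ⁴`. -/
def domain : Set E4 := {x | x 1 ∈ S.interval}

/-- The metric `(dt + H dφ)² - dr² - D² dφ² - dz²` at `x`, of signature `(+,-,-,-)`. -/
def metric (x v w : E4) : ℝ :=
  (v 0 + S.H (x 1) * v 2) * (w 0 + S.H (x 1) * w 2) - v 1 * w 1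
    - S.D (x 1) ^ 2 * (v 2 * w 2) - v 3 * w 3

/-- The matrix `g_ij` of the metric in the coordinate frame. -/
def gram (x : E4) : Matrix (Fin 4) (Fin 4) ℝ :=
  Matrix.of fun i j => S.metric x (EuclideanSpace.single i 1) (EuclideanSpace.single j 1)

/-- `∂_l g_ij` at `x`. -/
def dGram (x : E4) (l i j : Fin 4) : ℝ :=
  fderiv ℝ (fun y => S.gram y i j) x (EuclideanSpace.single l 1)

/-- The Christoffel symbols `Γ^k_ij` of the Levi-Civita connection. -/
def christoffel (x : E4) (k i j : Fin 4) : ℝ :=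
  (1 / 2) * ∑ l, (S.gram x)⁻¹ k l * (S.dGram x i j l + S.dGram x j i l - S.dGram x l i j)

/-- For a map `X` from (an open subset of) `ℝ³` to the spacetime: the ambient covariant derivative,
at `u` in the direction `v`, of the vector field `dX(w)` along `X`, for constant `v`, `w`. -/
def covDeriv (X : E3 → E4) (u v w : E3) : E4 :=
  WithLp.toLp 2 fun k =>
    (fderiv ℝ (fun u' => fderiv ℝ X u' w) u v) k
      + ∑ i, ∑ j, S.christoffel (X u) k i j * (fderiv ℝ X u v) i * (fderiv ℝ X u w) j

/-- `ξ` is a unit normal vector of the parametrized hypersurface `X` at `u`. -/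
def IsUnitNormal (X : E3 → E4) (u : E3) (ξ : E4) : Prop :=
  (S.metric (X u) ξ ξ = 1 ∨ S.metric (X u) ξ ξ = -1) ∧
    ∀ v, S.metric (X u) (fderiv ℝ X u v) ξ = 0

/-- The second fundamental form with respect to the unit normal `ξ`: the coefficient of `ξ` in the
decomposition of `covDeriv` into tangential and normal part (formula of Gauss). -/
def secondFundamentalForm (X : E3 → E4) (u : E3) (ξ : E4) (v w : E3) : ℝ :=
  S.metric (X u) ξ ξ * S.metric (X u) (S.covDeriv X u v w) ξ

/-- The metric induced on `ℝ³` by `X`. -/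
def inducedMetric (X : E3 → E4) (u v w : E3) : ℝ :=
  S.metric (X u) (fderiv ℝ X u v) (fderiv ℝ X u w)

/-- The induced metric at `u` is nondegenerate. -/
def IsNondegenerateAt (X : E3 → E4) (u : E3) : Prop :=
  ∀ v, (∀ w, S.inducedMetric X u v w = 0) → v = 0

/-- Spacelike on `V`: the induced metric is (negative) definite; the ambient signature is
`(+,-,-,-)`. -/
def IsSpacelikeOn (X : E3 → E4) (V : Set E3) : Prop :=
  ∀ u ∈ V, ∀ v, v ≠ 0 → S.inducedMetric X u v v < 0

/-- Timelike on `V`: the induced metric is Lorentzian, that is, nondegenerate with a timelike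
vector. -/
def IsTimelikeOn (X : E3 → E4) (V : Set E3) : Prop :=
  ∀ u ∈ V, S.IsNondegenerateAt X u ∧ ∃ v, 0 < S.inducedMetric X u v v

section Manifold

variable {M : Type*} [TopologicalSpace M] [ChartedSpace E3 M]

/-- A (pseudo-Riemannian) immersed hypersurface `F : M → S`: a smooth immersion whose induced
metric is nondegenerate, expressed in the charts of the three-manifold `M`. -/
structure IsHypersurface (F : M → E4) : Prop where
  smooth : ContMDiff (𝓡 3) (𝓡 4) ∞ F
  mem_domain : ∀ p, F p ∈ S.domain
  immersion : ∀ φ ∈ atlas E3 M, ∀ u ∈ φ.target, Function.Injective (fderiv ℝ (F ∘ φ.symm) u)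
  nondegenerate : ∀ φ ∈ atlas E3 M, ∀ u ∈ φ.target, S.IsNondegenerateAt (F ∘ φ.symm) u

/-- The second fundamental form vanishes. -/
def IsTotallyGeodesic (F : M → E4) : Prop :=
  ∀ φ ∈ atlas E3 M, ∀ u ∈ φ.target, ∀ ξ, S.IsUnitNormal (F ∘ φ.symm) u ξ →
    ∀ v w, S.secondFundamentalForm (F ∘ φ.symm) u ξ v w = 0

end Manifold

/-- `f₁ = (H'/2D)²`. -/
def f1 (r : ℝ) : ℝ := (deriv S.H r / (2 * S.D r)) ^ 2

/-- `f₂ = -(H'/2D)'`. -/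
def f2 (r : ℝ) : ℝ := -deriv (fun s => deriv S.H s / (2 * S.D s)) r

/-- `f₃ = 3 f₁ - D''/D`. -/
def f3 (r : ℝ) : ℝ := 3 * S.f1 r - deriv (deriv S.D) r / S.D r

/-- The spacetime is flat (locally Minkowski) near radius `r`: its curvature, which is determined
by `f₁, f₂, f₃`, vanishes for all radii close to `r`. -/
def IsFlatNear (r : ℝ) : Prop :=
  ∀ᶠ s in 𝓝 r, S.f1 s = 0 ∧ S.f2 s = 0 ∧ S.f3 s = 0

/-- `Ψ` is an isometry from the open subset `Ψ.source` of `S` onto the open subset `Ψ.target` of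
`T`. -/
structure IsLocalIsometry (S T : GodelType) (Ψ : OpenPartialHomeomorph E4 E4) : Prop where
  source_subset : Ψ.source ⊆ S.domain
  target_subset : Ψ.target ⊆ T.domain
  smooth : ContDiffOn ℝ ∞ Ψ Ψ.source
  smooth_symm : ContDiffOn ℝ ∞ Ψ.symm Ψ.target
  isometry : ∀ x ∈ Ψ.source, ∀ v w,
    T.metric (Ψ x) (fderiv ℝ Ψ x v) (fderiv ℝ Ψ x w) = S.metric x v w

/-- The homogeneous spacetime with `H = (2Ω/m²)(1 - cosh(mr))`, `D = sinh(mr)/m`, `r > 0`. -/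
def classI (m Ω : ℝ) (hm : 0 < m) : GodelType where
  interval := Ioi 0
  H := fun r => 2 * Ω / m ^ 2 * (1 - Real.cosh (m * r))
  D := fun r => Real.sinh (m * r) / m
  isOpen_interval := isOpen_Ioi
  ordConnected_interval := ordConnected_Ioi
  smooth_H := by
    apply ContDiff.contDiffOn
    exact contDiff_const.mul (contDiff_const.sub
      (Real.contDiff_cosh.comp (contDiff_const.mul contDiff_id)))
  smooth_D := by
    apply ContDiff.contDiffOn
    exact (Real.contDiff_sinh.comp (contDiff_const.mul contDiff_id)).div_const m
  D_ne_zero := by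
    intro r hr
    have h : 0 < m * r := mul_pos hm hr
    exact (div_pos (Real.sinh_pos_iff.mpr h) hm).ne'

/-- The limiting homogeneous spacetime: `classI` with `m² = 4Ω²`, `Ω ≠ 0`. -/
def limiting (Ω : ℝ) (hΩ : Ω ≠ 0) : GodelType :=
  classI (2 * |Ω|) Ω (mul_pos two_pos (abs_pos.mpr hΩ))

/-- The open box `(α 0, β 0) × (α 1, β 1) × (α 2, β 2)` in the coordinates `(u₁, u₂, u₃)`. -/
def _root_.openBox (α β : Fin 3 → ℝ) : Set E3 := {u | ∀ i, u i ∈ Ioo (α i) (β i)}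

/-- Family (a): `(u₁, u₂, u₃, 0)`, timelike. -/
def FormA (α β : Fin 3 → ℝ) (X : E3 → E4) : Prop :=
  (∀ u ∈ openBox α β, X u = !₂[u 0, u 1, u 2, 0]) ∧ S.IsTimelikeOn X (openBox α β)

/-- Family (b). The functions `H`, `D` under the integrals are taken along the hypersurface, i.e. at
its radius `R`, which is the second component and depends on `u₂` only. -/
def FormB (α β : Fin 3 → ℝ) (X : E3 → E4) : Prop :=
  ∃ (ρ r₀ : ℝ) (R : ℝ → ℝ),
    0 ∈ Ioo (α 1) (β 1) ∧
    ContinuousOn R (Ioo (α 1) (β 1)) ∧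
    (∀ s ∈ Ioo (α 1) (β 1), R s ∈ S.interval ∧ ρ ^ 2 ≤ S.D (R s) ^ 2 ∧
      R s = r₀ + ∫ t in (0 : ℝ)..s, √(1 - (ρ / S.D (R t)) ^ 2)) ∧
    (∃ k, ∀ s ∈ Ioo (α 1) (β 1), deriv S.H (R s) / (2 * S.D (R s)) = k) ∧
    (∀ u ∈ openBox α β, X u =
      !₂[u 0 + ρ * ∫ s in (0 : ℝ)..u 1, S.H (R s) / S.D (R s) ^ 2,
        r₀ + ∫ s in (0 : ℝ)..u 1, √(1 - (ρ / S.D (R s)) ^ 2),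
        -(ρ * ∫ s in (0 : ℝ)..u 1, 1 / S.D (R s) ^ 2),
        u 2]) ∧
    S.IsTimelikeOn X (openBox α β)

/-- `θ = ¼ ln((D' + H')/(D' - H'))`. -/
def theta (r : ℝ) : ℝ :=
  1 / 4 * Real.log ((deriv S.D r + deriv S.H r) / (deriv S.D r - deriv S.H r))

/-- `(H'/D)'`. -/
def condNum (r : ℝ) : ℝ := deriv (fun s => deriv S.H s / S.D s) r

/-- `(H'/D)² - D''/D`. -/
def condDen (r : ℝ) : ℝ := (deriv S.H r / S.D r) ^ 2 - deriv (deriv S.D) r / S.D r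

/-- Family (c). The inequality `|(H'/D)' / ((H'/D)² - D''/D)| < 1` counts as satisfied where
numerator and denominator both vanish. -/
def FormC (α β : Fin 3 → ℝ) (X : E3 → E4) : Prop :=
  (∀ r ∈ Ioo (α 0) (β 0), r ∈ S.interval ∧
    ((S.condDen r ≠ 0 ∧ |S.condNum r / S.condDen r| < 1) ∨ (S.condNum r = 0 ∧ S.condDen r = 0)) ∧
    deriv S.H r ^ 2 < deriv S.D r ^ 2) ∧
  (((∀ u ∈ openBox α β, X u =
      !₂[(S.D (u 0) * Real.tanh (S.theta (u 0)) - S.H (u 0)) * u 2, u 0, u 2, u 1]) ∧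
      S.IsSpacelikeOn X (openBox α β)) ∨
    ((∀ r ∈ Ioo (α 0) (β 0), S.theta r ≠ 0) ∧
      (∀ u ∈ openBox α β, X u =
        !₂[(S.D (u 0) * (Real.cosh (S.theta (u 0)) / Real.sinh (S.theta (u 0))) - S.H (u 0)) * u 2,
          u 0, u 2, u 1]) ∧
      S.IsTimelikeOn X (openBox α β)))

/-- Family (d). -/
def FormD (α β : Fin 3 → ℝ) (X : E3 → E4) : Prop :=
  (∃ c, ∀ r ∈ Ioo (α 1) (β 1), r ∈ S.interval ∧ S.H r = c) ∧
  ∃ θ : ℝ,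
    ((∀ u ∈ openBox α β, X u =
        !₂[Real.tanh θ * u 0 - S.H (u 1) * u 2, u 1, u 2, u 0]) ∧
      S.IsSpacelikeOn X (openBox α β)) ∨
    (θ ≠ 0 ∧
      (∀ u ∈ openBox α β, X u =
        !₂[Real.cosh θ / Real.sinh θ * u 0 - S.H (u 1) * u 2, u 1, u 2, u 0]) ∧
      S.IsTimelikeOn X (openBox α β))

/-- `X`, on the coordinate box, is one of the listed expressions in the spacetime `S`. -/
def IsListed (α β : Fin 3 → ℝ) (X : E3 → E4) : Prop :=
  S.FormA α β X ∨ S.FormB α β X ∨ S.FormC α β X ∨ S.FormD α β X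

end GodelType

end

open Set Filter Topology
open scoped Manifold ContDiff

noncomputable section

namespace GodelType

variable (S : GodelType)

/-- The components `(v⁰ + H v², v¹, D v², v³)` of a tangent vector in the orthonormal coframe
`dt + H dφ, dr, D dφ, dz`. -/
def cof (x v : E4) : Fin 4 → ℝ :=
  ![v 0 + S.H (x 1) * v 2, v 1, S.D (x 1) * v 2, v 3]

theorem metric_eq_cof (x v w : E4) :
    S.metric x v w = S.cof x v 0 * S.cof x w 0 - S.cof x v 1 * S.cof x w 1
      - S.cof x v 2 * S.cof x w 2 - S.cof x v 3 * S.cof x w 3 := by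
  simp [metric, cof]
  ring

theorem isOpen_domain : IsOpen S.domain :=
  S.isOpen_interval.preimage (by fun_prop : Continuous fun x : E4 => x 1)

variable {S}

theorem contDiffAt_H {r : ℝ} (hr : r ∈ S.interval) : ContDiffAt ℝ ∞ S.H r :=
  S.smooth_H.contDiffAt (S.isOpen_interval.mem_nhds hr)

theorem contDiffAt_D {r : ℝ} (hr : r ∈ S.interval) : ContDiffAt ℝ ∞ S.D r :=
  S.smooth_D.contDiffAt (S.isOpen_interval.mem_nhds hr)

theorem hasDerivAt_H {r : ℝ} (hr : r ∈ S.interval) : HasDerivAt S.H (deriv S.H r) r :=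
  ((contDiffAt_H hr).differentiableAt (by simp)).hasDerivAt

theorem hasDerivAt_D {r : ℝ} (hr : r ∈ S.interval) : HasDerivAt S.D (deriv S.D r) r :=
  ((contDiffAt_D hr).differentiableAt (by simp)).hasDerivAt

theorem gram_eq (x : E4) : S.gram x =
    !![1, 0, S.H (x 1), 0; 0, -1, 0, 0; S.H (x 1), 0, S.H (x 1) ^ 2 - S.D (x 1) ^ 2, 0;
      0, 0, 0, -1] := by
  ext i j
  fin_cases i <;> fin_cases j <;> simp [gram, metric] <;> ring

theorem gram_inv {x : E4} (hx : x ∈ S.domain) : (S.gram x)⁻¹ =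
    !![1 - S.H (x 1) ^ 2 / S.D (x 1) ^ 2, 0, S.H (x 1) / S.D (x 1) ^ 2, 0; 0, -1, 0, 0;
      S.H (x 1) / S.D (x 1) ^ 2, 0, -1 / S.D (x 1) ^ 2, 0; 0, 0, 0, -1] := by
  have hD := S.D_ne_zero _ hx
  apply Matrix.inv_eq_right_inv
  rw [gram_eq]
  ext i j
  fin_cases i <;> fin_cases j <;>
    simp [Matrix.mul_apply, Fin.sum_univ_four] <;> field_simp <;> ring

theorem fderiv_comp_radius {f : ℝ → ℝ} {f' : ℝ} {x : E4} (hf : HasDerivAt f f' (x 1)) (l : Fin 4) :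
    fderiv ℝ (fun y : E4 => f (y 1)) x (EuclideanSpace.single l 1) = if l = 1 then f' else 0 := by
  have h1 : HasFDerivAt (fun y : E4 => y 1) (EuclideanSpace.proj (𝕜 := ℝ) (1 : Fin 4)) x :=
    (EuclideanSpace.proj (𝕜 := ℝ) (1 : Fin 4)).hasFDerivAt
  have h2 := hf.comp_hasFDerivAt x h1
  rw [show (fun y : E4 => f (y 1)) = f ∘ fun y : E4 => y 1 from rfl, h2.fderiv]
  by_cases hl : l = 1
  · subst hl; simp
  · simp [hl, Ne.symm hl]

theorem dGram_eq {x : E4} (hx : x ∈ S.domain) (l i j : Fin 4) : S.dGram x l i j =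
    if l = 1 then !![0, 0, deriv S.H (x 1), 0; 0, 0, 0, 0; deriv S.H (x 1), 0,
      2 * S.H (x 1) * deriv S.H (x 1) - 2 * S.D (x 1) * deriv S.D (x 1), 0; 0, 0, 0, 0] i j
    else 0 := by
  have hH := hasDerivAt_H hx
  have hD := hasDerivAt_D hx
  have h2 : HasDerivAt (fun r => S.H r ^ 2 - S.D r ^ 2)
      (2 * S.H (x 1) * deriv S.H (x 1) - 2 * S.D (x 1) * deriv S.D (x 1)) (x 1) :=
    ((hH.pow 2).sub (hD.pow 2)).congr_deriv (by norm_num)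
  have hH' := fderiv_comp_radius hH l
  have h2' := fderiv_comp_radius h2 l
  simp only [dGram, gram_eq]
  fin_cases i <;> fin_cases j <;>
    first
    | (simp; done)
    | simpa using hH'
    | simpa using h2'

/-- The radial derivative of the metric. -/
def radialForm (S : GodelType) (x V W : E4) : ℝ :=
  deriv S.H (x 1) * (V 0 * W 2 + V 2 * W 0)
    + (2 * S.H (x 1) * deriv S.H (x 1) - 2 * S.D (x 1) * deriv S.D (x 1)) * (V 2 * W 2)

theorem metric_christoffel {x : E4} (hx : x ∈ S.domain) (V W ξ : E4) :
    S.metric x (WithLp.toLp 2 fun k => ∑ i, ∑ j, S.christoffel x k i j * V i * W j) ξ =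
      1 / 2 * (V 1 * S.radialForm x W ξ + W 1 * S.radialForm x V ξ
        - ξ 1 * S.radialForm x V W) := by
  have hD := S.D_ne_zero _ hx
  simp only [metric, christoffel, gram_inv hx, dGram_eq hx, Fin.sum_univ_four, radialForm]
  simp
  field_simp
  ring

theorem metric_covDeriv {X : E3 → E4} {u : E3} (hx : X u ∈ S.domain) (v w : E3) (ξ : E4) :
    S.metric (X u) (S.covDeriv X u v w) ξ =
      S.metric (X u) (fderiv ℝ (fun u' => fderiv ℝ X u' w) u v) ξ +
      1 / 2 * (fderiv ℝ X u v 1 * S.radialForm (X u) (fderiv ℝ X u w) ξ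
        + fderiv ℝ X u w 1 * S.radialForm (X u) (fderiv ℝ X u v) ξ
        - ξ 1 * S.radialForm (X u) (fderiv ℝ X u v) (fderiv ℝ X u w)) := by
  rw [← metric_christoffel hx]
  simp only [covDeriv, metric]
  ring

end GodelType

section LineDeriv

variable {E : Type*} [NormedAddCommGroup E] [NormedSpace ℝ E] {f g : E → ℝ} {f' g' : ℝ} {u v : E}

theorem HasLineDerivAt.add (hf : HasLineDerivAt ℝ f f' u v) (hg : HasLineDerivAt ℝ g g' u v) :
    HasLineDerivAt ℝ (fun x => f x + g x) (f' + g') u v :=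
  HasDerivAt.add hf hg

theorem HasLineDerivAt.sub (hf : HasLineDerivAt ℝ f f' u v) (hg : HasLineDerivAt ℝ g g' u v) :
    HasLineDerivAt ℝ (fun x => f x - g x) (f' - g') u v :=
  HasDerivAt.sub hf hg

theorem HasLineDerivAt.neg (hf : HasLineDerivAt ℝ f f' u v) :
    HasLineDerivAt ℝ (fun x => -f x) (-f') u v :=
  HasDerivAt.neg hf

theorem HasLineDerivAt.mul (hf : HasLineDerivAt ℝ f f' u v) (hg : HasLineDerivAt ℝ g g' u v) :
    HasLineDerivAt ℝ (fun x => f x * g x) (f' * g u + f u * g') u v := by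
  have h := HasDerivAt.mul hf hg
  simp only [zero_smul, add_zero] at h
  exact h

theorem HasLineDerivAt.comp_left {h : ℝ → ℝ} {h' : ℝ} (hh : HasDerivAt h h' (f u))
    (hf : HasLineDerivAt ℝ f f' u v) : HasLineDerivAt ℝ (fun x => h (f x)) (h' * f') u v := by
  have hh0 : HasDerivAt h h' (f (u + (0 : ℝ) • v)) := by simpa using hh
  exact HasDerivAt.comp (h₂ := h) (h := fun t : ℝ => f (u + t • v)) 0 hh0 hf

theorem hasLineDerivAt_const (c : ℝ) : HasLineDerivAt ℝ (fun _ : E => c) 0 u v :=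
  hasDerivAt_const _ _

theorem ContDiffOn.hasLineDerivAt {O : Set E} (hO : IsOpen O) (hf : ContDiffOn ℝ ∞ f O)
    (hu : u ∈ O) (v : E) : HasLineDerivAt ℝ f (fderiv ℝ f u v) u v :=
  ((hf.contDiffAt (hO.mem_nhds hu)).differentiableAt (by simp)).hasFDerivAt.hasLineDerivAt v

theorem HasLineDerivAt.eq_fderiv {O : Set E} (hO : IsOpen O) (hf : ContDiffOn ℝ ∞ f O)
    (hu : u ∈ O) (h : HasLineDerivAt ℝ f f' u v) : fderiv ℝ f u v = f' :=
  (ContDiffOn.hasLineDerivAt hO hf hu v).unique h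

theorem HasLineDerivAt.congr_deriv (h : HasLineDerivAt ℝ f f' u v) (h' : f' = g') :
    HasLineDerivAt ℝ f g' u v :=
  h' ▸ h

theorem HasLineDerivAt.congr_on {O : Set E} (hO : IsOpen O) (hu : u ∈ O) (hfg : ∀ x ∈ O, g x = f x)
    (h : HasLineDerivAt ℝ f f' u v) : HasLineDerivAt ℝ g f' u v := by
  have : f =ᶠ[𝓝 u] g := by
    filter_upwards [hO.mem_nhds hu] with x hx using (hfg x hx).symm
  exact (this.hasLineDerivAt_iff).1 h

end LineDeriv

section SecondDeriv

variable {F : Type*} [NormedAddCommGroup F] [NormedSpace ℝ F]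

theorem ContDiffOn.fderiv_apply_const {f : E3 → F} {O : Set E3} (hO : IsOpen O)
    (hf : ContDiffOn ℝ ∞ f O) (w : E3) : ContDiffOn ℝ ∞ (fun x => fderiv ℝ f x w) O :=
  (hf.fderiv_of_isOpen hO (by simp)).clm_apply contDiffOn_const

theorem ContDiffAt.fderiv_fderiv_comm {f : E3 → F} {u : E3} (hf : ContDiffAt ℝ ∞ f u) (v w : E3) :
    fderiv ℝ (fun x => fderiv ℝ f x w) u v = fderiv ℝ (fun x => fderiv ℝ f x v) u w := by
  have hd : DifferentiableAt ℝ (fderiv ℝ f) u :=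
    (hf.fderiv_right (m := 1) (by norm_cast)).differentiableAt (by simp)
  have h (w' : E3) : fderiv ℝ (fun x => fderiv ℝ f x w') u
      = (fderiv ℝ (fderiv ℝ f) u).flip w' := by
    simp [fderiv_clm_apply hd (differentiableAt_const w')]
  have hs : IsSymmSndFDerivAt ℝ f u := hf.isSymmSndFDerivAt (by
    simpa using (WithTop.coe_le_coe.2 le_top : ((2 : ℕ∞) : WithTop ℕ∞) ≤ ((⊤ : ℕ∞) : WithTop ℕ∞)))
  rw [h, h]
  exact hs v w

theorem fderiv_euclidean_apply {n : ℕ} {f : E3 → EuclideanSpace ℝ (Fin n)} {u : E3}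
    (hf : DifferentiableAt ℝ f u) (v : E3) (i : Fin n) :
    fderiv ℝ (fun x => f x i) u v = fderiv ℝ f u v i := by
  have := (EuclideanSpace.proj (𝕜 := ℝ) i).hasFDerivAt.comp u hf.hasFDerivAt
  rw [show (fun x => f x i) = (EuclideanSpace.proj (𝕜 := ℝ) i) ∘ f from rfl, this.fderiv]
  simp

theorem HasFDerivAt.hasLineDerivAt_apply {n : ℕ} {f : E3 → EuclideanSpace ℝ (Fin n)} {u : E3}
    (hf : DifferentiableAt ℝ f u) (v : E3) (i : Fin n) :
    HasLineDerivAt ℝ (fun x => f x i) (fderiv ℝ f u v i) u v := by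
  rw [← fderiv_euclidean_apply hf]
  exact ((EuclideanSpace.proj (𝕜 := ℝ) i).differentiableAt.comp u hf).hasFDerivAt.hasLineDerivAt v

end SecondDeriv

/-- The signed `3 × 3` minors of three vectors of `ℝ⁴`. -/
def minors (A : Fin 3 → Fin 4 → ℝ) : Fin 4 → ℝ :=
  let m (i j k : Fin 4) := A 0 i * (A 1 j * A 2 k - A 1 k * A 2 j)
    - A 0 j * (A 1 i * A 2 k - A 1 k * A 2 i) + A 0 k * (A 1 i * A 2 j - A 1 j * A 2 i)
  ![m 1 2 3, -m 0 2 3, m 0 1 3, -m 0 1 2]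

theorem det_eq_minors (A : Fin 3 → Fin 4 → ℝ) (y : Fin 4 → ℝ) :
    (Matrix.of (![y, A 0, A 1, A 2]) : Matrix (Fin 4) (Fin 4) ℝ).det = ∑ i, minors A i * y i := by
  simp [Matrix.det_succ_row_zero, Fin.sum_univ_succ, minors, Fin.succAbove]
  ring

theorem sum_minors_mul (A : Fin 3 → Fin 4 → ℝ) (j : Fin 3) : ∑ i, minors A i * A j i = 0 := by
  fin_cases j <;> simp [Fin.sum_univ_four, minors] <;> ring

section Minors

variable (L : E3 →ₗ[ℝ] (Fin 4 → ℝ))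

/-- The images of the standard basis vectors. -/
def frameImage (j : Fin 3) : Fin 4 → ℝ := L (EuclideanSpace.single j 1)

theorem map_eq_sum_frameImage (v : E3) : L v = ∑ j, v j • frameImage L j := by
  have : v = ∑ j, v j • EuclideanSpace.single j (1 : ℝ) := by
    ext i
    fin_cases i <;> simp [Fin.sum_univ_three]
  conv_lhs => rw [this]
  simp [frameImage]

theorem sum_minors_map (v : E3) : ∑ i, minors (frameImage L) i * L v i = 0 := by
  rw [map_eq_sum_frameImage]
  have h0 := sum_minors_mul (frameImage L) 0
  have h1 := sum_minors_mul (frameImage L) 1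
  have h2 := sum_minors_mul (frameImage L) 2
  simp only [Fin.sum_univ_four, Fin.sum_univ_three, Pi.add_apply, Pi.smul_apply,
    smul_eq_mul] at *
  linear_combination v 0 * h0 + v 1 * h1 + v 2 * h2

theorem exists_relation {y : Fin 4 → ℝ} (h : ∑ i, minors (frameImage L) i * y i = 0) :
    ∃ (s : ℝ) (v : E3), (s ≠ 0 ∨ v ≠ 0) ∧ s • y + L v = 0 := by
  rw [← det_eq_minors] at h
  obtain ⟨c, hc, hc0⟩ := Matrix.exists_vecMul_eq_zero_iff.2 h
  refine ⟨c 0, !₂[c 1, c 2, c 3], ?_, ?_⟩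
  · by_contra! hcon
    apply hc
    have h1 := congrArg (fun v : E3 => v 0) hcon.2
    have h2 := congrArg (fun v : E3 => v 1) hcon.2
    have h3 := congrArg (fun v : E3 => v 2) hcon.2
    ext i
    fin_cases i <;> simp_all
  · rw [map_eq_sum_frameImage, ← hc0]
    ext i
    simp [Matrix.vecMul, dotProduct, Fin.sum_univ_succ]

variable {L}

theorem exists_map_eq (hL : Function.Injective L) {y : Fin 4 → ℝ} (h : ∑ i, minors (frameImage L) i * y i = 0) :
    ∃ v, L v = y := by
  obtain ⟨s, v, hsv, h0⟩ := exists_relation L h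
  have hs : s ≠ 0 := by
    rintro rfl
    rcases hsv with h1 | h1
    · exact h1 rfl
    · exact h1 (hL (by simpa using h0))
  refine ⟨-(s⁻¹ • v), ?_⟩
  rw [map_neg, map_smul, eq_neg_of_add_eq_zero_right h0, smul_neg, neg_neg, smul_smul,
    inv_mul_cancel₀ hs, one_smul]

theorem minors_ne_zero (hL : Function.Injective L) : minors (frameImage L) ≠ 0 := by
  intro h0
  have hsurj : Function.Surjective L := fun y => exists_map_eq hL (by simp [h0])
  have := LinearMap.finrank_le_finrank_of_injective (f := (LinearEquiv.ofBijective L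
    ⟨hL, hsurj⟩).symm.toLinearMap) (LinearEquiv.injective _)
  simp at this

theorem minors_nonnull (hL : Function.Injective L)
    (hnd : ∀ v, (∀ w, L v 0 * L w 0 - L v 1 * L w 1 - L v 2 * L w 2 - L v 3 * L w 3 = 0) → v = 0) :
    minors (frameImage L) 0 ^ 2 - minors (frameImage L) 1 ^ 2 - minors (frameImage L) 2 ^ 2
      - minors (frameImage L) 3 ^ 2 ≠ 0 := by
  intro hq
  set n := minors (frameImage L) with hn
  have hn0 : n ≠ 0 := minors_ne_zero hL
  obtain ⟨s, v, hsv, h0⟩ := exists_relation L (y := ![n 0, -n 1, -n 2, -n 3]) (by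
    rw [← hn]
    simp [Fin.sum_univ_four]
    linarith)
  have hc (i : Fin 4) := congrFun h0 i
  have hv : v = 0 := by
    apply hnd
    intro w
    have hw := sum_minors_map L w
    have h0 := hc 0
    have h1 := hc 1
    have h2 := hc 2
    have h3 := hc 3
    rw [← hn] at hw
    simp [Fin.sum_univ_four] at hw h0 h1 h2 h3
    linear_combination -s * hw + h0 * L w 0 - h1 * L w 1 - h2 * L w 2 - h3 * L w 3
  subst hv
  have hs : s ≠ 0 := by simpa using hsv
  apply hn0
  ext i
  have := hc i
  fin_cases i <;> simpa [hs] using this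

end Minors

namespace GodelType

variable {S : GodelType}

/-- `-H' / 2D`. -/
def twist (S : GodelType) (r : ℝ) : ℝ := -(deriv S.H r / (2 * S.D r))

/-- `D' / D`. -/
def logDeriv (S : GodelType) (r : ℝ) : ℝ := deriv S.D r / S.D r

theorem twist_sq (r : ℝ) : S.twist r ^ 2 = S.f1 r := by
  simp [twist, f1]

theorem deriv_H_eq {r : ℝ} (hr : r ∈ S.interval) : deriv S.H r = -2 * S.twist r * S.D r := by
  have := S.D_ne_zero r hr
  simp only [twist]
  field_simp

theorem deriv_D_eq {r : ℝ} (hr : r ∈ S.interval) : deriv S.D r = S.logDeriv r * S.D r := by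
  have := S.D_ne_zero r hr
  simp only [logDeriv]
  field_simp

theorem contDiffOn_deriv_H : ContDiffOn ℝ ∞ (deriv S.H) S.interval :=
  ((contDiffOn_infty_iff_deriv_of_isOpen S.isOpen_interval).1 S.smooth_H).2

theorem contDiffOn_deriv_D : ContDiffOn ℝ ∞ (deriv S.D) S.interval :=
  ((contDiffOn_infty_iff_deriv_of_isOpen S.isOpen_interval).1 S.smooth_D).2

theorem contDiffOn_deriv_deriv_D : ContDiffOn ℝ ∞ (deriv (deriv S.D)) S.interval :=
  ((contDiffOn_infty_iff_deriv_of_isOpen S.isOpen_interval).1 contDiffOn_deriv_D).2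

theorem contDiffOn_twist : ContDiffOn ℝ ∞ S.twist S.interval :=
  (contDiffOn_deriv_H.div (contDiffOn_const.mul S.smooth_D) fun r hr => by
    simpa using S.D_ne_zero r hr).neg

theorem hasDerivAt_of_contDiffOn {f : ℝ → ℝ} (hf : ContDiffOn ℝ ∞ f S.interval) {r : ℝ}
    (hr : r ∈ S.interval) : HasDerivAt f (deriv f r) r :=
  ((hf.contDiffAt (S.isOpen_interval.mem_nhds hr)).differentiableAt (by simp)).hasDerivAt

theorem hasDerivAt_twist {r : ℝ} (hr : r ∈ S.interval) : HasDerivAt S.twist (S.f2 r) r := by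
  have h := hasDerivAt_of_contDiffOn contDiffOn_twist hr
  have h2 : deriv S.twist r = S.f2 r := by
    simp only [f2, ← deriv.fun_neg]
    rfl
  rwa [h2] at h

theorem hasDerivAt_logDeriv {r : ℝ} (hr : r ∈ S.interval) :
    HasDerivAt S.logDeriv (3 * S.twist r ^ 2 - S.f3 r - S.logDeriv r ^ 2) r := by
  have hD := S.D_ne_zero r hr
  refine ((hasDerivAt_of_contDiffOn contDiffOn_deriv_D hr).div (hasDerivAt_D hr) hD).congr_deriv ?_
  simp only [f3, logDeriv, twist_sq]
  field_simp
  ring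

/-- The coframe components of `dX v`. -/
def cofX (S : GodelType) (X : E3 → E4) (u v : E3) : Fin 4 → ℝ := S.cof (X u) (fderiv ℝ X u v)

/-- `cofX` as a linear map. -/
def cofL (S : GodelType) (X : E3 → E4) (u : E3) : E3 →ₗ[ℝ] (Fin 4 → ℝ) where
  toFun := S.cofX X u
  map_add' v w := by
    ext i
    fin_cases i <;> simp [cofX, cof] <;> ring
  map_smul' c v := by
    ext i
    fin_cases i <;> simp [cofX, cof] <;> ring

theorem inducedMetric_eq (X : E3 → E4) (u v w : E3) : S.inducedMetric X u v w =
    S.cofX X u v 0 * S.cofX X u w 0 - S.cofX X u v 1 * S.cofX X u w 1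
      - S.cofX X u v 2 * S.cofX X u w 2 - S.cofX X u v 3 * S.cofX X u w 3 :=
  S.metric_eq_cof _ _ _

theorem eq_zero_of_cof_eq_zero {x v : E4} (hx : x ∈ S.domain) (h : ∀ i, S.cof x v i = 0) :
    v = 0 := by
  have hD := S.D_ne_zero _ hx
  have h0 := h 0
  have h1 := h 1
  have h2 := h 2
  have h3 := h 3
  simp [cof, hD] at h0 h1 h2 h3
  ext i
  fin_cases i <;> simp_all

/-- A parametrized totally geodesic hypersurface on the open set `O`, together with a unit normal
with components `(a, b, c, d)` in the orthonormal frame dual to the coframe. -/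
structure IsAdapted (S : GodelType) (X : E3 → E4) (ε : ℝ) (a b c d : E3 → ℝ) (O : Set E3) :
    Prop where
  isOpen : IsOpen O
  smooth : ContDiffOn ℝ ∞ X O
  smooth_a : ContDiffOn ℝ ∞ a O
  smooth_b : ContDiffOn ℝ ∞ b O
  smooth_c : ContDiffOn ℝ ∞ c O
  smooth_d : ContDiffOn ℝ ∞ d O
  mem : ∀ u ∈ O, X u 1 ∈ S.interval
  sign : ε = 1 ∨ ε = -1
  unit : ∀ u ∈ O, a u ^ 2 - b u ^ 2 - c u ^ 2 - d u ^ 2 = ε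
  tangent : ∀ u ∈ O, ∀ v, a u * S.cofX X u v 0 =
    b u * S.cofX X u v 1 + c u * S.cofX X u v 2 + d u * S.cofX X u v 3
  surj : ∀ u ∈ O, ∀ y : Fin 4 → ℝ, a u * y 0 = b u * y 1 + c u * y 2 + d u * y 3 →
    ∃ v, S.cofX X u v = y
  inj : ∀ u ∈ O, ∀ v, S.cofX X u v = 0 → v = 0
  fderiv_a : ∀ u ∈ O, ∀ v, fderiv ℝ a u v =
    S.twist (X u 1) * (b u * S.cofX X u v 2 - c u * S.cofX X u v 1)
  fderiv_b : ∀ u ∈ O, ∀ v, fderiv ℝ b u v = S.twist (X u 1) * a u * S.cofX X u v 2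
    + c u * (S.twist (X u 1) * S.cofX X u v 0 + S.logDeriv (X u 1) * S.cofX X u v 2)
  fderiv_c : ∀ u ∈ O, ∀ v, fderiv ℝ c u v = -(S.twist (X u 1) * a u * S.cofX X u v 1)
    - b u * (S.twist (X u 1) * S.cofX X u v 0 + S.logDeriv (X u 1) * S.cofX X u v 2)
  fderiv_d : ∀ u ∈ O, ∀ v, fderiv ℝ d u v = 0

theorem IsAdapted.mono {X : E3 → E4} {ε : ℝ} {a b c d : E3 → ℝ} {O O' : Set E3}
    (h : S.IsAdapted X ε a b c d O) (hO' : IsOpen O') (hsub : O' ⊆ O) :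
    S.IsAdapted X ε a b c d O' where
  isOpen := hO'
  smooth := h.smooth.mono hsub
  smooth_a := h.smooth_a.mono hsub
  smooth_b := h.smooth_b.mono hsub
  smooth_c := h.smooth_c.mono hsub
  smooth_d := h.smooth_d.mono hsub
  mem u hu := h.mem u (hsub hu)
  sign := h.sign
  unit u hu := h.unit u (hsub hu)
  tangent u hu := h.tangent u (hsub hu)
  surj u hu := h.surj u (hsub hu)
  inj u hu := h.inj u (hsub hu)
  fderiv_a u hu := h.fderiv_a u (hsub hu)
  fderiv_b u hu := h.fderiv_b u (hsub hu)
  fderiv_c u hu := h.fderiv_c u (hsub hu)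
  fderiv_d u hu := h.fderiv_d u (hsub hu)

/-- The derivatives of the coframe components along `X`. -/
theorem hasLineDerivAt_cofX {X : E3 → E4} {O : Set E3} (hO : IsOpen O) (hX : ContDiffOn ℝ ∞ X O)
    (hmem : ∀ u ∈ O, X u 1 ∈ S.interval) {u : E3} (hu : u ∈ O) (v w : E3) :
    HasLineDerivAt ℝ (fun x => S.cofX X x w 0)
      (fderiv ℝ (fun x => fderiv ℝ X x w) u v 0
        + S.H (X u 1) * fderiv ℝ (fun x => fderiv ℝ X x w) u v 2
        + deriv S.H (X u 1) * fderiv ℝ X u v 1 * fderiv ℝ X u w 2) u v ∧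
    HasLineDerivAt ℝ (fun x => S.cofX X x w 1)
      (fderiv ℝ (fun x => fderiv ℝ X x w) u v 1) u v ∧
    HasLineDerivAt ℝ (fun x => S.cofX X x w 2)
      (S.D (X u 1) * fderiv ℝ (fun x => fderiv ℝ X x w) u v 2
        + deriv S.D (X u 1) * fderiv ℝ X u v 1 * fderiv ℝ X u w 2) u v ∧
    HasLineDerivAt ℝ (fun x => S.cofX X x w 3)
      (fderiv ℝ (fun x => fderiv ℝ X x w) u v 3) u v := by
  have hd : DifferentiableAt ℝ X u :=
    (hX.contDiffAt (hO.mem_nhds hu)).differentiableAt (by simp)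
  have hd2 : DifferentiableAt ℝ (fun x => fderiv ℝ X x w) u :=
    ((hX.fderiv_apply_const hO w).contDiffAt (hO.mem_nhds hu)).differentiableAt (by simp)
  have h (i : Fin 4) := HasFDerivAt.hasLineDerivAt_apply hd2 v i
  have h1 := HasFDerivAt.hasLineDerivAt_apply hd v 1
  have hH := HasLineDerivAt.comp_left (f := fun x => X x 1) (hasDerivAt_H (hmem u hu)) h1
  have hD := HasLineDerivAt.comp_left (f := fun x => X x 1) (hasDerivAt_D (hmem u hu)) h1
  refine ⟨?_, h 1, ?_, h 3⟩
  · exact ((h 0).add (hH.mul (h 2))).congr_deriv (by ring)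
  · exact (hD.mul (h 2)).congr_deriv (by ring)

theorem contDiffOn_comp_radius {X : E3 → E4} {O : Set E3} (hX : ContDiffOn ℝ ∞ X O)
    (hmem : ∀ u ∈ O, X u 1 ∈ S.interval) {f : ℝ → ℝ} (hf : ContDiffOn ℝ ∞ f S.interval) :
    ContDiffOn ℝ ∞ (fun u => f (X u 1)) O :=
  hf.comp (contDiffOn_euclidean.1 hX 1) hmem

theorem contDiffOn_cofX {X : E3 → E4} {O : Set E3} (hO : IsOpen O) (hX : ContDiffOn ℝ ∞ X O)
    (hmem : ∀ u ∈ O, X u 1 ∈ S.interval) (w : E3) (i : Fin 4) :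
    ContDiffOn ℝ ∞ (fun u => S.cofX X u w i) O := by
  have h := contDiffOn_euclidean.1 (hX.fderiv_apply_const hO w)
  have hH := contDiffOn_comp_radius hX hmem S.smooth_H
  have hD := contDiffOn_comp_radius hX hmem S.smooth_D
  fin_cases i
  · exact (h 0).add (hH.mul (h 2))
  · exact h 1
  · exact hD.mul (h 2)
  · exact h 3

end GodelType

namespace GodelType

variable {S : GodelType}

/-- The tangent vector with components `y` in the orthonormal frame. -/
def frameVec (S : GodelType) (x : E4) (y : Fin 4 → ℝ) : E4 :=
  !₂[y 0 - y 2 * S.H (x 1) / S.D (x 1), y 1, y 2 / S.D (x 1), y 3]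

theorem cof_frameVec {x : E4} (hx : x ∈ S.domain) (y : Fin 4 → ℝ) :
    S.cof x (S.frameVec x y) = y := by
  have := S.D_ne_zero _ hx
  ext i
  fin_cases i <;> simp [cof, frameVec] <;> field_simp
  ring

section Parallel

variable {X : E3 → E4} {O : Set E3} {ε : ℝ} {a b c d : E3 → ℝ}

theorem parallel_normal (hO : IsOpen O) (hX : ContDiffOn ℝ ∞ X O)
    (hmem : ∀ u ∈ O, X u 1 ∈ S.interval) (ha : ContDiffOn ℝ ∞ a O) (hb : ContDiffOn ℝ ∞ b O)
    (hc : ContDiffOn ℝ ∞ c O) (hd : ContDiffOn ℝ ∞ d O) (hε : ε = 1 ∨ ε = -1)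
    (hunit : ∀ u ∈ O, a u ^ 2 - b u ^ 2 - c u ^ 2 - d u ^ 2 = ε)
    (htan : ∀ u ∈ O, ∀ v, a u * S.cofX X u v 0 =
      b u * S.cofX X u v 1 + c u * S.cofX X u v 2 + d u * S.cofX X u v 3)
    (hsurj : ∀ u ∈ O, ∀ y : Fin 4 → ℝ, a u * y 0 = b u * y 1 + c u * y 2 + d u * y 3 →
      ∃ v, S.cofX X u v = y)
    (hgeo : ∀ u ∈ O, ∀ ξ, S.IsUnitNormal X u ξ →
      ∀ v w, S.secondFundamentalForm X u ξ v w = 0) :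
    ∀ u ∈ O, ∀ v,
      fderiv ℝ a u v = S.twist (X u 1) * (b u * S.cofX X u v 2 - c u * S.cofX X u v 1) ∧
      fderiv ℝ b u v = S.twist (X u 1) * a u * S.cofX X u v 2
        + c u * (S.twist (X u 1) * S.cofX X u v 0 + S.logDeriv (X u 1) * S.cofX X u v 2) ∧
      fderiv ℝ c u v = -(S.twist (X u 1) * a u * S.cofX X u v 1)
        - b u * (S.twist (X u 1) * S.cofX X u v 0 + S.logDeriv (X u 1) * S.cofX X u v 2) ∧
      fderiv ℝ d u v = 0 := by
  intro u hu v
  have hx : X u ∈ S.domain := hmem u hu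
  have hD := S.D_ne_zero _ hx
  have hεε : ε * ε = 1 := by rcases hε with rfl | rfl <;> norm_num
  have la := ContDiffOn.hasLineDerivAt hO ha hu v
  have lb := ContDiffOn.hasLineDerivAt hO hb hu v
  have lc := ContDiffOn.hasLineDerivAt hO hc hu v
  have ld := ContDiffOn.hasLineDerivAt hO hd hu v
  set ξ := S.frameVec (X u) ![a u, b u, c u, d u] with hξ
  have hcξ : S.cof (X u) ξ = ![a u, b u, c u, d u] := cof_frameVec hx _
  have hξξ : S.metric (X u) ξ ξ = ε := by
    rw [metric_eq_cof, hcξ, ← hunit u hu]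
    simp
    ring
  have hnormal : S.IsUnitNormal X u ξ := by
    refine ⟨by rwa [hξξ], fun w => ?_⟩
    rw [metric_eq_cof, hcξ]
    have := htan u hu w
    simp only [cofX] at this
    simp
    linarith
  set δ0 := fderiv ℝ a u v - S.twist (X u 1) * (b u * S.cofX X u v 2 - c u * S.cofX X u v 1)
    with hδ0
  set δ1 := fderiv ℝ b u v - (S.twist (X u 1) * a u * S.cofX X u v 2
        + c u * (S.twist (X u 1) * S.cofX X u v 0 + S.logDeriv (X u 1) * S.cofX X u v 2)) with hδ1
  set δ2 := fderiv ℝ c u v - (-(S.twist (X u 1) * a u * S.cofX X u v 1)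
        - b u * (S.twist (X u 1) * S.cofX X u v 0 + S.logDeriv (X u 1) * S.cofX X u v 2)) with hδ2
  have key (w : E3) : δ0 * S.cofX X u w 0 - δ1 * S.cofX X u w 1 - δ2 * S.cofX X u w 2
      - fderiv ℝ d u v * S.cofX X u w 3 = 0 := by
    have hg : S.metric (X u) (S.covDeriv X u v w) ξ = 0 := by
      have := hgeo u hu ξ hnormal v w
      rw [secondFundamentalForm, hξξ] at this
      have hε0 : ε ≠ 0 := by rintro rfl; simp at hεε
      exact (mul_eq_zero.1 this).resolve_left hε0
    rw [metric_covDeriv hx, metric_eq_cof, hcξ] at hg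
    obtain ⟨l0, l1, l2, l3⟩ := hasLineDerivAt_cofX hO hX hmem hu v w
    have h1 := HasLineDerivAt.congr_on hO hu (fun x hx => htan x hx w)
      (((lb.mul l1).add (lc.mul l2)).add (ld.mul l3))
    have h2 := HasLineDerivAt.unique (la.mul l0) h1
    simp only [radialForm, hξ, frameVec, cof] at hg
    simp [hδ0, hδ1, hδ2, cofX, cof, twist, logDeriv] at hg h2 ⊢
    field_simp at hg h2 ⊢
    linear_combination 2 * S.D (X u 1) * h2 - hg
  have keyξ : δ0 * a u - δ1 * b u - δ2 * c u - fderiv ℝ d u v * d u = 0 := by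
    have h1 := HasLineDerivAt.congr_on hO hu (fun x hx => (hunit x hx).symm)
      ((((la.mul la).congr_deriv rfl).sub (lb.mul lb)).sub (lc.mul lc) |>.sub (ld.mul ld)
        |> fun h => by simpa only [← pow_two] using h)
    have h2 := HasLineDerivAt.unique (hasLineDerivAt_const ε) h1
    simp only [hδ0, hδ1, hδ2]
    linear_combination -(1 / 2) * h2
  have hu1 := hunit u hu
  have sel (y0 y1 y2 y3 : ℝ) : δ0 * y0 - δ1 * y1 - δ2 * y2 - fderiv ℝ d u v * y3 = 0 := by
    set s := ε * (a u * y0 - b u * y1 - c u * y2 - d u * y3) with hs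
    obtain ⟨w, hw⟩ := hsurj u hu
      ![y0 - s * a u, y1 - s * b u, y2 - s * c u, y3 - s * d u] (by
        simp
        linear_combination -s * hu1 + (-(a u * y0 - b u * y1 - c u * y2 - d u * y3)) * hεε)
    have := key w
    rw [hw] at this
    simp at this
    linear_combination this + s * keyξ
  have s0 := sel 1 0 0 0
  have s1 := sel 0 1 0 0
  have s2 := sel 0 0 1 0
  have s3 := sel 0 0 0 1
  simp only [hδ0, hδ1, hδ2] at s0 s1 s2
  exact ⟨by linarith, by linarith, by linarith, by linarith⟩

theorem exists_isAdapted (hO : IsOpen O) (hne : O.Nonempty) (hX : ContDiffOn ℝ ∞ X O)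
    (hmem : ∀ u ∈ O, X u 1 ∈ S.interval) (himm : ∀ u ∈ O, Function.Injective (fderiv ℝ X u))
    (hnd : ∀ u ∈ O, S.IsNondegenerateAt X u)
    (hgeo : ∀ u ∈ O, ∀ ξ, S.IsUnitNormal X u ξ →
      ∀ v w, S.secondFundamentalForm X u ξ v w = 0) :
    ∃ O' ⊆ O, O'.Nonempty ∧ ∃ (ε : ℝ) (a b c d : E3 → ℝ), S.IsAdapted X ε a b c d O' := by
  have hinj : ∀ u ∈ O, Function.Injective (S.cofL X u) := by
    intro u hu
    refine (injective_iff_map_eq_zero _).2 fun v hv => himm u hu ?_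
    rw [map_zero]
    exact eq_zero_of_cof_eq_zero (hmem u hu) (congrFun hv)
  set n : E3 → Fin 4 → ℝ := fun u => minors (frameImage (S.cofL X u)) with hn
  have hns (i : Fin 4) : ContDiffOn ℝ ∞ (fun u => n u i) O := by
    have h (j : Fin 3) (i : Fin 4) :
        ContDiffOn ℝ ∞ (fun u => frameImage (S.cofL X u) j i) O :=
      contDiffOn_cofX hO hX hmem _ i
    have hm (i j k : Fin 4) := (((h 0 i).mul (((h 1 j).mul (h 2 k)).sub ((h 1 k).mul (h 2 j)))).sub
      ((h 0 j).mul (((h 1 i).mul (h 2 k)).sub ((h 1 k).mul (h 2 i))))).add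
      ((h 0 k).mul (((h 1 i).mul (h 2 j)).sub ((h 1 j).mul (h 2 i))))
    fin_cases i
    · exact hm 1 2 3
    · exact (hm 0 2 3).neg
    · exact hm 0 1 3
    · exact (hm 0 1 2).neg
  set q : E3 → ℝ := fun u => n u 0 ^ 2 - n u 1 ^ 2 - n u 2 ^ 2 - n u 3 ^ 2 with hq
  have hqs : ContDiffOn ℝ ∞ q O :=
    ((((hns 0).pow 2).sub ((hns 1).pow 2)).sub ((hns 2).pow 2)).sub ((hns 3).pow 2)
  have hq0 : ∀ u ∈ O, q u ≠ 0 := by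
    intro u hu
    refine minors_nonnull (hinj u hu) fun v hv => hnd u hu v fun w => ?_
    rw [inducedMetric_eq]
    exact hv w
  obtain ⟨u₀, hu₀⟩ := hne
  obtain ⟨ε, hε, hεq⟩ : ∃ ε : ℝ, (ε = 1 ∨ ε = -1) ∧ 0 < ε * q u₀ := by
    rcases (hq0 u₀ hu₀).lt_or_gt with h | h
    · exact ⟨-1, Or.inr rfl, by linarith⟩
    · exact ⟨1, Or.inl rfl, by linarith⟩
  have hεε : ε * ε = 1 := by rcases hε with rfl | rfl <;> norm_num
  set O' : Set E3 := O ∩ (fun u => ε * q u) ⁻¹' Ioi 0 with hO'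
  have hO'o : IsOpen O' :=
    (continuousOn_const.mul hqs.continuousOn).isOpen_inter_preimage hO isOpen_Ioi
  have hsub : O' ⊆ O := inter_subset_left
  have hpos : ∀ u ∈ O', 0 < ε * q u := fun u hu => hu.2
  set k : E3 → ℝ := fun u => (√(ε * q u))⁻¹ with hk
  have hks : ContDiffOn ℝ ∞ k O' :=
    ((contDiffOn_const.mul (hqs.mono hsub)).sqrt fun u hu => (hpos u hu).ne').inv
      fun u hu => (Real.sqrt_pos.2 (hpos u hu)).ne'
  have hk0 : ∀ u ∈ O', k u ≠ 0 := fun u hu => inv_ne_zero (Real.sqrt_pos.2 (hpos u hu)).ne'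
  have hk2 : ∀ u ∈ O', k u ^ 2 * q u = ε := by
    intro u hu
    have h1 : k u ^ 2 * (ε * q u) = 1 := by
      rw [hk]
      simp only [inv_pow]
      rw [Real.sq_sqrt (hpos u hu).le, inv_mul_cancel₀ (hpos u hu).ne']
    linear_combination ε * h1 - k u ^ 2 * q u * hεε
  have has : ContDiffOn ℝ ∞ (fun u => k u * n u 0) O' := hks.mul ((hns 0).mono hsub)
  have hbs (i : Fin 4) : ContDiffOn ℝ ∞ (fun u => -(k u * n u i)) O' :=
    (hks.mul ((hns i).mono hsub)).neg
  have hunit : ∀ u ∈ O', (k u * n u 0) ^ 2 - (-(k u * n u 1)) ^ 2 - (-(k u * n u 2)) ^ 2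
      - (-(k u * n u 3)) ^ 2 = ε := by
    intro u hu
    rw [← hk2 u hu]
    ring
  have htan : ∀ u ∈ O', ∀ v, k u * n u 0 * S.cofX X u v 0 = -(k u * n u 1) * S.cofX X u v 1
      + -(k u * n u 2) * S.cofX X u v 2 + -(k u * n u 3) * S.cofX X u v 3 := by
    intro u hu v
    have : ∑ i, n u i * S.cofX X u v i = 0 := sum_minors_map (S.cofL X u) v
    rw [Fin.sum_univ_four] at this
    linear_combination k u * this
  have hsurj : ∀ u ∈ O', ∀ y : Fin 4 → ℝ, k u * n u 0 * y 0 = -(k u * n u 1) * y 1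
      + -(k u * n u 2) * y 2 + -(k u * n u 3) * y 3 → ∃ v, S.cofX X u v = y := by
    intro u hu y hy
    refine exists_map_eq (hinj u (hsub hu)) ?_
    change ∑ i, n u i * y i = 0
    rw [Fin.sum_univ_four]
    refine (mul_eq_zero.1 (?_ : k u * _ = 0)).resolve_left (hk0 u hu)
    linear_combination hy
  have hpar := parallel_normal hO'o (hX.mono hsub) (fun u hu => hmem u (hsub hu)) has (hbs 1)
    (hbs 2) (hbs 3) hε hunit htan hsurj fun u hu => hgeo u (hsub hu)
  exact ⟨O', hsub, ⟨u₀, hu₀, hεq⟩, ε, _, _, _, _,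
    { isOpen := hO'o
      smooth := hX.mono hsub
      smooth_a := has
      smooth_b := hbs 1
      smooth_c := hbs 2
      smooth_d := hbs 3
      mem := fun u hu => hmem u (hsub hu)
      sign := hε
      unit := hunit
      tangent := htan
      surj := hsurj
      inj := fun u hu v hv => hinj u (hsub hu) (hv.trans (map_zero (S.cofL X u)).symm)
      fderiv_a := fun u hu v => (hpar u hu v).1
      fderiv_b := fun u hu v => (hpar u hu v).2.1
      fderiv_c := fun u hu v => (hpar u hu v).2.2.1
      fderiv_d := fun u hu v => (hpar u hu v).2.2.2 }⟩

end Parallel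

end GodelType

theorem symm_of_hasLineDerivAt_fderiv {O : Set E3} (hO : IsOpen O) {f : E3 → ℝ}
    (hf : ContDiffOn ℝ ∞ f O) {g : E3 → E3 → ℝ} (hg : ∀ x ∈ O, ∀ w, fderiv ℝ f x w = g x w)
    {u : E3} (hu : u ∈ O) {v w : E3} {l m : ℝ} (hl : HasLineDerivAt ℝ (fun x => g x w) l u v)
    (hm : HasLineDerivAt ℝ (fun x => g x v) m u w) : l = m := by
  have h1 := (hl.congr_on hO hu fun x hx => hg x hx w).eq_fderiv hO (hf.fderiv_apply_const hO w) hu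
  have h2 := (hm.congr_on hO hu fun x hx => hg x hx v).eq_fderiv hO (hf.fderiv_apply_const hO v) hu
  rw [← h1, ← h2]
  exact (hf.contDiffAt (hO.mem_nhds hu)).fderiv_fderiv_comm v w

namespace GodelType

variable {S : GodelType}

/-- The value of `ωⁱ ∧ ωʲ` on a pair of vectors. -/
def wedgeX (S : GodelType) (X : E3 → E4) (u v w : E3) (i j : Fin 4) : ℝ :=
  S.cofX X u v i * S.cofX X u w j - S.cofX X u w i * S.cofX X u v j

namespace IsAdapted

variable {X : E3 → E4} {O : Set E3} {ε : ℝ} {a b c d : E3 → ℝ}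

theorem codazzi (h : S.IsAdapted X ε a b c d O) {u : E3} (hu : u ∈ O) (v w : E3) :
    (S.f2 (X u 1) * b u * S.wedgeX X u v w 1 2
      + S.f1 (X u 1) * (b u * S.wedgeX X u v w 0 1 + c u * S.wedgeX X u v w 0 2) = 0) ∧
    ((S.f2 (X u 1) * a u - S.f3 (X u 1) * c u) * S.wedgeX X u v w 1 2
      + (S.f1 (X u 1) * a u - S.f2 (X u 1) * c u) * S.wedgeX X u v w 0 1 = 0) ∧
    (S.f3 (X u 1) * b u * S.wedgeX X u v w 1 2 + S.f2 (X u 1) * b u * S.wedgeX X u v w 0 1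
      + S.f1 (X u 1) * a u * S.wedgeX X u v w 0 2 = 0) := by
  have hO := h.isOpen
  have hD := S.D_ne_zero _ (h.mem u hu)
  have hdX : DifferentiableAt ℝ X u :=
    (h.smooth.contDiffAt (hO.mem_nhds hu)).differentiableAt (by simp)
  have W (v w : E3) := hasLineDerivAt_cofX hO h.smooth h.mem hu v w
  have hs := (h.smooth.contDiffAt (hO.mem_nhds hu)).fderiv_fderiv_comm v w
  have r1 (v : E3) := HasFDerivAt.hasLineDerivAt_apply hdX v 1
  have y1 (v : E3) := HasLineDerivAt.comp_left (f := fun x => X x 1)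
    (hasDerivAt_twist (h.mem u hu)) (r1 v)
  have p1 (v : E3) := HasLineDerivAt.comp_left (f := fun x => X x 1)
    (hasDerivAt_logDeriv (h.mem u hu)) (r1 v)
  have la (v : E3) := (ContDiffOn.hasLineDerivAt hO h.smooth_a hu v).congr_deriv (h.fderiv_a u hu v)
  have lb (v : E3) := (ContDiffOn.hasLineDerivAt hO h.smooth_b hu v).congr_deriv (h.fderiv_b u hu v)
  have lc (v : E3) := (ContDiffOn.hasLineDerivAt hO h.smooth_c hu v).congr_deriv (h.fderiv_c u hu v)
  have A (v w : E3) := (y1 v).mul (((lb v).mul (W v w).2.2.1).sub ((lc v).mul (W v w).2.1))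
  have q (v w : E3) := ((y1 v).mul (W v w).1).add ((p1 v).mul (W v w).2.2.1)
  have B (v w : E3) := (((y1 v).mul (la v)).mul (W v w).2.2.1).add ((lc v).mul (q v w))
  have C (v w : E3) := (((y1 v).mul (la v)).mul (W v w).2.1).neg.sub ((lb v).mul (q v w))
  have hA := symm_of_hasLineDerivAt_fderiv hO h.smooth_a h.fderiv_a hu (A v w) (A w v)
  have hB := symm_of_hasLineDerivAt_fderiv hO h.smooth_b h.fderiv_b hu (B v w) (B w v)
  have hC := symm_of_hasLineDerivAt_fderiv hO h.smooth_c h.fderiv_c hu (C v w) (C w v)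
  simp only [hs, deriv_H_eq (h.mem u hu), deriv_D_eq (h.mem u hu)] at hA hB hC
  simp only [wedgeX, ← twist_sq]
  simp only [cofX, cof, Matrix.cons_val_zero, Matrix.cons_val_one, Matrix.cons_val] at hA hB hC ⊢
  refine ⟨?_, ?_, ?_⟩
  · linear_combination hA
  · linear_combination hB
  · linear_combination hC

theorem differentiableAt (h : S.IsAdapted X ε a b c d O) {u : E3} (hu : u ∈ O) :
    DifferentiableAt ℝ X u :=
  (h.smooth.contDiffAt (h.isOpen.mem_nhds hu)).differentiableAt (by simp)

theorem hasLineDerivAt_comp_radius (h : S.IsAdapted X ε a b c d O) {u : E3} (hu : u ∈ O)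
    {f : ℝ → ℝ} {f' : ℝ} (hf : HasDerivAt f f' (X u 1)) (v : E3) :
    HasLineDerivAt ℝ (fun x => f (X x 1)) (f' * S.cofX X u v 1) u v :=
  HasLineDerivAt.comp_left (f := fun x => X x 1) hf
    (HasFDerivAt.hasLineDerivAt_apply (h.differentiableAt hu) v 1)

/-- If the radius is a submersion on `O` then not all points of `O` are flat points. -/
theorem exists_not_flat (h : S.IsAdapted X ε a b c d O) {u : E3} (hu : u ∈ O)
    (hflat : ¬ S.IsFlatNear (X u 1)) (hr : ∃ v, S.cofX X u v 1 ≠ 0) :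
    ∃ x ∈ O, ¬ (S.f1 (X x 1) = 0 ∧ S.f2 (X x 1) = 0 ∧ S.f3 (X x 1) = 0) := by
  by_contra! hcon
  apply hflat
  have hsm : ContDiffAt ℝ ∞ (fun x => X x 1) u :=
    (contDiffOn_euclidean.1 h.smooth 1).contDiffAt (h.isOpen.mem_nhds hu)
  have hst := hsm.hasStrictFDerivAt (by simp)
  have hsurj : (fderiv ℝ (fun x => X x 1) u).range = ⊤ := by
    rw [LinearMap.range_eq_top]
    refine LinearMap.surjective_of_ne_zero ?_
    obtain ⟨v, hv⟩ := hr
    intro h0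
    apply hv
    have := fderiv_euclidean_apply (h.differentiableAt hu) v 1
    have h1 := DFunLike.congr_fun h0 v
    rw [show S.cofX X u v 1 = fderiv ℝ X u v 1 from rfl, ← this]
    exact h1
  have hmap := hst.map_nhds_eq_of_surj hsurj
  change ∀ᶠ s in 𝓝 (X u 1), _
  rw [← hmap, eventually_map]
  filter_upwards [h.isOpen.mem_nhds hu] with x hx using hcon x hx

theorem f2_eq_zero (h : S.IsAdapted X ε a b c d O) {y : ℝ} (hy : ∀ u ∈ O, S.twist (X u 1) = y)
    {u : E3} (hu : u ∈ O) (hr : ∃ v, S.cofX X u v 1 ≠ 0) : S.f2 (X u 1) = 0 := by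
  obtain ⟨v, hv⟩ := hr
  have h1 := h.hasLineDerivAt_comp_radius hu (hasDerivAt_twist (h.mem u hu)) v
  have h2 := (hasLineDerivAt_const (u := u) (v := v) y).congr_on h.isOpen hu hy
  exact (mul_eq_zero.1 (h1.unique h2)).resolve_right hv

end IsAdapted

end GodelType

/-- Either a continuous function vanishes on an open set or it has no zeros on a smaller one. -/
theorem exists_open_ne_or_forall_eq {O : Set E3} (hO : IsOpen O) {f : E3 → ℝ}
    (hf : ContinuousOn f O) :
    (∀ u ∈ O, f u = 0) ∨ ∃ O' ⊆ O, IsOpen O' ∧ O'.Nonempty ∧ ∀ u ∈ O', f u ≠ 0 := by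
  by_cases h : ∀ u ∈ O, f u = 0
  · exact Or.inl h
  · push Not at h
    obtain ⟨u, hu, hfu⟩ := h
    exact Or.inr ⟨O ∩ f ⁻¹' {0}ᶜ, inter_subset_left,
      hf.isOpen_inter_preimage hO isOpen_compl_singleton, ⟨u, hu, hfu⟩, fun x hx => hx.2⟩

theorem exists_ball_subset {O : Set E3} (hO : IsOpen O) (hne : O.Nonempty) :
    ∃ B ⊆ O, IsOpen B ∧ B.Nonempty ∧ Convex ℝ B := by
  obtain ⟨u, hu⟩ := hne
  obtain ⟨r, hr, hsub⟩ := Metric.isOpen_iff.1 hO u hu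
  exact ⟨Metric.ball u r, hsub, Metric.isOpen_ball, ⟨u, Metric.mem_ball_self hr⟩, convex_ball u r⟩

theorem exists_const_of_hasLineDerivAt {O : Set E3} (hO : IsOpen O) (hc : Convex ℝ O)
    {f : E3 → ℝ} (hf : ContDiffOn ℝ ∞ f O) (h : ∀ u ∈ O, ∀ v, HasLineDerivAt ℝ f 0 u v) :
    ∃ k, ∀ u ∈ O, f u = k := by
  refine hO.exists_is_const_of_fderiv_eq_zero hc.isPreconnected
    (hf.differentiableOn (by simp)) fun u hu => ?_
  ext v
  exact (h u hu v).eq_fderiv hO hf hu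

/-- The inverse function theorem for a smooth map with injective derivatives. -/
theorem exists_openPartialHomeomorph {E F : Type*} [NormedAddCommGroup E] [NormedSpace ℝ E]
    [NormedAddCommGroup F] [NormedSpace ℝ F] [FiniteDimensional ℝ E] [FiniteDimensional ℝ F]
    (hdim : Module.finrank ℝ E = Module.finrank ℝ F) {f : E → F} {O : Set E} (hO : IsOpen O)
    (hf : ContDiffOn ℝ ∞ f O) (hinj : ∀ x ∈ O, ∀ v, fderiv ℝ f x v = 0 → v = 0)
    {x₀ : E} (hx₀ : x₀ ∈ O) :
    ∃ e : OpenPartialHomeomorph E F, x₀ ∈ e.source ∧ e.source ⊆ O ∧ (∀ x, e x = f x) ∧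
      ContDiffOn ℝ ∞ e.symm e.target := by
  have : CompleteSpace E := FiniteDimensional.complete ℝ E
  have hequiv : ∀ x ∈ O, ∃ L : E ≃L[ℝ] F, HasFDerivAt f (L : E →L[ℝ] F) x := by
    intro x hx
    have hi : Function.Injective (fderiv ℝ f x).toLinearMap :=
      (injective_iff_map_eq_zero _).2 fun v hv => hinj x hx v hv
    refine ⟨(LinearEquiv.ofInjectiveOfFinrankEq (fderiv ℝ f x).toLinearMap hi
      hdim).toContinuousLinearEquiv, ?_⟩
    have h := ((hf.contDiffAt (hO.mem_nhds hx)).differentiableAt (by simp)).hasFDerivAt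
    convert h using 1
    ext v
    rfl
  obtain ⟨L, hL⟩ := hequiv x₀ hx₀
  have hst := (hf.contDiffAt (hO.mem_nhds hx₀)).hasStrictFDerivAt' hL (by simp)
  set e := (hst.toOpenPartialHomeomorph f).restrOpen O hO with he
  refine ⟨e, ⟨hst.mem_toOpenPartialHomeomorph_source, hx₀⟩, inter_subset_right, fun x => rfl, ?_⟩
  intro y hy
  have hy' : e.symm y ∈ O := inter_subset_right (e.map_target hy)
  obtain ⟨L', hL'⟩ := hequiv _ hy'
  exact (e.contDiffAt_symm hy hL' (hf.contDiffAt (hO.mem_nhds hy'))).contDiffWithinAt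

theorem isOpen_openBox (α β : Fin 3 → ℝ) : IsOpen (openBox α β) := by
  have : openBox α β = ⋂ i, (fun u : E3 => u i) ⁻¹' Ioo (α i) (β i) := by
    ext u
    simp [openBox]
  rw [this]
  exact isOpen_iInter_of_finite fun i => isOpen_Ioo.preimage (by fun_prop)

theorem exists_openBox_subset {T : Set E3} (hT : IsOpen T) {y : E3} (hy : y ∈ T) :
    ∃ α β : Fin 3 → ℝ, y ∈ openBox α β ∧ openBox α β ⊆ T := by
  have hT' : IsOpen ((WithLp.toLp 2 : (Fin 3 → ℝ) → E3) ⁻¹' T) :=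
    hT.preimage (PiLp.continuous_toLp 2 _)
  obtain ⟨r, hr, hsub⟩ := Metric.isOpen_iff.1 hT' (WithLp.ofLp y) hy
  refine ⟨fun i => y i - r, fun i => y i + r, fun i => ⟨by linarith, by linarith⟩, fun u hu => ?_⟩
  have : (WithLp.ofLp u) ∈ Metric.ball (WithLp.ofLp y) r := by
    rw [Metric.mem_ball, dist_pi_lt_iff hr]
    intro i
    rw [Real.dist_eq, abs_lt]
    have := hu i
    exact ⟨by linarith [this.1], by linarith [this.2]⟩
  exact hsub this

theorem exists_box_chart {G : E3 → E3} {O : Set E3} (hO : IsOpen O) (hG : ContDiffOn ℝ ∞ G O)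
    (hinj : ∀ u ∈ O, ∀ v, (∀ i, HasLineDerivAt ℝ (fun x => G x i) 0 u v) → v = 0)
    {x₀ : E3} (hx₀ : x₀ ∈ O) :
    ∃ (χ : OpenPartialHomeomorph E3 E3) (α β : Fin 3 → ℝ), x₀ ∈ χ.source ∧ χ.source ⊆ O ∧
      ContDiffOn ℝ ∞ χ χ.source ∧ ContDiffOn ℝ ∞ χ.symm χ.target ∧ χ.target = openBox α β ∧
      G x₀ ∈ openBox α β ∧ (∀ u ∈ openBox α β, χ.symm u ∈ O ∧ G (χ.symm u) = u) ∧
      χ.symm (G x₀) = x₀ := by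
  obtain ⟨e, hx, hsub, heq, hsm⟩ := exists_openPartialHomeomorph rfl hO hG (fun u hu v hv => by
    refine hinj u hu v fun i => ?_
    have hd := (hG.contDiffAt (hO.mem_nhds hu)).differentiableAt (n := ∞) (by simp)
    simpa [hv] using HasFDerivAt.hasLineDerivAt_apply hd v i) hx₀
  obtain ⟨α, β, hbox, hboxs⟩ := exists_openBox_subset e.open_target (e.map_source hx)
  set χ := (e.symm.restrOpen _ (isOpen_openBox α β)).symm with hχ
  have ht : χ.target = openBox α β := inter_eq_right.2 hboxs
  have hs : χ.source ⊆ e.source := by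
    intro x hx
    have h1 := χ.map_source hx
    have h2 := χ.left_inv hx
    rw [← h2]
    rw [ht] at h1
    exact e.map_target (hboxs h1)
  have hGe : ∀ x, χ x = G x := heq
  refine ⟨χ, α, β, ?_, hs.trans hsub, ?_, ?_, ht, ?_, ?_, by rw [← heq]; exact e.left_inv hx⟩
  · have h1 : e x₀ ∈ χ.target := by rwa [ht]
    have h2 := χ.map_target h1
    rwa [show χ.symm (e x₀) = x₀ from e.left_inv hx] at h2
  · exact (hG.mono (hs.trans hsub)).congr fun x _ => hGe x
  · rw [ht]
    exact hsm.mono hboxs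
  · rwa [← heq]
  · intro u hu
    rw [← ht] at hu
    exact ⟨hsub (hs (χ.map_target hu)), by rw [← hGe]; exact χ.right_inv hu⟩

namespace GodelType

variable {S T : GodelType}

namespace IsAdapted

variable {X : E3 → E4} {O : Set E3} {ε : ℝ} {a b c d : E3 → ℝ}

theorem inducedMetric_neg (h : S.IsAdapted X 1 a b c d O) {u : E3} (hu : u ∈ O) {v : E3}
    (hv : v ≠ 0) : S.inducedMetric X u v v < 0 := by
  rw [inducedMetric_eq]
  by_contra! hcon
  apply hv
  have ht := h.tangent u hu v
  have hun := h.unit u hu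
  apply h.inj u hu
  set y := S.cofX X u v
  have hcs : (a u * y 0) ^ 2 ≤ (b u ^ 2 + c u ^ 2 + d u ^ 2) * (y 1 ^ 2 + y 2 ^ 2 + y 3 ^ 2) := by
    rw [ht]
    nlinarith [sq_nonneg (b u * y 2 - c u * y 1), sq_nonneg (b u * y 3 - d u * y 1),
      sq_nonneg (c u * y 3 - d u * y 2)]
  have h1 : b u ^ 2 + c u ^ 2 + d u ^ 2 = a u ^ 2 - 1 := by linarith
  rw [h1] at hcs
  have h2 : 0 ≤ a u ^ 2 * (y 0 * y 0 - y 1 * y 1 - y 2 * y 2 - y 3 * y 3) :=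
    mul_nonneg (sq_nonneg _) hcon
  have h3 : y 1 ^ 2 + y 2 ^ 2 + y 3 ^ 2 ≤ 0 := by nlinarith
  have y1 : y 1 = 0 := by nlinarith [sq_nonneg (y 1), sq_nonneg (y 2), sq_nonneg (y 3)]
  have y2 : y 2 = 0 := by nlinarith [sq_nonneg (y 1), sq_nonneg (y 2), sq_nonneg (y 3)]
  have y3 : y 3 = 0 := by nlinarith [sq_nonneg (y 1), sq_nonneg (y 2), sq_nonneg (y 3)]
  have ha : a u ≠ 0 := by
    intro ha
    rw [ha] at hun
    nlinarith [sq_nonneg (b u), sq_nonneg (c u), sq_nonneg (d u)]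
  have y0 : y 0 = 0 := by
    rw [y1, y2, y3] at ht
    simpa [ha] using ht
  ext i
  fin_cases i <;> assumption

theorem isNondegenerateAt (h : S.IsAdapted X ε a b c d O) {u : E3} (hu : u ∈ O) :
    S.IsNondegenerateAt X u := by
  intro v hv
  have ht := h.tangent u hu v
  have hun := h.unit u hu
  have hεε : ε * ε = 1 := by rcases h.sign with rfl | rfl <;> norm_num
  apply h.inj u hu
  have sel (y0 y1 y2 y3 : ℝ) : S.cofX X u v 0 * y0 - S.cofX X u v 1 * y1 - S.cofX X u v 2 * y2
      - S.cofX X u v 3 * y3 = 0 := by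
    set s := ε * (a u * y0 - b u * y1 - c u * y2 - d u * y3) with hs
    obtain ⟨w, hw⟩ := h.surj u hu
      ![y0 - s * a u, y1 - s * b u, y2 - s * c u, y3 - s * d u] (by
        simp
        linear_combination -s * hun + (-(a u * y0 - b u * y1 - c u * y2 - d u * y3)) * hεε)
    have := hv w
    rw [inducedMetric_eq, hw] at this
    simp at this
    linear_combination this + s * ht
  ext i
  have s0 := sel 1 0 0 0
  have s1 := sel 0 1 0 0
  have s2 := sel 0 0 1 0
  have s3 := sel 0 0 0 1
  fin_cases i <;> simp <;> linarith

theorem exists_inducedMetric_pos (h : S.IsAdapted X (-1) a b c d O) {u : E3} (hu : u ∈ O) :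
    ∃ v, 0 < S.inducedMetric X u v v := by
  have hun := h.unit u hu
  obtain ⟨v, hv⟩ := h.surj u hu ![1 + a u * a u, a u * b u, a u * c u, a u * d u] (by
    simp
    linear_combination a u * hun)
  refine ⟨v, ?_⟩
  rw [inducedMetric_eq, hv]
  simp
  nlinarith [sq_nonneg (a u)]

end IsAdapted

section Transfer

variable {X : E3 → E4} {O : Set E3} {ε : ℝ} {a b c d : E3 → ℝ}
  {Ψ : OpenPartialHomeomorph E4 E4} {χ : OpenPartialHomeomorph E3 E3}

theorem exists_inducedMetric_comp (hΨ : IsLocalIsometry S T Ψ) (hO : IsOpen O)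
    (hX : ContDiffOn ℝ ∞ X O) (hmem : ∀ x ∈ O, X x ∈ Ψ.source) (hsub : χ.source ⊆ O)
    (hχ : ContDiffOn ℝ ∞ χ χ.source) (hχs : ContDiffOn ℝ ∞ χ.symm χ.target) {u : E3}
    (hu : u ∈ χ.target) : ∃ A : E3 ≃ₗ[ℝ] E3, ∀ v w,
      T.inducedMetric (Ψ ∘ X ∘ χ.symm) u v w = S.inducedMetric X (χ.symm u) (A v) (A w) := by
  have hx := χ.map_target hu
  set x := χ.symm u with hxdef
  have d1 : HasFDerivAt χ.symm (fderiv ℝ χ.symm u) u :=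
    ((hχs.contDiffAt (χ.open_target.mem_nhds hu)).differentiableAt (by simp)).hasFDerivAt
  have d2 : HasFDerivAt χ (fderiv ℝ χ x) x :=
    ((hχ.contDiffAt (χ.open_source.mem_nhds hx)).differentiableAt (by simp)).hasFDerivAt
  have d3 : HasFDerivAt X (fderiv ℝ X x) x :=
    ((hX.contDiffAt (hO.mem_nhds (hsub hx))).differentiableAt (by simp)).hasFDerivAt
  have d4 : HasFDerivAt Ψ (fderiv ℝ Ψ (X x)) (X x) :=
    ((hΨ.smooth.contDiffAt (Ψ.open_source.mem_nhds (hmem x (hsub hx)))).differentiableAt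
      (by simp)).hasFDerivAt
  have c1 : (fderiv ℝ χ x).comp (fderiv ℝ χ.symm u) = ContinuousLinearMap.id ℝ E3 := by
    refine (d2.comp u d1).unique ((hasFDerivAt_id u).congr_of_eventuallyEq ?_)
    filter_upwards [χ.open_target.mem_nhds hu] with y hy using χ.right_inv hy
  have c2 : (fderiv ℝ χ.symm u).comp (fderiv ℝ χ x) = ContinuousLinearMap.id ℝ E3 := by
    have d1' : HasFDerivAt χ.symm (fderiv ℝ χ.symm u) (χ x) := by
      rwa [hxdef, χ.right_inv hu]
    refine (d1'.comp x d2).unique ((hasFDerivAt_id x).congr_of_eventuallyEq ?_)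
    filter_upwards [χ.open_source.mem_nhds hx] with y hy using χ.left_inv hy
  refine ⟨LinearEquiv.ofLinearMap (fderiv ℝ χ.symm u).toLinearMap (fderiv ℝ χ x).toLinearMap
    (by ext v : 1; exact DFunLike.congr_fun c2 v) (by ext v : 1; exact DFunLike.congr_fun c1 v),
    fun v w => ?_⟩
  have hcomp : HasFDerivAt (Ψ ∘ X ∘ χ.symm)
      (((fderiv ℝ Ψ (X x)).comp (fderiv ℝ X x)).comp (fderiv ℝ χ.symm u)) u :=
    (d4.comp x d3).comp u d1
  rw [inducedMetric, hcomp.fderiv]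
  exact hΨ.isometry _ (hmem x (hsub hx)) _ _

theorem IsAdapted.isSpacelikeOn_comp (h : S.IsAdapted X ε a b c d O) (hε : ε = 1)
    (hΨ : IsLocalIsometry S T Ψ) (hmem : ∀ x ∈ O, X x ∈ Ψ.source) (hsub : χ.source ⊆ O)
    (hχ : ContDiffOn ℝ ∞ χ χ.source) (hχs : ContDiffOn ℝ ∞ χ.symm χ.target) :
    T.IsSpacelikeOn (Ψ ∘ X ∘ χ.symm) χ.target := by
  intro u hu v hv
  subst hε
  obtain ⟨A, hA⟩ := exists_inducedMetric_comp hΨ h.isOpen h.smooth hmem hsub hχ hχs hu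
  rw [hA]
  exact h.inducedMetric_neg (hsub (χ.map_target hu)) (by simpa using hv)

theorem IsAdapted.isTimelikeOn_comp (h : S.IsAdapted X ε a b c d O) (hε : ε = -1)
    (hΨ : IsLocalIsometry S T Ψ) (hmem : ∀ x ∈ O, X x ∈ Ψ.source) (hsub : χ.source ⊆ O)
    (hχ : ContDiffOn ℝ ∞ χ χ.source) (hχs : ContDiffOn ℝ ∞ χ.symm χ.target) :
    T.IsTimelikeOn (Ψ ∘ X ∘ χ.symm) χ.target := by
  intro u hu
  subst hε
  obtain ⟨A, hA⟩ := exists_inducedMetric_comp hΨ h.isOpen h.smooth hmem hsub hχ hχs hu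
  have hx := hsub (χ.map_target hu)
  constructor
  · intro v hv
    refine A.map_eq_zero_iff.1 (h.isNondegenerateAt hx _ fun w => ?_)
    have := hv (A.symm w)
    rwa [hA, A.apply_symm_apply] at this
  · obtain ⟨v, hv⟩ := h.exists_inducedMetric_pos hx
    exact ⟨A.symm v, by rwa [hA, A.apply_symm_apply]⟩

/-- A chart onto a box in which the coordinates are the components of `G`. -/
theorem IsAdapted.exists_chart (h : S.IsAdapted X ε a b c d O)
    (hΨ : IsLocalIsometry S T Ψ) (hmem : ∀ x ∈ O, X x ∈ Ψ.source) {G : E3 → E3}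
    (hG : ContDiffOn ℝ ∞ G O)
    (hinj : ∀ u ∈ O, ∀ v, (∀ i, HasLineDerivAt ℝ (fun x => G x i) 0 u v) → v = 0)
    {x₀ : E3} (hx₀ : x₀ ∈ O) :
    ∃ (χ : OpenPartialHomeomorph E3 E3) (α β : Fin 3 → ℝ), x₀ ∈ χ.source ∧ χ.source ⊆ O ∧
      ContDiffOn ℝ ∞ χ χ.source ∧ ContDiffOn ℝ ∞ χ.symm χ.target ∧ χ.target = openBox α β ∧
      G x₀ ∈ openBox α β ∧ (∀ u ∈ openBox α β, χ.symm u ∈ O ∧ G (χ.symm u) = u) ∧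
      χ.symm (G x₀) = x₀ ∧ (ε = 1 → T.IsSpacelikeOn (Ψ ∘ X ∘ χ.symm) (openBox α β)) ∧
      (ε = -1 → T.IsTimelikeOn (Ψ ∘ X ∘ χ.symm) (openBox α β)) := by
  obtain ⟨χ, α, β, h1, h2, h3, h4, h5, h6, h7, h8⟩ := exists_box_chart h.isOpen hG hinj hx₀
  refine ⟨χ, α, β, h1, h2, h3, h4, h5, h6, h7, h8, fun hε => ?_, fun hε => ?_⟩
  · rw [← h5]
    exact h.isSpacelikeOn_comp hε hΨ hmem h2 h3 h4
  · rw [← h5]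
    exact h.isTimelikeOn_comp hε hΨ hmem h2 h3 h4

end Transfer

theorem exists_translation (S : GodelType) (k : E4) (hk : k 1 = 0) :
    ∃ Ψ : OpenPartialHomeomorph E4 E4, IsLocalIsometry S S Ψ ∧ Ψ.source = S.domain ∧
      Ψ.target = S.domain ∧ ∀ x, Ψ x = x + k := by
  let Ψ : OpenPartialHomeomorph E4 E4 :=
    { toFun := fun x => x + k
      invFun := fun x => x - k
      source := S.domain
      target := S.domain
      map_source' := fun x hx => by simpa [domain, hk] using hx
      map_target' := fun x hx => by simpa [domain, hk] using hx
      left_inv' := fun x _ => by simp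
      right_inv' := fun x _ => by simp
      open_source := S.isOpen_domain
      open_target := S.isOpen_domain
      continuousOn_toFun := by fun_prop
      continuousOn_invFun := by fun_prop }
  refine ⟨Ψ, ⟨subset_rfl, subset_rfl, ?_, ?_, ?_⟩, rfl, rfl, fun x => rfl⟩
  · exact (contDiff_id.add contDiff_const).contDiffOn
  · exact (contDiff_id.sub contDiff_const).contDiffOn
  · intro x _ v w
    have hd : fderiv ℝ Ψ x = ContinuousLinearMap.id ℝ E4 :=
      ((hasFDerivAt_id x).add_const k).fderiv
    rw [hd]
    simp [metric, Ψ, hk]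

/-- On some nonempty open subset of `O` the hypersurface `X` is, in suitable coordinates and up to
isometries, one of the listed expressions. -/
def HasListedChart (S : GodelType) (X : E3 → E4) (O : Set E3) : Prop :=
  ∃ χ : OpenPartialHomeomorph E3 E3, χ.source.Nonempty ∧ χ.source ⊆ O ∧
    ContDiffOn ℝ ∞ χ χ.source ∧ ContDiffOn ℝ ∞ χ.symm χ.target ∧
    ∃ α β : Fin 3 → ℝ, χ.target = openBox α β ∧
      ((∃ Ψ : OpenPartialHomeomorph E4 E4, IsLocalIsometry S S Ψ ∧
          Ψ.source = S.domain ∧ Ψ.target = S.domain ∧ S.IsListed α β (Ψ ∘ X ∘ χ.symm)) ∨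
        (∃ (Ω : ℝ) (hΩ : Ω ≠ 0) (Ψ : OpenPartialHomeomorph E4 E4),
          IsLocalIsometry S (limiting Ω hΩ) Ψ ∧ (∀ q ∈ χ.source, X q ∈ Ψ.source) ∧
          (∀ x ∈ Ψ.source, deriv S.H (x 1) = -2 * Ω * S.D (x 1) ∧
            deriv (deriv S.D) (x 1) = 4 * Ω ^ 2 * S.D (x 1)) ∧
          (limiting Ω hΩ).IsListed α β (Ψ ∘ X ∘ χ.symm)))

theorem HasListedChart.mono {X : E3 → E4} {O O' : Set E3} (h : S.HasListedChart X O)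
    (hsub : O ⊆ O') : S.HasListedChart X O' := by
  obtain ⟨χ, h1, h2, h3⟩ := h
  exact ⟨χ, h1, h2.trans hsub, h3⟩

/-- The listed chart is found by taking suitable functions on the hypersurface as coordinates. -/
theorem IsAdapted.hasListedChart {X : E3 → E4} {O : Set E3} {ε : ℝ} {a b c d : E3 → ℝ}
    (h : S.IsAdapted X ε a b c d O) {k : E4} (hk : k 1 = 0) {G : E3 → E3}
    (hG : ContDiffOn ℝ ∞ G O)
    (hinj : ∀ u ∈ O, ∀ v, (∀ i, HasLineDerivAt ℝ (fun x => G x i) 0 u v) → v = 0)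
    {x₀ : E3} (hx₀ : x₀ ∈ O)
    (hlist : ∀ (α β : Fin 3 → ℝ) (σ : E3 → E3), ContDiffOn ℝ ∞ σ (openBox α β) →
      G x₀ ∈ openBox α β → (∀ u ∈ openBox α β, σ u ∈ O ∧ G (σ u) = u) →
      (ε = 1 → S.IsSpacelikeOn (fun u => X (σ u) + k) (openBox α β)) →
      (ε = -1 → S.IsTimelikeOn (fun u => X (σ u) + k) (openBox α β)) → σ (G x₀) = x₀ →
      S.IsListed α β (fun u => X (σ u) + k)) :
    S.HasListedChart X O := by
  obtain ⟨Ψ, hΨ, hs, ht, hΨk⟩ := exists_translation S k hk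
  obtain ⟨χ, α, β, h1, h2, h3, h4, h5, h6, h7, hx, h8, h9⟩ :=
    h.exists_chart hΨ (fun x hx => by rw [hs]; exact h.mem x hx) hG hinj hx₀
  have heq : Ψ ∘ X ∘ χ.symm = fun u => X (χ.symm u) + k := funext fun u => hΨk _
  rw [heq] at h8 h9
  refine ⟨χ, ⟨x₀, h1⟩, h2, h3, h4, α, β, h5, Or.inl ⟨Ψ, hΨ, hs, ht, ?_⟩⟩
  rw [heq]
  exact hlist α β χ.symm (h5 ▸ h4) h6 h7 h8 h9 hx

end GodelType

theorem contDiffOn_vec3 {O : Set E3} {g₀ g₁ g₂ : E3 → ℝ} (h₀ : ContDiffOn ℝ ∞ g₀ O)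
    (h₁ : ContDiffOn ℝ ∞ g₁ O) (h₂ : ContDiffOn ℝ ∞ g₂ O) :
    ContDiffOn ℝ ∞ (fun x => (!₂[g₀ x, g₁ x, g₂ x] : E3)) O := by
  refine contDiffOn_euclidean.2 fun i => ?_
  fin_cases i
  · exact h₀
  · exact h₁
  · exact h₂

theorem vec3_eq_iff {x y z : ℝ} {u : E3} : (!₂[x, y, z] : E3) = u ↔ x = u 0 ∧ y = u 1 ∧ z = u 2 := by
  constructor
  · rintro rfl
    exact ⟨rfl, rfl, rfl⟩
  · rintro ⟨rfl, rfl, rfl⟩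
    ext i
    fin_cases i <;> rfl

theorem exists_mem_openBox {α β : Fin 3 → ℝ} {y : E3} (hy : y ∈ openBox α β) {i : Fin 3} {r : ℝ}
    (hr : r ∈ Ioo (α i) (β i)) : ∃ u ∈ openBox α β, u i = r := by
  refine ⟨WithLp.toLp 2 (Function.update y i r), fun j => ?_, by simp⟩
  by_cases hj : j = i
  · subst hj
    simpa using hr
  · simpa [hj] using hy j

theorem Real.exists_tanh_eq {a d : ℝ} (h : a ^ 2 - d ^ 2 = 1) : ∃ θ, Real.tanh θ = d / a := by
  have ha : a ≠ 0 := by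
    rintro rfl
    nlinarith [sq_nonneg d]
  rcases lt_or_gt_of_ne ha with ha' | ha'
  · refine ⟨Real.arsinh (-d), ?_⟩
    rw [Real.tanh_eq_sinh_div_cosh, Real.sinh_arsinh, Real.cosh_arsinh,
      show 1 + (-d) ^ 2 = (-a) ^ 2 by linarith, Real.sqrt_sq (by linarith), neg_div_neg_eq]
  · refine ⟨Real.arsinh d, ?_⟩
    rw [Real.tanh_eq_sinh_div_cosh, Real.sinh_arsinh, Real.cosh_arsinh,
      show 1 + d ^ 2 = a ^ 2 by linarith, Real.sqrt_sq ha'.le]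

namespace GodelType

variable {S : GodelType} {X : E3 → E4} {O : Set E3} {ε : ℝ} {a b c d : E3 → ℝ}

namespace IsAdapted

theorem smooth_apply (h : S.IsAdapted X ε a b c d O) (i : Fin 4) :
    ContDiffOn ℝ ∞ (fun x => X x i) O :=
  contDiffOn_euclidean.1 h.smooth i

theorem hasLineDerivAt_apply (h : S.IsAdapted X ε a b c d O) {u : E3} (hu : u ∈ O) (v : E3)
    (i : Fin 4) : HasLineDerivAt ℝ (fun x => X x i) (fderiv ℝ X u v i) u v :=
  HasFDerivAt.hasLineDerivAt_apply (h.differentiableAt hu) v i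

theorem smooth_comp (h : S.IsAdapted X ε a b c d O) {f : ℝ → ℝ} (hf : ContDiffOn ℝ ∞ f S.interval) :
    ContDiffOn ℝ ∞ (fun x => f (X x 1)) O :=
  contDiffOn_comp_radius h.smooth h.mem hf

theorem hasListedChart_slice (h : S.IsAdapted X ε a b c d O) (hne : O.Nonempty)
    (hconv : Convex ℝ O) (habc : ∀ u ∈ O, a u = 0 ∧ b u = 0 ∧ c u = 0) :
    S.HasListedChart X O := by
  obtain ⟨x₀, hx₀⟩ := hne
  have hε : ε = -1 := by
    obtain ⟨h1, h2, h3⟩ := habc x₀ hx₀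
    have := h.unit x₀ hx₀
    rw [h1, h2, h3] at this
    rcases h.sign with rfl | rfl
    · nlinarith [sq_nonneg (d x₀)]
    · rfl
  have h3 : ∀ u ∈ O, ∀ v, S.cofX X u v 3 = 0 := by
    intro u hu v
    obtain ⟨h1, h2, h3⟩ := habc u hu
    have ht := h.tangent u hu v
    have hun := h.unit u hu
    rw [h1, h2, h3] at ht hun
    have hd : d u ≠ 0 := by
      intro hd
      rw [hd, hε] at hun
      norm_num at hun
    simpa [hd] using ht
  obtain ⟨k, hk⟩ := exists_const_of_hasLineDerivAt h.isOpen hconv (h.smooth_apply 3)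
    fun u hu v => (h.hasLineDerivAt_apply hu v 3).congr_deriv (h3 u hu v)
  refine h.hasListedChart (k := !₂[0, 0, 0, -k]) rfl
    (G := fun x => !₂[X x 0, X x 1, X x 2])
    (contDiffOn_vec3 (h.smooth_apply 0) (h.smooth_apply 1) (h.smooth_apply 2)) ?_ hx₀ ?_
  · intro u hu v hv
    have e0 : fderiv ℝ X u v 0 = 0 := (h.hasLineDerivAt_apply hu v 0).unique (hv 0)
    have e1 : fderiv ℝ X u v 1 = 0 := (h.hasLineDerivAt_apply hu v 1).unique (hv 1)
    have e2 : fderiv ℝ X u v 2 = 0 := (h.hasLineDerivAt_apply hu v 2).unique (hv 2)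
    refine h.inj u hu v ?_
    ext i
    have := h3 u hu v
    fin_cases i
    · simp [cofX, cof, e0, e2]
    · simpa [cofX, cof] using e1
    · simp [cofX, cof, e2]
    · exact this
  · intro α β σ _ _ hσ _ htime _
    refine Or.inl ⟨fun u hu => ?_, htime hε⟩
    obtain ⟨h1, h2⟩ := hσ u hu
    obtain ⟨e0, e1, e2⟩ := vec3_eq_iff.1 h2
    have e3 := hk _ h1
    ext i
    fin_cases i <;> simp [e0, e1, e2, e3]

theorem hasListedChart_static (h : S.IsAdapted X ε a b c d O) (hne : O.Nonempty)
    (hconv : Convex ℝ O) (htw : ∀ u ∈ O, S.twist (X u 1) = 0) (hbc : ∀ u ∈ O, b u = 0 ∧ c u = 0)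
    (ha : ∀ u ∈ O, a u ≠ 0) : S.HasListedChart X O := by
  obtain ⟨x₀, hx₀⟩ := hne
  obtain ⟨a₀, ha₀⟩ := exists_const_of_hasLineDerivAt h.isOpen hconv h.smooth_a fun u hu v =>
    (ContDiffOn.hasLineDerivAt h.isOpen h.smooth_a hu v).congr_deriv (by
      rw [h.fderiv_a u hu v, htw u hu, zero_mul])
  obtain ⟨d₀, hd₀⟩ := exists_const_of_hasLineDerivAt h.isOpen hconv h.smooth_d fun u hu v =>
    (ContDiffOn.hasLineDerivAt h.isOpen h.smooth_d hu v).congr_deriv (h.fderiv_d u hu v)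
  have hH' : ∀ u ∈ O, deriv S.H (X u 1) = 0 := fun u hu => by
    rw [deriv_H_eq (h.mem u hu), htw u hu]
    simp
  obtain ⟨c₀, hc₀⟩ := exists_const_of_hasLineDerivAt h.isOpen hconv (h.smooth_comp S.smooth_H)
    fun u hu v => (h.hasLineDerivAt_comp_radius hu (hasDerivAt_H (h.mem u hu)) v).congr_deriv (by
      rw [hH' u hu, zero_mul])
  have ha0 : a₀ ≠ 0 := by
    rw [← ha₀ x₀ hx₀]
    exact ha x₀ hx₀
  have htan : ∀ u ∈ O, ∀ v, a₀ * S.cofX X u v 0 = d₀ * S.cofX X u v 3 := by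
    intro u hu v
    have := h.tangent u hu v
    rw [(hbc u hu).1, (hbc u hu).2, ha₀ u hu, hd₀ u hu] at this
    linarith
  obtain ⟨k, hk⟩ := exists_const_of_hasLineDerivAt (f := fun u => X u 0 + c₀ * X u 2 - d₀ / a₀ * X u 3)
    h.isOpen hconv
    (((h.smooth_apply 0).add (contDiffOn_const.mul (h.smooth_apply 2))).sub
      (contDiffOn_const.mul (h.smooth_apply 3)))
    fun u hu v => (((h.hasLineDerivAt_apply hu v 0).add
      ((hasLineDerivAt_const c₀).mul (h.hasLineDerivAt_apply hu v 2))).sub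
      ((hasLineDerivAt_const (d₀ / a₀)).mul (h.hasLineDerivAt_apply hu v 3))).congr_deriv (by
        have := htan u hu v
        simp only [cofX, cof, hc₀ u hu, Matrix.cons_val_zero, Matrix.cons_val] at this
        field_simp
        linear_combination this)
  have hun := h.unit x₀ hx₀
  rw [(hbc x₀ hx₀).1, (hbc x₀ hx₀).2, ha₀ x₀ hx₀, hd₀ x₀ hx₀] at hun
  refine h.hasListedChart (k := !₂[-k, 0, 0, 0]) rfl
    (G := fun x => !₂[X x 3, X x 1, X x 2])
    (contDiffOn_vec3 (h.smooth_apply 3) (h.smooth_apply 1) (h.smooth_apply 2)) ?_ hx₀ ?_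
  · intro u hu v hv
    have e3 : fderiv ℝ X u v 3 = 0 := (h.hasLineDerivAt_apply hu v 3).unique (hv 0)
    have e1 : fderiv ℝ X u v 1 = 0 := (h.hasLineDerivAt_apply hu v 1).unique (hv 1)
    have e2 : fderiv ℝ X u v 2 = 0 := (h.hasLineDerivAt_apply hu v 2).unique (hv 2)
    refine h.inj u hu v ?_
    have := htan u hu v
    ext i
    fin_cases i
    · simp [cofX, cof, e3, ha0] at this
      simpa [cofX, cof] using this
    · simpa [cofX, cof] using e1
    · simp [cofX, cof, e2]
    · simpa [cofX, cof] using e3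
  · intro α β σ _ hbox hσ hspace htime _
    have hX (u : E3) (hu : u ∈ openBox α β) : X (σ u) + !₂[-k, 0, 0, 0] =
        !₂[d₀ / a₀ * u 0 - S.H (u 1) * u 2, u 1, u 2, u 0] := by
      obtain ⟨h1, h2⟩ := hσ u hu
      obtain ⟨e0, e1, e2⟩ := vec3_eq_iff.1 h2
      have e3 := hk _ h1
      have e4 := hc₀ _ h1
      rw [e0, e2] at e3
      rw [e1] at e4
      ext i
      fin_cases i <;> simp [e0, e1, e2, e4]
      linarith
    refine Or.inr (Or.inr (Or.inr ⟨⟨c₀, fun r hr => ?_⟩, ?_⟩))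
    · obtain ⟨u, hu, rfl⟩ := exists_mem_openBox hbox hr
      obtain ⟨h1, h2⟩ := hσ u hu
      obtain ⟨e0, e1, e2⟩ := vec3_eq_iff.1 h2
      rw [← e1]
      exact ⟨h.mem _ h1, hc₀ _ h1⟩
    · rcases h.sign with rfl | rfl
      · obtain ⟨θ, hθ⟩ := Real.exists_tanh_eq (a := a₀) (d := d₀) (by linarith)
        refine ⟨θ, Or.inl ⟨fun u hu => ?_, hspace rfl⟩⟩
        rw [hθ]
        exact hX u hu
      · obtain ⟨θ, hθ⟩ := Real.exists_tanh_eq (a := d₀) (d := a₀) (by linarith)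
        refine ⟨θ, Or.inr ⟨?_, fun u hu => ?_, htime rfl⟩⟩
        · rintro rfl
          have hd0 : d₀ ≠ 0 := by
            rintro rfl
            nlinarith [sq_nonneg a₀]
          rw [Real.tanh_zero, eq_comm, div_eq_zero_iff] at hθ
          exact hθ.elim ha0 hd0
        · rw [← inv_div, ← Real.tanh_eq_sinh_div_cosh, hθ, inv_div]
          exact hX u hu

theorem continuousOn_f3 (h : S.IsAdapted X ε a b c d O) :
    ContinuousOn (fun u => S.f3 (X u 1)) O := by
  have h1 := (h.smooth_comp contDiffOn_twist).pow 2
  have h2 := (h.smooth_comp contDiffOn_deriv_deriv_D).div (h.smooth_comp S.smooth_D)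
    fun u hu => S.D_ne_zero _ (h.mem u hu)
  simp only [f3, ← twist_sq]
  exact ((contDiffOn_const.mul h1).sub h2).continuousOn

theorem hasListedChart_of_d_ne_zero (h : S.IsAdapted X ε a b c d O) (hne : O.Nonempty)
    (hflat : ∀ u ∈ O, ¬ S.IsFlatNear (X u 1)) (hd : ∀ u ∈ O, d u ≠ 0) :
    S.HasListedChart X O := by
  have hs : ∀ u ∈ O, ∀ y : Fin 3 → ℝ, ∃ v, S.cofX X u v 0 = y 0 ∧ S.cofX X u v 1 = y 1 ∧
      S.cofX X u v 2 = y 2 := by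
    intro u hu y
    obtain ⟨v, hv⟩ := h.surj u hu
      ![y 0, y 1, y 2, (a u * y 0 - b u * y 1 - c u * y 2) / d u] (by
        have := hd u hu
        simp
        field_simp
        ring)
    exact ⟨v, by simp [hv]⟩
  have hcod : ∀ u ∈ O, S.f1 (X u 1) * a u = 0 ∧ S.f1 (X u 1) * b u = 0 ∧ S.f1 (X u 1) * c u = 0 ∧
      S.f3 (X u 1) * b u = 0 ∧ S.f2 (X u 1) * a u = S.f3 (X u 1) * c u := by
    intro u hu
    obtain ⟨v0, p0, p1, p2⟩ := hs u hu ![1, 0, 0]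
    obtain ⟨v1, q0, q1, q2⟩ := hs u hu ![0, 1, 0]
    obtain ⟨v2, r0, r1, r2⟩ := hs u hu ![0, 0, 1]
    obtain ⟨A1, -, -⟩ := h.codazzi hu v0 v1
    obtain ⟨A2, -, C2⟩ := h.codazzi hu v0 v2
    obtain ⟨-, B3, C3⟩ := h.codazzi hu v1 v2
    simp [wedgeX, p0, p1, p2, q0, q1, q2, r0, r1, r2] at A1 A2 C2 B3 C3
    simp only [mul_eq_zero]
    exact ⟨C2, A1, A2, C3, by linarith⟩
  rcases exists_open_ne_or_forall_eq h.isOpen (f := fun u => a u ^ 2 + b u ^ 2 + c u ^ 2)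
    (((h.smooth_a.pow 2).add (h.smooth_b.pow 2)).add (h.smooth_c.pow 2)).continuousOn
    with h0 | ⟨O₁, hsub₁, hO₁, ⟨x₁, hx₁⟩, h1⟩
  · obtain ⟨B, hB, hBo, hBne, hBc⟩ := exists_ball_subset h.isOpen hne
    refine ((h.mono hBo hB).hasListedChart_slice hBne hBc fun u hu => ?_).mono hB
    have := h0 u (hB hu)
    refine ⟨?_, ?_, ?_⟩ <;> nlinarith [sq_nonneg (a u), sq_nonneg (b u), sq_nonneg (c u)]
  · have hf1 : ∀ u ∈ O₁, S.f1 (X u 1) = 0 := by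
      intro u hu
      by_contra hcon
      obtain ⟨p, q, r, -, -⟩ := hcod u (hsub₁ hu)
      apply h1 u hu
      simp only [mul_eq_zero, hcon, false_or] at p q r
      simp [p, q, r]
    have htw : ∀ u ∈ O₁, S.twist (X u 1) = 0 := fun u hu => by
      have := hf1 u hu
      rw [← twist_sq] at this
      exact pow_eq_zero_iff two_ne_zero |>.1 this
    have hr : ∀ u ∈ O₁, ∃ v, S.cofX X u v 1 ≠ 0 := fun u hu => by
      obtain ⟨v, -, hv, -⟩ := hs u (hsub₁ hu) ![0, 1, 0]
      exact ⟨v, by simp [hv]⟩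
    have hA₁ := h.mono hO₁ hsub₁
    have hf2 : ∀ u ∈ O₁, S.f2 (X u 1) = 0 := fun u hu => hA₁.f2_eq_zero htw hu (hr u hu)
    obtain ⟨x₂, hx₂, hnf⟩ := hA₁.exists_not_flat hx₁ (hflat x₁ (hsub₁ hx₁)) (hr x₁ hx₁)
    have hf3 : S.f3 (X x₂ 1) ≠ 0 := fun h3 => hnf ⟨hf1 x₂ hx₂, hf2 x₂ hx₂, h3⟩
    obtain ⟨B, hB, hBo, hBne, hBc⟩ := exists_ball_subset
      (hA₁.continuousOn_f3.isOpen_inter_preimage hO₁ isOpen_compl_singleton) ⟨x₂, hx₂, hf3⟩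
    have hB₁ : B ⊆ O₁ := hB.trans inter_subset_left
    have hbc : ∀ u ∈ B, b u = 0 ∧ c u = 0 := by
      intro u hu
      have h3 : S.f3 (X u 1) ≠ 0 := (hB hu).2
      obtain ⟨-, -, -, p, q⟩ := hcod u (hsub₁ (hB₁ hu))
      rw [hf2 u (hB₁ hu), zero_mul, eq_comm] at q
      exact ⟨(mul_eq_zero.1 p).resolve_left h3, (mul_eq_zero.1 q).resolve_left h3⟩
    refine ((hA₁.mono hBo hB₁).hasListedChart_static hBne hBc (fun u hu => htw u (hB₁ hu)) hbc
      fun u hu h0 => ?_).mono (hB₁.trans hsub₁)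
    apply h1 u (hB₁ hu)
    simp [h0, hbc u hu]

end IsAdapted

end GodelType

namespace Real

/-- If `tanh 2θ = H'/D'` with `tanh 2θ = 2ac/(a²+c²)` then `e^θ = |a + c|`. -/
theorem quarter_log_eq {ε a c H' D' : ℝ} (hε : ε = 1 ∨ ε = -1) (h : a ^ 2 - c ^ 2 = ε)
    (hD : D' ≠ 0) (hr : H' * (a ^ 2 + c ^ 2) = 2 * a * c * D') :
    1 / 4 * Real.log ((D' + H') / (D' - H')) = Real.log |a + c| := by
  have hε2 : ε ^ 2 = 1 := by rcases hε with rfl | rfl <;> norm_num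
  have hm : a - c ≠ 0 := by
    intro h0
    have : ε = 0 := by linear_combination -h + (a + c) * h0
    rcases hε with rfl | rfl <;> norm_num at this
  have hp : 0 < a ^ 2 + c ^ 2 := by
    by_contra! hcon
    apply hm
    have ha : a = 0 := by nlinarith [sq_nonneg a, sq_nonneg c]
    have hc : c = 0 := by nlinarith [sq_nonneg a, sq_nonneg c]
    rw [ha, hc, sub_zero]
  have h1 : (D' + H') * (a ^ 2 + c ^ 2) = D' * (a + c) ^ 2 := by linear_combination hr
  have h2 : (D' - H') * (a ^ 2 + c ^ 2) = D' * (a - c) ^ 2 := by linear_combination -hr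
  have h3 : D' - H' ≠ 0 := by
    intro h0
    rw [h0, zero_mul] at h2
    exact mul_ne_zero hD (pow_ne_zero 2 hm) h2.symm
  have h4 : (a - c) ^ 2 * (a + c) ^ 2 = 1 := by
    rw [← hε2, ← h]
    ring
  have h5 : (D' + H') / (D' - H') = |a + c| ^ 4 := by
    rw [div_eq_iff h3, show |a + c| ^ 4 = (|a + c| ^ 2) ^ 2 by ring, sq_abs]
    apply mul_right_cancel₀ hp.ne'
    linear_combination h1 - (a + c) ^ 4 * h2 - D' * (a + c) ^ 2 * h4
  rw [h5, Real.log_pow]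
  push_cast
  ring

theorem tanh_log_abs {ε a c : ℝ} (hε : ε = 1 ∨ ε = -1) (h : a ^ 2 - c ^ 2 = ε) :
    (ε = 1 → Real.tanh (Real.log |a + c|) = c / a) ∧
    (ε = -1 → a ≠ 0 → Real.log |a + c| ≠ 0 ∧
      Real.cosh (Real.log |a + c|) / Real.sinh (Real.log |a + c|) = c / a) := by
  have hs : a + c ≠ 0 := by
    intro h0
    have : ε = 0 := by linear_combination -h + (a - c) * h0
    rcases hε with rfl | rfl <;> norm_num at this
  have hpos : 0 < |a + c| := abs_pos.2 hs
  have h1 : |a + c| ^ 2 = (a + c) ^ 2 := sq_abs _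
  have hsi : Real.sinh (Real.log |a + c|) = ((a + c) ^ 2 - 1) / (2 * |a + c|) := by
    rw [Real.sinh_log hpos, ← h1]
    field_simp
  have hco : Real.cosh (Real.log |a + c|) = ((a + c) ^ 2 + 1) / (2 * |a + c|) := by
    rw [Real.cosh_log hpos, ← h1]
    field_simp
  constructor
  · rintro rfl
    have ha : a ≠ 0 := by
      rintro rfl
      nlinarith [sq_nonneg c]
    rw [Real.tanh_eq_sinh_div_cosh, hsi, hco, div_div_div_cancel_right₀ (by positivity),
      div_eq_div_iff (by positivity) ha]
    linear_combination (a + c) * h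
  · rintro rfl ha
    have h2 : (a + c) ^ 2 - 1 = 2 * a * (a + c) := by linear_combination -h
    have h3 : (a + c) ^ 2 + 1 = 2 * c * (a + c) := by linear_combination h
    have h4 : (a + c) ^ 2 - 1 ≠ 0 := by
      rw [h2]
      exact mul_ne_zero (mul_ne_zero two_ne_zero ha) hs
    refine ⟨fun h0 => ?_, ?_⟩
    · rw [h0, Real.sinh_zero, eq_comm, div_eq_zero_iff] at hsi
      rcases hsi with h5 | h5
      · exact h4 h5
      · exact hpos.ne' (by linarith)
    · rw [hsi, hco, div_div_div_cancel_right₀ (by positivity), h2, h3]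
      field_simp

end Real

namespace GodelType

variable {S : GodelType} {X : E3 → E4} {O : Set E3} {ε : ℝ} {a b c d : E3 → ℝ}

namespace IsAdapted

theorem hasListedChart_helicoid (h : S.IsAdapted X ε a b c d O) (hne : O.Nonempty)
    (hconv : Convex ℝ O) (hbd : ∀ u ∈ O, b u = 0 ∧ d u = 0) (ha : ∀ u ∈ O, a u ≠ 0)
    (hrel : ∀ u ∈ O, deriv S.H (X u 1) * (a u ^ 2 + c u ^ 2) = 2 * a u * c u * deriv S.D (X u 1))
    (hD' : ∀ u ∈ O, deriv S.D (X u 1) ≠ 0) : S.HasListedChart X O := by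
  obtain ⟨x₀, hx₀⟩ := hne
  have hO := h.isOpen
  have hun : ∀ u ∈ O, a u ^ 2 - c u ^ 2 = ε := by
    intro u hu
    have := h.unit u hu
    rw [(hbd u hu).1, (hbd u hu).2] at this
    linarith
  have htan : ∀ u ∈ O, ∀ v, a u * S.cofX X u v 0 = c u * S.cofX X u v 2 := by
    intro u hu v
    have := h.tangent u hu v
    rw [(hbd u hu).1, (hbd u hu).2] at this
    linarith
  have la (u : E3) (hu : u ∈ O) (v : E3) : HasLineDerivAt ℝ a
      (-(S.twist (X u 1) * c u * S.cofX X u v 1)) u v :=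
    (ContDiffOn.hasLineDerivAt hO h.smooth_a hu v).congr_deriv (by
      rw [h.fderiv_a u hu v, (hbd u hu).1]
      ring)
  have lc (u : E3) (hu : u ∈ O) (v : E3) : HasLineDerivAt ℝ c
      (-(S.twist (X u 1) * a u * S.cofX X u v 1)) u v :=
    (ContDiffOn.hasLineDerivAt hO h.smooth_c hu v).congr_deriv (by
      rw [h.fderiv_c u hu v, (hbd u hu).1]
      ring)
  obtain ⟨κ, hκ⟩ := exists_const_of_hasLineDerivAt
    (f := fun u => S.D (X u 1) * (c u * (a u)⁻¹) - S.H (X u 1)) hO hconv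
    (((h.smooth_comp S.smooth_D).mul (h.smooth_c.mul (h.smooth_a.inv ha))).sub
      (h.smooth_comp S.smooth_H))
    fun u hu v => (((h.hasLineDerivAt_comp_radius hu (hasDerivAt_D (h.mem u hu)) v).mul
      ((lc u hu v).mul ((la u hu v).comp_left (hasDerivAt_inv (ha u hu))))).sub
      (h.hasLineDerivAt_comp_radius hu (hasDerivAt_H (h.mem u hu)) v)).congr_deriv (by
        have h0 := hrel u hu
        have h1 := ha u hu
        have hD := S.D_ne_zero _ (h.mem u hu)
        simp only [twist]
        field_simp
        linear_combination -h0 * S.cofX X u v 1)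
  obtain ⟨t₀, ht₀⟩ := exists_const_of_hasLineDerivAt (f := fun u => X u 0 - κ * X u 2) hO hconv
    ((h.smooth_apply 0).sub (contDiffOn_const.mul (h.smooth_apply 2)))
    fun u hu v => ((h.hasLineDerivAt_apply hu v 0).sub
      ((hasLineDerivAt_const κ).mul (h.hasLineDerivAt_apply hu v 2))).congr_deriv (by
        have h0 := htan u hu v
        have h1 := ha u hu
        rw [← hκ u hu]
        simp only [cofX, cof, Matrix.cons_val_zero, Matrix.cons_val] at h0
        field_simp
        linear_combination h0)
  have hcond : ∀ u ∈ O, S.condNum (X u 1) * (a u ^ 2 + c u ^ 2)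
      = -(2 * a u * c u) * S.condDen (X u 1) := by
    intro u hu
    have hr := h.mem u hu
    have hD := S.D_ne_zero _ hr
    obtain ⟨v, hv⟩ := h.surj u hu ![0, 1, 0, 0] (by simp [hbd u hu])
    have hHd := hasDerivAt_of_contDiffOn contDiffOn_deriv_H hr
    have hDd := hasDerivAt_of_contDiffOn contDiffOn_deriv_D hr
    have l1 := (h.hasLineDerivAt_comp_radius hu hHd v).mul
      (((la u hu v).mul (la u hu v)).add ((lc u hu v).mul (lc u hu v)))
    have l2 := ((hasLineDerivAt_const 2).mul ((la u hu v).mul (lc u hu v))).mul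
      (h.hasLineDerivAt_comp_radius hu hDd v)
    have h3 := l1.unique (l2.congr_on hO hu fun x hx => by linear_combination hrel x hx)
    have hnum : S.condNum (X u 1) = _ := (hHd.div (hasDerivAt_D hr) hD).deriv
    rw [hv] at h3
    simp [twist] at h3
    rw [hnum, condDen]
    field_simp at h3 ⊢
    linear_combination h3 / 2
  have hκ' : ∀ u ∈ O, S.D (X u 1) * (c u / a u) - S.H (X u 1) = κ := fun u hu => by
    rw [← hκ u hu, div_eq_mul_inv]
  refine h.hasListedChart (k := !₂[-t₀, 0, 0, 0]) rfl
    (G := fun x => !₂[X x 1, X x 3, X x 2])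
    (contDiffOn_vec3 (h.smooth_apply 1) (h.smooth_apply 3) (h.smooth_apply 2)) ?_ hx₀ ?_
  · intro u hu v hv
    have e1 : fderiv ℝ X u v 1 = 0 := (h.hasLineDerivAt_apply hu v 1).unique (hv 0)
    have e3 : fderiv ℝ X u v 3 = 0 := (h.hasLineDerivAt_apply hu v 3).unique (hv 1)
    have e2 : fderiv ℝ X u v 2 = 0 := (h.hasLineDerivAt_apply hu v 2).unique (hv 2)
    refine h.inj u hu v ?_
    have := htan u hu v
    ext i
    fin_cases i
    · simp [cofX, cof, e2, ha u hu] at this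
      simpa [cofX, cof, e2] using this
    · simpa [cofX, cof] using e1
    · simp [cofX, cof, e2]
    · simpa [cofX, cof] using e3
  · intro α β σ _ hbox hσ hspace htime _
    have hX (u : E3) (hu : u ∈ openBox α β) : X (σ u) + !₂[-t₀, 0, 0, 0] =
        !₂[κ * u 2, u 0, u 2, u 1] := by
      obtain ⟨h1, h2⟩ := hσ u hu
      obtain ⟨e0, e1, e2⟩ := vec3_eq_iff.1 h2
      have e3 := ht₀ _ h1
      rw [e2] at e3
      ext i
      fin_cases i <;> simp [e0, e1, e2]
      linarith
    refine Or.inr (Or.inr (Or.inl ⟨fun r hr => ?_, ?_⟩))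
    · obtain ⟨u, hu, rfl⟩ := exists_mem_openBox hbox hr
      obtain ⟨h1, h2⟩ := hσ u hu
      obtain ⟨e0, -, -⟩ := vec3_eq_iff.1 h2
      rw [← e0]
      set x := σ u
      have hc := hcond x h1
      have hun' := hun x h1
      have hεε : ε * ε = 1 := by rcases h.sign with rfl | rfl <;> norm_num
      have hsq : (a x ^ 2 + c x ^ 2) ^ 2 = 4 * (a x * c x) ^ 2 + 1 := by
        rw [← hεε, ← hun']
        ring
      have hp : 0 < a x ^ 2 + c x ^ 2 := by
        have := ha x h1
        positivity
      refine ⟨h.mem x h1, ?_, ?_⟩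
      · by_cases hden : S.condDen (X x 1) = 0
        · refine Or.inr ⟨?_, hden⟩
          rw [hden, mul_zero] at hc
          exact (mul_eq_zero.1 hc).resolve_right hp.ne'
        · refine Or.inl ⟨hden, ?_⟩
          have : S.condNum (X x 1) / S.condDen (X x 1) = -(2 * a x * c x) / (a x ^ 2 + c x ^ 2) := by
            rw [div_eq_div_iff hden hp.ne', hc]
          rw [this, abs_div, abs_of_pos hp, div_lt_one hp]
          refine abs_lt_of_sq_lt_sq ?_ hp.le
          rw [hsq]
          nlinarith
      · have hr1 := hrel x h1
        have hd := hD' x h1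
        have : (4 * (a x * c x) ^ 2 + 1) * (deriv S.D (X x 1) ^ 2 - deriv S.H (X x 1) ^ 2)
            = deriv S.D (X x 1) ^ 2 := by
          rw [← hsq]
          linear_combination (-(deriv S.H (X x 1) * (a x ^ 2 + c x ^ 2))
            - 2 * a x * c x * deriv S.D (X x 1)) * hr1 + deriv S.D (X x 1) ^ 2 * hsq
        have hpos : 0 < deriv S.D (X x 1) ^ 2 := by positivity
        rw [← this] at hpos
        have := pos_of_mul_pos_right hpos (by positivity)
        linarith
    · have hθ : ∀ u ∈ openBox α β, S.theta (u 0) = Real.log |a (σ u) + c (σ u)| := by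
        intro u hu
        obtain ⟨h1, h2⟩ := hσ u hu
        obtain ⟨e0, -, -⟩ := vec3_eq_iff.1 h2
        rw [← e0]
        exact Real.quarter_log_eq h.sign (hun _ h1) (hD' _ h1) (hrel _ h1)
      have hκ'' : ∀ u ∈ openBox α β, S.D (u 0) * (c (σ u) / a (σ u)) - S.H (u 0) = κ := by
        intro u hu
        obtain ⟨h1, h2⟩ := hσ u hu
        obtain ⟨e0, -, -⟩ := vec3_eq_iff.1 h2
        rw [← hκ' _ h1, e0]
      have hlog (u : E3) (hu : u ∈ openBox α β) := Real.tanh_log_abs h.sign (hun _ (hσ u hu).1)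
      rcases h.sign with rfl | rfl
      · refine Or.inl ⟨fun u hu => ?_, hspace rfl⟩
        rw [hθ u hu, (hlog u hu).1 rfl, hκ'' u hu]
        exact hX u hu
      · refine Or.inr ⟨fun r hr => ?_, fun u hu => ?_, htime rfl⟩
        · obtain ⟨u, hu, rfl⟩ := exists_mem_openBox hbox hr
          rw [hθ u hu]
          exact ((hlog u hu).2 rfl (ha _ (hσ u hu).1)).1
        · rw [hθ u hu, ((hlog u hu).2 rfl (ha _ (hσ u hu).1)).2, hκ'' u hu]
          exact hX u hu

theorem hasListedChart_of_b_eq_zero (h : S.IsAdapted X ε a b c d O) (hne : O.Nonempty)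
    (hflat : ∀ u ∈ O, ¬ S.IsFlatNear (X u 1)) (hbd : ∀ u ∈ O, b u = 0 ∧ d u = 0)
    (ha : ∀ u ∈ O, a u ≠ 0) : S.HasListedChart X O := by
  have hO := h.isOpen
  have hrel : ∀ u ∈ O,
      deriv S.H (X u 1) * (a u ^ 2 + c u ^ 2) = 2 * a u * c u * deriv S.D (X u 1) := by
    intro u hu
    obtain ⟨v, hv⟩ := h.surj u hu ![c u, 0, a u, 0] (by
      simp
      ring)
    have h1 := h.fderiv_b u hu v
    have h2 := ((hasLineDerivAt_const (u := u) (v := v) (0 : ℝ)).congr_on hO hu fun x hx =>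
      (hbd x hx).1).eq_fderiv hO h.smooth_b hu
    rw [h2, hv] at h1
    simp at h1
    rw [deriv_H_eq (h.mem u hu), deriv_D_eq (h.mem u hu)]
    linear_combination 2 * S.D (X u 1) * h1
  have hr : ∀ u ∈ O, ∃ v, S.cofX X u v 1 = 1 := by
    intro u hu
    obtain ⟨v, hv⟩ := h.surj u hu ![0, 1, 0, 0] (by simp [hbd u hu])
    exact ⟨v, by simp [hv]⟩
  have hr' : ∀ u ∈ O, ∃ v, S.cofX X u v 1 ≠ 0 := fun u hu => by
    obtain ⟨v, hv⟩ := hr u hu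
    exact ⟨v, by simp [hv]⟩
  rcases exists_open_ne_or_forall_eq hO (h.smooth_comp contDiffOn_deriv_D).continuousOn
    with h0 | ⟨O₁, hsub₁, hO₁, hne₁, h1⟩
  · exfalso
    obtain ⟨x, hx⟩ := hne
    obtain ⟨u, hu, hnf⟩ := h.exists_not_flat hx (hflat x hx) (hr' x hx)
    have htw : ∀ u ∈ O, S.twist (X u 1) = 0 := by
      intro u hu
      have h2 := hrel u hu
      have h3 := ha u hu
      rw [h0 u hu, mul_zero] at h2
      have h4 := (mul_eq_zero.1 h2).resolve_right (by positivity)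
      simp [twist, h4]
    apply hnf
    refine ⟨by rw [← twist_sq, htw u hu]; simp, h.f2_eq_zero htw hu (hr' u hu), ?_⟩
    obtain ⟨v, hv⟩ := hr u hu
    have h4 := h.hasLineDerivAt_comp_radius hu
      (hasDerivAt_of_contDiffOn contDiffOn_deriv_D (h.mem u hu)) v
    have h5 := h4.unique ((hasLineDerivAt_const (0 : ℝ)).congr_on hO hu h0)
    rw [hv, mul_one] at h5
    simp [f3, ← twist_sq, htw u hu, h5]
  · obtain ⟨B, hB, hBo, hBne, hBc⟩ := exists_ball_subset hO₁ hne₁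
    have hB' := hB.trans hsub₁
    exact ((h.mono hBo hB').hasListedChart_helicoid hBne hBc (fun u hu => hbd u (hB' hu))
      (fun u hu => ha u (hB' hu)) (fun u hu => hrel u (hB' hu)) fun u hu => h1 u (hB hu)).mono hB'

end IsAdapted

end GodelType

theorem convex_openBox (α β : Fin 3 → ℝ) : Convex ℝ (openBox α β) := by
  intro u hu v hv s t hs ht hst i
  exact convex_Ioo (α i) (β i) (hu i) (hv i) hs ht hst

/-- The point of the line `u₀ = y₀, u₂ = y₂` with middle coordinate `s`. -/
def midPoint (y : E3) (s : ℝ) : E3 := !₂[y 0, s, y 2]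

theorem midPoint_mem {α β : Fin 3 → ℝ} {y : E3} (hy : y ∈ openBox α β) {s : ℝ}
    (hs : s ∈ Ioo (α 1) (β 1)) : midPoint y s ∈ openBox α β := by
  intro i
  fin_cases i
  · exact hy 0
  · exact hs
  · exact hy 2

theorem hasDerivAt_midPoint (y : E3) (s : ℝ) :
    HasDerivAt (midPoint y) (EuclideanSpace.single 1 1) s := by
  have : midPoint y = fun s => midPoint y 0 + s • EuclideanSpace.single 1 (1 : ℝ) := by
    ext s i
    fin_cases i <;> simp [midPoint]
  rw [this]
  simpa using ((hasDerivAt_id s).smul_const (EuclideanSpace.single 1 (1 : ℝ))).const_add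
    (midPoint y 0)

/-- A function on a box whose differential is proportional to `du₂` depends on `u₂` only. -/
theorem eq_midPoint_of_fderiv {α β : Fin 3 → ℝ} {y : E3} (hy : y ∈ openBox α β) {f g : E3 → ℝ}
    (hf : ContDiffOn ℝ ∞ f (openBox α β))
    (hfg : ∀ u ∈ openBox α β, ∀ w, fderiv ℝ f u w = g u * w 1) :
    (∀ u ∈ openBox α β, f u = f (midPoint y (u 1))) ∧
    ∀ s ∈ Ioo (α 1) (β 1), HasDerivAt (fun s => f (midPoint y s)) (g (midPoint y s)) s := by
  have hd : ∀ u ∈ openBox α β, HasFDerivAt f (fderiv ℝ f u) u := fun u hu =>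
    ((hf.contDiffAt ((isOpen_openBox α β).mem_nhds hu)).differentiableAt (by simp)).hasFDerivAt
  constructor
  · intro u hu
    set p := midPoint y (u 1) with hp
    have hpm : p ∈ openBox α β := midPoint_mem hy (hu 1)
    have hseg (t : ℝ) (ht : t ∈ Icc (0 : ℝ) 1) : p + t • (u - p) ∈ openBox α β := by
      have := convex_openBox α β hpm hu (by linarith [ht.2] : 0 ≤ 1 - t) ht.1 (by ring)
      convert this using 1
      module
    have hder (t : ℝ) (ht : t ∈ Icc (0 : ℝ) 1) :
        HasDerivAt (fun t : ℝ => f (p + t • (u - p))) 0 t := by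
      have h1 : HasDerivAt (fun t : ℝ => p + t • (u - p)) (u - p) t := by
        simpa using ((hasDerivAt_id t).smul_const (u - p)).const_add p
      have h2 := (hd _ (hseg t ht)).comp_hasDerivAt t h1
      rw [hfg _ (hseg t ht)] at h2
      exact h2.congr_deriv (by simp [hp, midPoint])
    obtain ⟨t, -, ht⟩ := exists_hasDerivAt_eq_slope (fun t : ℝ => f (p + t • (u - p)))
      (fun _ => 0) one_pos (fun t ht => (hder t ht).continuousAt.continuousWithinAt)
      fun t ht => hder t ⟨ht.1.le, ht.2.le⟩
    simp at ht
    linarith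
  · intro s hs
    have h := (hd _ (midPoint_mem hy hs)).comp_hasDerivAt s (hasDerivAt_midPoint y s)
    rw [hfg _ (midPoint_mem hy hs)] at h
    exact h.congr_deriv (by simp)

theorem eq_add_integral {l r : ℝ} (h0 : (0 : ℝ) ∈ Ioo l r) {f f' : ℝ → ℝ}
    (hf : ∀ s ∈ Ioo l r, HasDerivAt f (f' s) s) (hf' : ContinuousOn f' (Ioo l r)) {s : ℝ}
    (hs : s ∈ Ioo l r) : f s = f 0 + ∫ t in (0 : ℝ)..s, f' t := by
  have hsub : uIcc 0 s ⊆ Ioo l r := (Set.ordConnected_Ioo).uIcc_subset h0 hs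
  rw [intervalIntegral.integral_eq_sub_of_hasDerivAt (fun t ht => hf t (hsub ht))
    (hf'.mono hsub).intervalIntegrable]
  ring

/-- A smooth function on an open interval has a smooth antiderivative. -/
theorem exists_antideriv {l r : ℝ} {g : ℝ → ℝ} (hg : ContDiffOn ℝ ∞ g (Ioo l r)) :
    ∃ G : ℝ → ℝ, ContDiffOn ℝ ∞ G (Ioo l r) ∧ ∀ s ∈ Ioo l r, HasDerivAt G (g s) s := by
  by_cases hne : l < r
  · have hm : (l + r) / 2 ∈ Ioo l r := ⟨by linarith, by linarith⟩
    have hder : ∀ s ∈ Ioo l r,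
        HasDerivAt (fun s => ∫ t in ((l + r) / 2)..s, g t) (g s) s := by
      intro s hs
      have hsub : uIcc ((l + r) / 2) s ⊆ Ioo l r := (Set.ordConnected_Ioo).uIcc_subset hm hs
      exact intervalIntegral.integral_hasDerivAt_right
        (hg.continuousOn.mono hsub).intervalIntegrable
        (hg.continuousOn.stronglyMeasurableAtFilter isOpen_Ioo s hs)
        (hg.continuousOn.continuousAt (isOpen_Ioo.mem_nhds hs))
    refine ⟨_, (contDiffOn_infty_iff_deriv_of_isOpen isOpen_Ioo).2 ⟨fun s hs =>
      (hder s hs).differentiableAt.differentiableWithinAt, hg.congr fun s hs => (hder s hs).deriv⟩,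
      hder⟩
  · rw [Ioo_eq_empty hne]
    exact ⟨g, by simp, by simp⟩

namespace GodelType

variable {S : GodelType} {X : E3 → E4} {O : Set E3} {ε : ℝ} {a b c d : E3 → ℝ}

namespace IsAdapted

/-- A cylinder over a geodesic, given an arc length function `s` of that geodesic. -/
theorem hasListedChart_of_arcLength (h : S.IsAdapted X ε a b c d O) (hne : O.Nonempty)
    (hconv : Convex ℝ O) (had : ∀ u ∈ O, a u = 0 ∧ d u = 0)
    (htw : ∀ u ∈ O, S.twist (X u 1) = 0) {ρ₀ σ : ℝ} (hρ : ∀ u ∈ O, b u * S.D (X u 1) = ρ₀)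
    (hσ : σ = 1 ∨ σ = -1) (hcσ : ∀ u ∈ O, 0 ≤ -(σ * c u)) {s : E3 → ℝ}
    (hs : ContDiffOn ℝ ∞ s O) (hs' : ∀ u ∈ O, ∀ v,
      HasLineDerivAt ℝ s (σ * (b u * S.cofX X u v 2 - c u * S.cofX X u v 1)) u v) :
    S.HasListedChart X O := by
  obtain ⟨x₀, hx₀⟩ := hne
  have hσσ : σ * σ = 1 := by rcases hσ with rfl | rfl <;> norm_num
  have hun : ∀ u ∈ O, ε = -1 ∧ b u ^ 2 + c u ^ 2 = 1 := by
    intro u hu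
    have := h.unit u hu
    rw [(had u hu).1, (had u hu).2] at this
    rcases h.sign with rfl | rfl
    · nlinarith [sq_nonneg (b u), sq_nonneg (c u)]
    · exact ⟨rfl, by linarith⟩
  have htan : ∀ u ∈ O, ∀ v, b u * S.cofX X u v 1 + c u * S.cofX X u v 2 = 0 := by
    intro u hu v
    have := h.tangent u hu v
    rw [(had u hu).1, (had u hu).2] at this
    linarith
  obtain ⟨c₀, hc₀⟩ := exists_const_of_hasLineDerivAt h.isOpen hconv (h.smooth_comp S.smooth_H)
    fun u hu v => (h.hasLineDerivAt_comp_radius hu (hasDerivAt_H (h.mem u hu)) v).congr_deriv (by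
      rw [deriv_H_eq (h.mem u hu), htw u hu]
      ring)
  set ρ := -(σ * ρ₀) with hρdef
  have hsqrt : ∀ u ∈ O, √(1 - (ρ / S.D (X u 1)) ^ 2) = -(σ * c u) := by
    intro u hu
    have hD := S.D_ne_zero _ (h.mem u hu)
    rw [← Real.sqrt_sq (hcσ u hu), hρdef, ← hρ u hu]
    congr 1
    field_simp
    linear_combination -(hun u hu).2 + (-b u ^ 2 - c u ^ 2) * hσσ
  have hX1 : ∀ u ∈ O, ∀ v,
      fderiv ℝ X u v 1 = √(1 - (ρ / S.D (X u 1)) ^ 2) * fderiv ℝ s u v := by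
    intro u hu v
    rw [hsqrt u hu, (hs' u hu v).eq_fderiv h.isOpen hs hu]
    change S.cofX X u v 1 = _
    linear_combination (-(S.cofX X u v 1) * (hun u hu).2) + b u * htan u hu v
      - c u * (c u * S.cofX X u v 1 - b u * S.cofX X u v 2) * hσσ
  have hX2 : ∀ u ∈ O, ∀ v,
      fderiv ℝ X u v 2 = -(ρ * (1 / S.D (X u 1) ^ 2)) * fderiv ℝ s u v := by
    intro u hu v
    have hD := S.D_ne_zero _ (h.mem u hu)
    rw [(hs' u hu v).eq_fderiv h.isOpen hs hu, hρdef, ← hρ u hu]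
    have h2 : S.cofX X u v 2 = S.D (X u 1) * fderiv ℝ X u v 2 := rfl
    have h3 := htan u hu v
    rw [h2] at h3 ⊢
    field_simp
    linear_combination (-(S.D (X u 1) * fderiv ℝ X u v 2) * (hun u hu).2) + c u * h3
      - b u * (b u * S.D (X u 1) * fderiv ℝ X u v 2 - c u * S.cofX X u v 1) * hσσ
  refine h.hasListedChart (k := !₂[0, 0, -X x₀ 2, 0]) rfl
    (G := fun x => !₂[X x 0 + c₀ * (X x 2 - X x₀ 2), s x - s x₀, X x 3])
    (contDiffOn_vec3 ((h.smooth_apply 0).add (contDiffOn_const.mul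
      ((h.smooth_apply 2).sub contDiffOn_const))) (hs.sub contDiffOn_const) (h.smooth_apply 3))
      ?_ hx₀ ?_
  · intro u hu v hv
    have e0 := ((h.hasLineDerivAt_apply hu v 0).add ((hasLineDerivAt_const c₀).mul
      ((h.hasLineDerivAt_apply hu v 2).sub (hasLineDerivAt_const (X x₀ 2))))).unique (hv 0)
    have e1 := ((ContDiffOn.hasLineDerivAt h.isOpen hs hu v).sub
      (hasLineDerivAt_const (s x₀))).unique (hv 1)
    have e3 : fderiv ℝ X u v 3 = 0 := (h.hasLineDerivAt_apply hu v 3).unique (hv 2)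
    have e4 := hX1 u hu v
    have e5 := hX2 u hu v
    rw [sub_zero] at e1
    rw [e1, mul_zero] at e4 e5
    refine h.inj u hu v ?_
    ext i
    fin_cases i
    · simpa [cofX, cof, e5] using e0
    · simpa [cofX, cof] using e4
    · simp [cofX, cof, e5]
    · simpa [cofX, cof] using e3
  · intro α β τ hτ hbox hτG _ htime hτ0
    set y : E3 := !₂[X x₀ 0 + c₀ * (X x₀ 2 - X x₀ 2), s x₀ - s x₀, X x₀ 3] with hy
    have h0 : (0 : ℝ) ∈ Ioo (α 1) (β 1) := by simpa [hy] using hbox 1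
    have hτO : MapsTo τ (openBox α β) O := fun u hu => (hτG u hu).1
    have hdτ : ∀ u ∈ openBox α β, HasFDerivAt τ (fderiv ℝ τ u) u := fun u hu =>
      ((hτ.contDiffAt ((isOpen_openBox α β).mem_nhds hu)).differentiableAt (by simp)).hasFDerivAt
    have hcoord : ∀ u ∈ openBox α β, X (τ u) 0 + c₀ * (X (τ u) 2 - X x₀ 2) = u 0 ∧
        s (τ u) - s x₀ = u 1 ∧ X (τ u) 3 = u 2 := fun u hu => vec3_eq_iff.1 (hτG u hu).2
    have hsd : ∀ u ∈ openBox α β, ∀ w, fderiv ℝ s (τ u) (fderiv ℝ τ u w) = w 1 := by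
      intro u hu w
      have h1 := ((hs.contDiffAt (h.isOpen.mem_nhds (hτO hu))).differentiableAt
        (by simp)).hasFDerivAt.comp u (hdτ u hu)
      have h2 : HasFDerivAt (fun u : E3 => u 1 + s x₀) (EuclideanSpace.proj (𝕜 := ℝ) (1 : Fin 3)) u :=
        (EuclideanSpace.proj (𝕜 := ℝ) (1 : Fin 3)).hasFDerivAt.add_const _
      have h3 : s ∘ τ =ᶠ[𝓝 u] fun u => u 1 + s x₀ := by
        filter_upwards [(isOpen_openBox α β).mem_nhds hu] with x hx
        simp [← (hcoord x hx).2.1]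
      exact DFunLike.congr_fun (h1.unique (h2.congr_of_eventuallyEq h3)) w
    have hcomp (i : Fin 4) : ContDiffOn ℝ ∞ (fun u => X (τ u) i) (openBox α β) :=
      (h.smooth_apply i).comp hτ hτO
    have hXd (i : Fin 4) : ∀ u ∈ openBox α β, ∀ w,
        fderiv ℝ (fun u => X (τ u) i) u w = fderiv ℝ X (τ u) (fderiv ℝ τ u w) i := by
      intro u hu w
      have h1 := (((h.smooth_apply i).contDiffAt (h.isOpen.mem_nhds (hτO hu))).differentiableAt
        (by simp)).hasFDerivAt.comp u (hdτ u hu)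
      rw [← fderiv_euclidean_apply (h.differentiableAt (hτO hu))]
      exact DFunLike.congr_fun h1.fderiv w
    obtain ⟨hr, hr'⟩ := eq_midPoint_of_fderiv hbox (hcomp 1)
      (g := fun u => √(1 - (ρ / S.D (X (τ u) 1)) ^ 2)) fun u hu w => by
        rw [hXd 1 u hu, hX1 _ (hτO hu), hsd u hu]
    obtain ⟨hφ, hφ'⟩ := eq_midPoint_of_fderiv hbox (hcomp 2)
      (g := fun u => -(ρ * (1 / S.D (X (τ u) 1) ^ 2))) fun u hu w => by
        rw [hXd 2 u hu, hX2 _ (hτO hu), hsd u hu]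
    set R : ℝ → ℝ := fun s => X (τ (midPoint y s)) 1 with hR
    have hRO : ∀ s ∈ Ioo (α 1) (β 1), τ (midPoint y s) ∈ O := fun s hs =>
      hτO (midPoint_mem hbox hs)
    have hRI : MapsTo R (Ioo (α 1) (β 1)) S.interval := fun s hs => h.mem _ (hRO s hs)
    have hRc : ContinuousOn R (Ioo (α 1) (β 1)) := fun s hs =>
      (hr' s hs).continuousAt.continuousWithinAt
    have hDc : ContinuousOn (fun s => S.D (R s)) (Ioo (α 1) (β 1)) :=
      S.smooth_D.continuousOn.comp hRc hRI
    have hD0 : ∀ s ∈ Ioo (α 1) (β 1), S.D (R s) ≠ 0 := fun s hs => S.D_ne_zero _ (hRI hs)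
    have hRint : ∀ s ∈ Ioo (α 1) (β 1),
        R s = R 0 + ∫ t in (0 : ℝ)..s, √(1 - (ρ / S.D (R t)) ^ 2) := fun s hs =>
      eq_add_integral h0 hr'
        (continuousOn_const.sub ((continuousOn_const.div hDc hD0).pow 2)).sqrt hs
    have hy0 : midPoint y 0 = y := by
      ext i
      fin_cases i <;> simp [midPoint, hy]
    have hφint : ∀ s ∈ Ioo (α 1) (β 1), X (τ (midPoint y s)) 2 =
        X (τ y) 2 + -(ρ * ∫ t in (0 : ℝ)..s, 1 / S.D (R t) ^ 2) := fun s hs => by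
      have := eq_add_integral h0 hφ'
        ((continuousOn_const.mul (continuousOn_const.div (hDc.pow 2)
          fun s hs => pow_ne_zero 2 (hD0 s hs))).neg) hs
      rw [intervalIntegral.integral_neg, intervalIntegral.integral_const_mul] at this
      rwa [hy0] at this
    have hτy : τ y = x₀ := hτ0
    rw [hτy] at hφint
    refine Or.inr (Or.inl ⟨ρ, R 0, R, h0, hRc, fun s hs => ⟨hRI hs, ?_, hRint s hs⟩,
      ⟨0, fun s hs => ?_⟩, fun u hu => ?_, htime (hun x₀ hx₀).1⟩)
    · have h1 := hρ _ (hRO s hs)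
      have h2 := (hun _ (hRO s hs)).2
      have h3 : ρ ^ 2 = (b (τ (midPoint y s)) * S.D (R s)) ^ 2 := by
        rw [h1, hρdef]
        linear_combination ρ₀ ^ 2 * hσσ
      rw [h3]
      nlinarith [sq_nonneg (c (τ (midPoint y s))), sq_nonneg (S.D (R s)),
        mul_nonneg (sq_nonneg (c (τ (midPoint y s)))) (sq_nonneg (S.D (R s)))]
    · have := htw _ (hRO s hs)
      rw [twist, neg_eq_zero] at this
      exact this
    · have hu1 := hu 1
      have e1 := hr u hu
      have e2 := hφ u hu
      obtain ⟨e0, -, e3⟩ := hcoord u hu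
      have hH : ∫ t in (0 : ℝ)..u 1, S.H (R t) / S.D (R t) ^ 2
          = c₀ * ∫ t in (0 : ℝ)..u 1, 1 / S.D (R t) ^ 2 := by
        rw [← intervalIntegral.integral_const_mul]
        refine intervalIntegral.integral_congr fun t ht => ?_
        have ht' : t ∈ Ioo (α 1) (β 1) := (Set.ordConnected_Ioo).uIcc_subset h0 hu1 ht
        have : S.H (R t) = c₀ := hc₀ _ (hRO t ht')
        simp only [this]
        ring
      rw [hH, ← hRint _ hu1]
      have e4 := hφint _ hu1
      rw [← e2] at e4
      ext i
      fin_cases i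
      · simp only [Fin.zero_eta, PiLp.add_apply, Matrix.cons_val_zero]
        rw [e4] at e0
        linear_combination e0
      · simpa using e1
      · simp only [Fin.reduceFinMk, PiLp.add_apply, Matrix.cons_val]
        linear_combination e4
      · simpa using e3

theorem hasListedChart_of_a_eq_zero (h : S.IsAdapted X ε a b c d O) (hne : O.Nonempty)
    (had : ∀ u ∈ O, a u = 0 ∧ d u = 0) : S.HasListedChart X O := by
  have hO := h.isOpen
  have hun : ∀ u ∈ O, b u ^ 2 + c u ^ 2 = 1 := by
    intro u hu
    have := h.unit u hu
    rw [(had u hu).1, (had u hu).2] at this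
    rcases h.sign with rfl | rfl
    · nlinarith [sq_nonneg (b u), sq_nonneg (c u)]
    · linarith
  have htan : ∀ u ∈ O, ∀ v, b u * S.cofX X u v 1 + c u * S.cofX X u v 2 = 0 := by
    intro u hu v
    have := h.tangent u hu v
    rw [(had u hu).1, (had u hu).2] at this
    linarith
  have htw : ∀ u ∈ O, S.twist (X u 1) = 0 := by
    intro u hu
    obtain ⟨v, hv⟩ := h.surj u hu ![0, -c u, b u, 0] (by
      simp
      ring)
    have h1 := h.fderiv_a u hu v
    rw [((hasLineDerivAt_const (u := u) (v := v) (0 : ℝ)).congr_on hO hu fun x hx =>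
      (had x hx).1).eq_fderiv hO h.smooth_a hu, hv] at h1
    simp at h1
    rcases h1 with h1 | h1
    · exact h1
    · nlinarith [hun u hu]
  have hρ (B : Set E3) (hB : B ⊆ O) (hBo : IsOpen B) (hBc : Convex ℝ B) :
      ∃ ρ₀, ∀ u ∈ B, b u * S.D (X u 1) = ρ₀ :=
    exists_const_of_hasLineDerivAt hBo hBc
      ((h.smooth_b.mono hB).mul ((h.smooth_comp S.smooth_D).mono hB))
      fun u hu v => ((ContDiffOn.hasLineDerivAt hO h.smooth_b (hB hu) v).mul
        (h.hasLineDerivAt_comp_radius (hB hu) (hasDerivAt_D (h.mem u (hB hu))) v)).congr_deriv (by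
          rw [h.fderiv_b u (hB hu), htw u (hB hu), (had u (hB hu)).1,
            deriv_D_eq (h.mem u (hB hu))]
          linear_combination S.logDeriv (X u 1) * S.D (X u 1) * htan u (hB hu) v)
  rcases exists_open_ne_or_forall_eq hO h.smooth_c.continuousOn
    with h0 | ⟨O₁, hsub₁, hO₁, ⟨x₀, hx₀⟩, h1⟩
  · obtain ⟨B, hB, hBo, hBne, hBc⟩ := exists_ball_subset hO hne
    obtain ⟨ρ₀, hρ₀⟩ := hρ B hB hBo hBc
    have hA := h.mono hBo hB
    refine (hA.hasListedChart_of_arcLength hBne hBc (fun u hu => had u (hB hu))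
      (fun u hu => htw u (hB hu)) hρ₀ (σ := 1) (Or.inl rfl) (fun u hu => by simp [h0 u (hB hu)])
      (s := fun u => ρ₀ * X u 2) (contDiffOn_const.mul (hA.smooth_apply 2))
      fun u hu v => ((hasLineDerivAt_const ρ₀).mul
        (hA.hasLineDerivAt_apply hu v 2)).congr_deriv ?_).mono hB
    rw [h0 u (hB hu), ← hρ₀ u hu]
    simp [cofX, cof]
    ring
  · obtain ⟨σ, hσ, hσc⟩ : ∃ σ : ℝ, (σ = 1 ∨ σ = -1) ∧ 0 < -(σ * c x₀) := by
      rcases (h1 x₀ hx₀).lt_or_gt with hlt | hgt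
      · exact ⟨1, Or.inl rfl, by linarith⟩
      · exact ⟨-1, Or.inr rfl, by linarith⟩
    have hσσ : σ * σ = 1 := by rcases hσ with rfl | rfl <;> norm_num
    obtain ⟨B₁, hB₁, hB₁o, hB₁c, hxB₁⟩ : ∃ B ⊆ O ∩ (fun u => -(σ * c u)) ⁻¹' Ioi 0,
        IsOpen B ∧ Convex ℝ B ∧ x₀ ∈ B := by
      have hopen := ((continuousOn_const.mul h.smooth_c.continuousOn).neg).isOpen_inter_preimage
        (f := fun u => -(σ * c u)) hO (isOpen_Ioi (a := (0 : ℝ)))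
      obtain ⟨r, hr, hsub⟩ := Metric.isOpen_iff.1 hopen x₀ ⟨hsub₁ hx₀, hσc⟩
      exact ⟨_, hsub, Metric.isOpen_ball, convex_ball _ _, Metric.mem_ball_self hr⟩
    have hB₁O : B₁ ⊆ O := fun u hu => (hB₁ hu).1
    have hneg : ∀ u ∈ B₁, 0 < -(σ * c u) := fun u hu => (hB₁ hu).2
    obtain ⟨ρ₀, hρ₀⟩ := hρ B₁ hB₁O hB₁o hB₁c
    have hρD : ∀ u ∈ B₁, 1 - (ρ₀ / S.D (X u 1)) ^ 2 = (-(σ * c u)) ^ 2 := by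
      intro u hu
      have hD := S.D_ne_zero _ (h.mem u (hB₁O hu))
      rw [← hρ₀ u hu]
      field_simp
      linear_combination -hun u (hB₁O hu) - c u ^ 2 * hσσ
    have hJ : IsOpen (S.interval ∩ (fun r => 1 - (ρ₀ / S.D r) ^ 2) ⁻¹' Ioi 0) :=
      (continuousOn_const.sub ((continuousOn_const.div S.smooth_D.continuousOn
        S.D_ne_zero).pow 2)).isOpen_inter_preimage S.isOpen_interval isOpen_Ioi
    obtain ⟨l, r, hlr, hsub⟩ := mem_nhds_iff_exists_Ioo_subset.1 (hJ.mem_nhds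
      ⟨h.mem x₀ (hsub₁ hx₀), show 0 < 1 - (ρ₀ / S.D (X x₀ 1)) ^ 2 by
        rw [hρD x₀ hxB₁]
        exact pow_pos hσc 2⟩)
    obtain ⟨g, hg, hg'⟩ := exists_antideriv (l := l) (r := r)
      (g := fun t => (√(1 - (ρ₀ / S.D t) ^ 2))⁻¹) ((((contDiffOn_const.sub
        ((contDiffOn_const.div S.smooth_D S.D_ne_zero).pow 2)).mono fun t ht =>
          (hsub ht).1).sqrt fun t ht => (hsub ht).2.ne').inv
          fun t ht => (Real.sqrt_pos.2 (hsub ht).2).ne')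
    obtain ⟨B, hB, hBo, hBne, hBc⟩ := exists_ball_subset
      ((h.smooth_apply 1).continuousOn.mono hB₁O |>.isOpen_inter_preimage hB₁o
        (isOpen_Ioo (a := l) (b := r))) ⟨x₀, hxB₁, hlr⟩
    have hBB₁ : B ⊆ B₁ := fun u hu => (hB hu).1
    have hBO : B ⊆ O := hBB₁.trans hB₁O
    have hA := h.mono hBo hBO
    refine (hA.hasListedChart_of_arcLength hBne hBc (fun u hu => had u (hBO hu))
      (fun u hu => htw u (hBO hu)) (fun u hu => hρ₀ u (hBB₁ hu)) hσ
      (fun u hu => (hneg u (hBB₁ hu)).le) (s := fun u => g (X u 1))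
      (hg.comp (hA.smooth_apply 1) fun u hu => (hB hu).2) fun u hu v =>
        (hA.hasLineDerivAt_comp_radius hu (hg' _ (hB hu).2) v).congr_deriv ?_).mono hBO
    have hpos := hneg u (hBB₁ hu)
    rw [hρD u (hBB₁ hu), Real.sqrt_sq hpos.le]
    have hc0 : σ * c u ≠ 0 := fun h0 => by simp [h0] at hpos
    rw [inv_mul_eq_iff_eq_mul₀ hpos.ne']
    linear_combination (-(S.cofX X u v 1) * hun u (hBO hu)) + b u * htan u (hBO hu) v
      - c u * (c u * S.cofX X u v 1 - b u * S.cofX X u v 2) * hσσ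

end IsAdapted

end GodelType

open scoped ComplexConjugate

open Complex in
/-- A development of a Gödel-type spacetime with `H' = -2ΩD`, `D'' = 4Ω²D` into anti-de Sitter space,
realized as `{Im (conj z₁ z₂) = 1}` in `ℂ²`: `P` is the position, and `iP, Q, iQ` is the image of the
orthonormal frame. -/
structure GodelType.IsDevelopment (S : GodelType) (Ω : ℝ) (J : Set ℝ) (P Q : Fin 2 → E4 → ℂ) :
    Prop where
  smooth_P : ∀ k, ContDiff ℝ ∞ (P k)
  smooth_Q : ∀ k, ContDiff ℝ ∞ (Q k)
  fderiv_P : ∀ k x v, x 1 ∈ J → fderiv ℝ (P k) x v =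
    I * Ω * S.cof x v 0 * P k x + Ω * (S.cof x v 1 + I * S.cof x v 2) * Q k x
  fderiv_Q : ∀ k x v, x 1 ∈ J → fderiv ℝ (Q k) x v =
    I * (Ω * S.cof x v 0 + S.logDeriv (x 1) * S.cof x v 2) * Q k x
      + Ω * (S.cof x v 1 - I * S.cof x v 2) * P k x
  im_P : ∀ x, (conj (P 0 x) * P 1 x).im = 1
  im_Q : ∀ x, (conj (Q 0 x) * Q 1 x).im = -1
  conj_mul : ∀ x, conj (P 0 x) * Q 1 x = Q 0 x * conj (P 1 x)

section Development

open Complex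

/-- The coefficients of the development. -/
def devCoeff (Ω p q : ℝ) (A B : ℝ → ℝ) (k : Fin 2) (x : E4) : ℂ :=
  ![((A (x 2) * Real.exp (Ω * x 1) : ℝ) : ℂ) + I * ((B (x 2) * p * Real.exp (-(Ω * x 1)) : ℝ) : ℂ),
    ((B (x 2) * q * Real.exp (Ω * x 1) : ℝ) : ℂ) + I * ((A (x 2) * Real.exp (-(Ω * x 1)) : ℝ) : ℂ)] k

/-- The phase of the development. -/
def devPhase (Ω κ : ℝ) (x : E4) : ℂ := exp (I * ((Ω * (x 0 + κ * x 2) : ℝ) : ℂ))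

/-- The position of the development. -/
def devP (Ω κ p q : ℝ) (A B : ℝ → ℝ) (k : Fin 2) (x : E4) : ℂ :=
  devCoeff Ω p q A B k x * devPhase Ω κ x

/-- The radial frame vector of the development. -/
def devQ (Ω κ p q : ℝ) (A B : ℝ → ℝ) (k : Fin 2) (x : E4) : ℂ :=
  conj (devCoeff Ω p q A B k x) * devPhase Ω κ x

variable {Ω κ p q : ℝ} {A B : ℝ → ℝ}

theorem contDiff_devCoeff (hA : ContDiff ℝ ∞ A) (hB : ContDiff ℝ ∞ B) (k : Fin 2) :
    ContDiff ℝ ∞ (devCoeff Ω p q A B k) := by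
  have hx (i : Fin 4) : ContDiff ℝ ∞ (fun x : E4 => x i) := by fun_prop
  have hE : ContDiff ℝ ∞ (fun x : E4 => Real.exp (Ω * x 1)) := (contDiff_const.mul (hx 1)).exp
  have hE' : ContDiff ℝ ∞ (fun x : E4 => Real.exp (-(Ω * x 1))) :=
    (contDiff_const.mul (hx 1)).neg.exp
  have hA' := hA.comp (hx 2)
  have hB' := hB.comp (hx 2)
  fin_cases k
  · exact (ofRealCLM.contDiff.comp (hA'.mul hE)).add
      (contDiff_const.mul (ofRealCLM.contDiff.comp ((hB'.mul contDiff_const).mul hE')))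
  · exact (ofRealCLM.contDiff.comp ((hB'.mul contDiff_const).mul hE)).add
      (contDiff_const.mul (ofRealCLM.contDiff.comp (hA'.mul hE')))

theorem contDiff_devPhase : ContDiff ℝ ∞ (devPhase Ω κ) := by
  have hx (i : Fin 4) : ContDiff ℝ ∞ (fun x : E4 => x i) := by fun_prop
  exact (contDiff_const.mul (ofRealCLM.contDiff.comp
    (contDiff_const.mul ((hx 0).add (contDiff_const.mul (hx 2)))))).cexp

theorem hasDerivAt_line (x v : E4) (i : Fin 4) : HasDerivAt (fun s : ℝ => (x + s • v) i) (v i) 0 := by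
  simpa using ((hasDerivAt_id (0 : ℝ)).mul_const (v i)).const_add (x i)

theorem hasDerivAt_devCoeff (hA : ∀ s, HasDerivAt A (p * q * B s) s)
    (hB : ∀ s, HasDerivAt B (A s) s) (k : Fin 2) (x v : E4) :
    HasDerivAt (fun s : ℝ => devCoeff Ω p q A B k (x + s • v))
      (Ω * v 1 * conj (devCoeff Ω p q A B k x)
        + v 2 * (![(p : ℂ), q] k * devCoeff Ω p q A B (![1, 0] k) x)) 0 := by
  have hx := hasDerivAt_line x v
  have h0 : x + (0 : ℝ) • v = x := by simp
  have hA' : HasDerivAt (fun s : ℝ => A ((x + s • v) 2)) (p * q * B (x 2) * v 2) 0 :=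
    HasDerivAt.comp (h₂ := A) (0 : ℝ) (by simpa using hA (x 2)) (hx 2)
  have hB' : HasDerivAt (fun s : ℝ => B ((x + s • v) 2)) (A (x 2) * v 2) 0 :=
    HasDerivAt.comp (h₂ := B) (0 : ℝ) (by simpa using hB (x 2)) (hx 2)
  have hE : HasDerivAt (fun s : ℝ => Real.exp (Ω * (x + s • v) 1))
      (Real.exp (Ω * x 1) * (Ω * v 1)) 0 := by
    simpa using ((hx 1).const_mul Ω).exp
  have hE' : HasDerivAt (fun s : ℝ => Real.exp (-(Ω * (x + s • v) 1)))
      (Real.exp (-(Ω * x 1)) * (-(Ω * v 1))) 0 := by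
    simpa using ((hx 1).const_mul Ω).neg.exp
  fin_cases k
  · refine ((hA'.mul hE).ofReal_comp.add
      (((hB'.mul_const p).mul hE').ofReal_comp.const_mul I)).congr_deriv ?_
    simp [devCoeff, -ofReal_exp]
    ring
  · refine (((hB'.mul_const q).mul hE).ofReal_comp.add
      ((hA'.mul hE').ofReal_comp.const_mul I)).congr_deriv ?_
    simp [devCoeff, -ofReal_exp]
    ring

theorem hasDerivAt_devPhase (x v : E4) :
    HasDerivAt (fun s : ℝ => devPhase Ω κ (x + s • v))
      (I * Ω * (v 0 + κ * v 2) * devPhase Ω κ x) 0 := by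
  have hx := hasDerivAt_line x v
  have h := ((((hx 0).add ((hx 2).const_mul κ)).const_mul Ω).ofReal_comp.const_mul I).cexp
  refine h.congr_deriv ?_
  simp [devPhase]
  ring

theorem devCoeff_frame {S : GodelType} {x : E4}
    (hD : 2 * Ω * S.D (x 1) = q * Real.exp (Ω * x 1) ^ 2 + p * Real.exp (-(Ω * x 1)) ^ 2)
    (hH : 2 * Ω * (κ - S.H (x 1)) = q * Real.exp (Ω * x 1) ^ 2 - p * Real.exp (-(Ω * x 1)) ^ 2)
    (k : Fin 2) :
    ![(p : ℂ), q] k * devCoeff Ω p q A B (![1, 0] k) x =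
      I * Ω * S.D (x 1) * conj (devCoeff Ω p q A B k x)
        - I * Ω * (κ - S.H (x 1)) * devCoeff Ω p q A B k x := by
  have hE : Real.exp (Ω * x 1) * Real.exp (-(Ω * x 1)) = 1 := by
    rw [← Real.exp_add]
    simp
  set E := Real.exp (Ω * x 1) with hEd
  set E' := Real.exp (-(Ω * x 1)) with hEd'
  have hE' : (E : ℂ) * E' = 1 := by exact_mod_cast hE
  have hD' : 2 * (Ω : ℂ) * S.D (x 1) = q * E ^ 2 + p * E' ^ 2 := by exact_mod_cast hD
  have hH' : 2 * (Ω : ℂ) * (κ - S.H (x 1)) = q * E ^ 2 - p * E' ^ 2 := by exact_mod_cast hH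
  fin_cases k
  · simp [devCoeff, -ofReal_exp, ← hEd, ← hEd']
    linear_combination -(1 / 2) * I * (A (x 2) * E - I * (B (x 2) * p * E')) * hD'
      + (1 / 2) * I * (A (x 2) * E + I * (B (x 2) * p * E')) * hH'
      - (I * p * A (x 2) * E' + p * q * B (x 2) * E) * hE' + q * B (x 2) * p * E ^ 2 * E' * I_sq
  · simp [devCoeff, -ofReal_exp, ← hEd, ← hEd']
    linear_combination -(1 / 2) * I * (B (x 2) * q * E - I * (A (x 2) * E')) * hD'
      + (1 / 2) * I * (B (x 2) * q * E + I * (A (x 2) * E')) * hH'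
      - (I * p * q * B (x 2) * E' + q * A (x 2) * E) * hE' + q * A (x 2) * E ^ 2 * E' * I_sq

theorem hasDerivAt_devP (hA : ∀ s, HasDerivAt A (p * q * B s) s)
    (hB : ∀ s, HasDerivAt B (A s) s) (k : Fin 2) (x v : E4) :
    HasDerivAt (fun s : ℝ => devP Ω κ p q A B k (x + s • v))
      (I * Ω * (v 0 + κ * v 2) * devP Ω κ p q A B k x + (Ω * v 1 * conj (devCoeff Ω p q A B k x)
        + v 2 * (![(p : ℂ), q] k * devCoeff Ω p q A B (![1, 0] k) x)) * devPhase Ω κ x) 0 := by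
  refine ((hasDerivAt_devCoeff hA hB k x v).mul (hasDerivAt_devPhase x v)).congr_deriv ?_
  simp only [zero_smul, add_zero, devP]
  ring

theorem hasDerivAt_devQ (hA : ∀ s, HasDerivAt A (p * q * B s) s)
    (hB : ∀ s, HasDerivAt B (A s) s) (k : Fin 2) (x v : E4) :
    HasDerivAt (fun s : ℝ => devQ Ω κ p q A B k (x + s • v))
      (I * Ω * (v 0 + κ * v 2) * devQ Ω κ p q A B k x +
        conj (Ω * v 1 * conj (devCoeff Ω p q A B k x)
        + v 2 * (![(p : ℂ), q] k * devCoeff Ω p q A B (![1, 0] k) x)) * devPhase Ω κ x) 0 := by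
  have h := conjCLE.toContinuousLinearMap.hasFDerivAt.comp_hasDerivAt (0 : ℝ)
    (hasDerivAt_devCoeff (Ω := Ω) hA hB k x v)
  refine (h.mul (hasDerivAt_devPhase x v)).congr_deriv ?_
  simp only [zero_smul, add_zero, devQ, Function.comp]
  simp
  ring

theorem isDevelopment_dev {S : GodelType} {J : Set ℝ} (hJ : IsOpen J) (hJS : J ⊆ S.interval)
    (hΩ : Ω ≠ 0) (hA : ∀ s, HasDerivAt A (p * q * B s) s) (hB : ∀ s, HasDerivAt B (A s) s)
    (hAB : ∀ s, A s ^ 2 - p * q * B s ^ 2 = 1)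
    (hD : ∀ r ∈ J, 2 * Ω * S.D r = q * Real.exp (Ω * r) ^ 2 + p * Real.exp (-(Ω * r)) ^ 2)
    (hH : ∀ r ∈ J, 2 * Ω * (κ - S.H r) = q * Real.exp (Ω * r) ^ 2 - p * Real.exp (-(Ω * r)) ^ 2) :
    S.IsDevelopment Ω J (devP Ω κ p q A B) (devQ Ω κ p q A B) := by
  have hAB' : ContDiff ℝ ∞ A ∧ ContDiff ℝ ∞ B := by
    have dA : deriv A = fun s => p * q * B s := funext fun s => (hA s).deriv
    have dB : deriv B = A := funext fun s => (hB s).deriv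
    have key : ∀ n : ℕ, ContDiff ℝ n A ∧ ContDiff ℝ n B := by
      intro n
      induction n with
      | zero =>
        exact ⟨contDiff_zero.2 (continuous_iff_continuousAt.2 fun s => (hA s).continuousAt),
          contDiff_zero.2 (continuous_iff_continuousAt.2 fun s => (hB s).continuousAt)⟩
      | succ n ih =>
        push_cast
        rw [contDiff_succ_iff_deriv, contDiff_succ_iff_deriv, dA, dB]
        exact ⟨⟨fun s => (hA s).differentiableAt, by simp, contDiff_const.mul ih.2⟩,
          fun s => (hB s).differentiableAt, by simp, ih.1⟩
    exact ⟨contDiff_infty.2 fun n => (key n).1, contDiff_infty.2 fun n => (key n).2⟩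
  have sP (k : Fin 2) : ContDiff ℝ ∞ (devP Ω κ p q A B k) :=
    (contDiff_devCoeff hAB'.1 hAB'.2 k).mul contDiff_devPhase
  have sQ (k : Fin 2) : ContDiff ℝ ∞ (devQ Ω κ p q A B k) :=
    (conjCLE.contDiff.comp (contDiff_devCoeff hAB'.1 hAB'.2 k)).mul contDiff_devPhase
  have hphase (x : E4) : conj (devPhase Ω κ x) * devPhase Ω κ x = 1 := by
    rw [devPhase, ← exp_conj, ← exp_add]
    simp
  have hE (x : E4) : Real.exp (Ω * x 1) * Real.exp (-(Ω * x 1)) = 1 := by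
    rw [← Real.exp_add]
    simp
  have hc (x : E4) : conj (devCoeff Ω p q A B 0 x) * devCoeff Ω p q A B 1 x =
      ((A (x 2) * B (x 2) * (q * Real.exp (Ω * x 1) ^ 2 + p * Real.exp (-(Ω * x 1)) ^ 2) : ℝ) : ℂ)
        + I := by
    have h1 : ((A (x 2) ^ 2 - p * q * B (x 2) ^ 2 : ℝ) : ℂ) = 1 := by
      rw [hAB]
      simp
    have h2 : ((Real.exp (Ω * x 1) * Real.exp (-(Ω * x 1)) : ℝ) : ℂ) = 1 := by
      rw [hE]
      simp
    set E := Real.exp (Ω * x 1) with hEd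
    set E' := Real.exp (-(Ω * x 1)) with hEd'
    push_cast at h1 h2
    simp [devCoeff, -ofReal_exp, ← hEd, ← hEd']
    linear_combination I * (A (x 2) ^ 2 - p * q * B (x 2) ^ 2) * h2 + I * h1
      - A (x 2) * B (x 2) * p * E' ^ 2 * I_sq
  have hlog : ∀ r ∈ J, S.logDeriv r * S.D r = 2 * Ω * (κ - S.H r) := by
    intro r hr
    have hD0 := S.D_ne_zero r (hJS hr)
    have h1 : HasDerivAt (fun r => (2 * Ω)⁻¹ * (q * Real.exp (Ω * r) ^ 2
        + p * Real.exp (-(Ω * r)) ^ 2)) (q * Real.exp (Ω * r) ^ 2 - p * Real.exp (-(Ω * r)) ^ 2) r := by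
      have e1 : HasDerivAt (fun r => Real.exp (Ω * r)) (Real.exp (Ω * r) * Ω) r := by
        simpa using ((hasDerivAt_id r).const_mul Ω).exp
      have e2 : HasDerivAt (fun r => Real.exp (-(Ω * r))) (Real.exp (-(Ω * r)) * -Ω) r := by
        simpa using ((hasDerivAt_id r).const_mul Ω).neg.exp
      refine (((e1.pow 2).const_mul q).add ((e2.pow 2).const_mul p)).const_mul (2 * Ω)⁻¹
        |>.congr_deriv ?_
      field_simp
      norm_num
      ring
    have h2 : S.D =ᶠ[𝓝 r] fun r => (2 * Ω)⁻¹ * (q * Real.exp (Ω * r) ^ 2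
        + p * Real.exp (-(Ω * r)) ^ 2) := by
      filter_upwards [hJ.mem_nhds hr] with t ht
      rw [← hD t ht]
      field_simp
    rw [GodelType.logDeriv, div_mul_cancel₀ _ hD0, h2.deriv_eq, h1.deriv, hH r hr]
  refine ⟨sP, sQ, ?_, ?_, ?_, ?_, ?_⟩
  · intro k x v hx
    have h1 := (((sP k).differentiable (by simp)) x).hasFDerivAt.hasLineDerivAt v
    have h2 := HasDerivAt.unique h1 (hasDerivAt_devP hA hB k x v)
    rw [h2, devCoeff_frame (hD _ hx) (hH _ hx)]
    simp [GodelType.cof, devP, devQ]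
    ring
  · intro k x v hx
    have h1 := (((sQ k).differentiable (by simp)) x).hasFDerivAt.hasLineDerivAt v
    have h2 := HasDerivAt.unique h1 (hasDerivAt_devQ hA hB k x v)
    have h3 : (S.logDeriv (x 1) : ℂ) * S.D (x 1) = 2 * Ω * (κ - S.H (x 1)) := by
      exact_mod_cast hlog _ hx
    rw [h2, devCoeff_frame (hD _ hx) (hH _ hx)]
    simp [GodelType.cof, devP, devQ]
    linear_combination -I * v 2 * conj (devCoeff Ω p q A B k x) * devPhase Ω κ x * h3
  · intro x
    have : conj (devP Ω κ p q A B 0 x) * devP Ω κ p q A B 1 x =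
        conj (devCoeff Ω p q A B 0 x) * devCoeff Ω p q A B 1 x := by
      simp only [devP, map_mul]
      linear_combination conj (devCoeff Ω p q A B 0 x) * devCoeff Ω p q A B 1 x * hphase x
    rw [this, hc]
    rw [add_im, ofReal_im]
    simp
  · intro x
    have : conj (devQ Ω κ p q A B 0 x) * devQ Ω κ p q A B 1 x =
        conj (conj (devCoeff Ω p q A B 0 x) * devCoeff Ω p q A B 1 x) := by
      simp only [devQ, map_mul, conj_conj]
      linear_combination devCoeff Ω p q A B 0 x * conj (devCoeff Ω p q A B 1 x) * hphase x
    rw [this, hc, conj_im, add_im, ofReal_im]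
    simp
  · intro x
    simp only [devP, devQ, map_mul]
    ring

end Development

section AntiDeSitter

open scoped ComplexConjugate
open Complex

/-- The polarization of `Im (conj z₁ z₂)`. -/
def sform (z w : ℂ × ℂ) : ℝ := ((conj z.1 * w.2).im + (conj w.1 * z.2).im) / 2

theorem sform_frame {P₀ P₁ Q₀ Q₁ : ℂ} (hP : (conj P₀ * P₁).im = 1) (hQ : (conj Q₀ * Q₁).im = -1)
    (hPQ : conj P₀ * Q₁ = Q₀ * conj P₁) (α β γ δ : ℂ) :
    sform (α * P₀ + β * Q₀, α * P₁ + β * Q₁) (γ * P₀ + δ * Q₀, γ * P₁ + δ * Q₁) =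
      (conj α * γ).re - (conj β * δ).re := by
  have h1 := congrArg re hPQ
  have h2 := congrArg im hPQ
  simp [sform] at hP hQ h1 h2 ⊢
  linear_combination (α.re * γ.re + α.im * γ.im) * hP + (β.re * δ.re + β.im * δ.im) * hQ
    + (α.re * δ.re + α.im * δ.im + γ.re * β.re + γ.im * β.im) / 2 * h2
    + (α.re * δ.im - α.im * δ.re + γ.re * β.im - γ.im * β.re) / 2 * h1

/-- The linear action of a real `2 × 2` matrix of determinant one on `ℂ²`. -/
def realAct {k l m n : ℝ} (h : k * n - l * m = 1) : (ℂ × ℂ) ≃L[ℝ] (ℂ × ℂ) :=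
  ContinuousLinearEquiv.equivOfInverse
    ((k • ContinuousLinearMap.fst ℝ ℂ ℂ + l • ContinuousLinearMap.snd ℝ ℂ ℂ).prod
      (m • ContinuousLinearMap.fst ℝ ℂ ℂ + n • ContinuousLinearMap.snd ℝ ℂ ℂ))
    ((n • ContinuousLinearMap.fst ℝ ℂ ℂ - l • ContinuousLinearMap.snd ℝ ℂ ℂ).prod
      (-m • ContinuousLinearMap.fst ℝ ℂ ℂ + k • ContinuousLinearMap.snd ℝ ℂ ℂ))
    (fun z => by
      have h' : (k : ℂ) * n - l * m = 1 := by exact_mod_cast h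
      ext1
      · simp
        linear_combination z.1 * h'
      · simp
        linear_combination z.2 * h')
    (fun z => by
      have h' : (k : ℂ) * n - l * m = 1 := by exact_mod_cast h
      ext1
      · simp
        linear_combination z.1 * h'
      · simp
        linear_combination z.2 * h')

theorem realAct_apply {k l m n : ℝ} (h : k * n - l * m = 1) (z : ℂ × ℂ) :
    realAct h z = (k * z.1 + l * z.2, m * z.1 + n * z.2) := by
  ext1 <;> simp [realAct]

theorem sform_realAct {k l m n : ℝ} (h : k * n - l * m = 1) (z w : ℂ × ℂ) :
    sform (realAct h z) (realAct h w) = sform z w := by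
  simp [realAct_apply, sform]
  linear_combination (z.1.re * w.2.im - z.1.im * w.2.re + w.1.re * z.2.im - w.1.im * z.2.re) * h

/-- The cone over the development. -/
def coneMap (P : Fin 2 → E4 → ℂ) (x : E4) : ℂ × ℂ :=
  (Real.exp (x 3) * P 0 x, Real.exp (x 3) * P 1 x)

/-- The metric of the cone in which the radial parameter `e^z` is replaced by `z`. -/
def coneMetric (Ω : ℝ) (z v w : ℂ × ℂ) : ℝ :=
  sform v w / (Ω ^ 2 * sform z z) - (1 + 1 / Ω ^ 2) * (sform z v * sform z w) / sform z z ^ 2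

namespace GodelType

variable {S T : GodelType} {Ω : ℝ} {J J' : Set ℝ} {P Q P' Q' : Fin 2 → E4 → ℂ}

namespace IsDevelopment

theorem contDiff_coneMap (h : S.IsDevelopment Ω J P Q) : ContDiff ℝ ∞ (coneMap P) := by
  have hx : ContDiff ℝ ∞ (fun x : E4 => (Real.exp (x 3) : ℂ)) :=
    ofRealCLM.contDiff.comp (by fun_prop : ContDiff ℝ ∞ (fun x : E4 => x 3)).exp
  exact (hx.mul (h.smooth_P 0)).prodMk (hx.mul (h.smooth_P 1))

theorem fderiv_coneMap (h : S.IsDevelopment Ω J P Q) {x : E4} (hx : x 1 ∈ J) (v : E4) :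
    fderiv ℝ (coneMap P) x v =
      (Real.exp (x 3) * (v 3 + I * Ω * S.cof x v 0) * P 0 x
        + Real.exp (x 3) * (Ω * (S.cof x v 1 + I * S.cof x v 2)) * Q 0 x,
       Real.exp (x 3) * (v 3 + I * Ω * S.cof x v 0) * P 1 x
        + Real.exp (x 3) * (Ω * (S.cof x v 1 + I * S.cof x v 2)) * Q 1 x) := by
  have hP (k : Fin 2) := (((h.smooth_P k).differentiable (by simp)) x).hasFDerivAt.hasLineDerivAt v
  have hE : HasDerivAt (fun s : ℝ => (Real.exp ((x + s • v) 3) : ℂ)) (Real.exp (x 3) * v 3 : ℝ) 0 := by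
    simpa using ((hasDerivAt_line x v 3).exp).ofReal_comp
  have hk (k : Fin 2) : HasDerivAt (fun s : ℝ => (Real.exp ((x + s • v) 3) : ℂ) * P k (x + s • v))
      (Real.exp (x 3) * (v 3 + I * Ω * S.cof x v 0) * P k x
        + Real.exp (x 3) * (Ω * (S.cof x v 1 + I * S.cof x v 2)) * Q k x) 0 := by
    refine (hE.mul (hP k)).congr_deriv ?_
    rw [h.fderiv_P k x v hx]
    simp
    ring
  have h1 := ((h.contDiff_coneMap.differentiable (by simp)) x).hasFDerivAt.hasLineDerivAt v
  exact HasDerivAt.unique h1 ((hk 0).prodMk (hk 1))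

theorem sform_coneMap (h : S.IsDevelopment Ω J P Q) (x : E4) :
    sform (coneMap P x) (coneMap P x) = Real.exp (x 3) ^ 2 := by
  have := sform_frame (h.im_P x) (h.im_Q x) (h.conj_mul x) (Real.exp (x 3)) 0 (Real.exp (x 3)) 0
  simp [-ofReal_exp] at this
  rw [coneMap, this]
  ring

theorem metric_eq_coneMetric (h : S.IsDevelopment Ω J P Q) (hΩ : Ω ≠ 0) {x : E4} (hx : x 1 ∈ J)
    (v w : E4) : S.metric x v w =
      coneMetric Ω (coneMap P x) (fderiv ℝ (coneMap P) x v) (fderiv ℝ (coneMap P) x w) := by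
  have hE := (Real.exp_pos (x 3)).ne'
  have h1 (v : E4) : sform (coneMap P x) (fderiv ℝ (coneMap P) x v)
      = Real.exp (x 3) ^ 2 * v 3 := by
    have := sform_frame (h.im_P x) (h.im_Q x) (h.conj_mul x) (Real.exp (x 3)) 0
      (Real.exp (x 3) * (v 3 + I * Ω * S.cof x v 0))
      (Real.exp (x 3) * (Ω * (S.cof x v 1 + I * S.cof x v 2)))
    rw [zero_mul, zero_mul, add_zero, add_zero] at this
    rw [h.fderiv_coneMap hx, coneMap, this]
    simp [-ofReal_exp]
    ring
  have h2 : sform (fderiv ℝ (coneMap P) x v) (fderiv ℝ (coneMap P) x w) =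
      Real.exp (x 3) ^ 2 * (v 3 * w 3 + Ω ^ 2 * (S.cof x v 0 * S.cof x w 0
        - S.cof x v 1 * S.cof x w 1 - S.cof x v 2 * S.cof x w 2)) := by
    rw [h.fderiv_coneMap hx, h.fderiv_coneMap hx,
      sform_frame (h.im_P x) (h.im_Q x) (h.conj_mul x)]
    simp [-ofReal_exp]
    ring
  rw [coneMetric, h.sform_coneMap, h1, h1, h2, metric_eq_cof]
  have h3 (v : E4) : S.cof x v 3 = v 3 := rfl
  rw [h3, h3]
  field_simp
  ring

theorem fderiv_coneMap_injective (h : S.IsDevelopment Ω J P Q) (hΩ : Ω ≠ 0)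
    (hJ : J ⊆ S.interval) {x : E4} (hx : x 1 ∈ J) {v : E4}
    (hv : fderiv ℝ (coneMap P) x v = 0) : v = 0 := by
  have hm (w : E4) : S.metric x v w = 0 := by
    rw [h.metric_eq_coneMetric hΩ hx, hv]
    simp [coneMetric, sform]
  apply eq_zero_of_cof_eq_zero (S := S) (x := x) (hJ hx)
  intro i
  have h1 (y : Fin 4 → ℝ) := hm (S.frameVec x y)
  simp only [metric_eq_cof, cof_frameVec (S := S) (x := x) (hJ hx)] at h1
  fin_cases i
  · simpa using h1 ![1, 0, 0, 0]
  · simpa using h1 ![0, 1, 0, 0]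
  · simpa using h1 ![0, 0, 1, 0]
  · simpa using h1 ![0, 0, 0, 1]

/-- Two spacetimes with developments are locally isometric, compatibly with any linear isometry. -/
theorem exists_isLocalIsometry (h : S.IsDevelopment Ω J P Q) (h' : T.IsDevelopment Ω J' P' Q')
    (hΩ : Ω ≠ 0) (hJ : IsOpen J) (hJ' : IsOpen J') (hJS : J ⊆ S.interval) (hJT : J' ⊆ T.interval)
    (e : (ℂ × ℂ) ≃L[ℝ] (ℂ × ℂ)) (he : ∀ z w, sform (e z) (e w) = sform z w) {x₀ q₀ : E4}
    (hx₀ : x₀ 1 ∈ J) (hq₀ : q₀ 1 ∈ J') (h₀ : coneMap P' q₀ = e (coneMap P x₀)) :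
    ∃ Ψ : OpenPartialHomeomorph E4 E4, IsLocalIsometry S T Ψ ∧ x₀ ∈ Ψ.source ∧ Ψ x₀ = q₀ ∧
      ∀ x ∈ Ψ.source, x 1 ∈ J ∧ Ψ x 1 ∈ J' ∧ coneMap P' (Ψ x) = e (coneMap P x) := by
  have hdim : Module.finrank ℝ E4 = Module.finrank ℝ (ℂ × ℂ) := by simp
  have hopen {J : Set ℝ} (hJ : IsOpen J) : IsOpen {x : E4 | x 1 ∈ J} :=
    hJ.preimage (by fun_prop : Continuous fun x : E4 => x 1)
  obtain ⟨f, hf0, hfs, hfe, hfsm⟩ := exists_openPartialHomeomorph hdim (hopen hJ)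
    h.contDiff_coneMap.contDiffOn (fun x hx v hv => h.fderiv_coneMap_injective hΩ hJS hx hv) hx₀
  obtain ⟨g, hg0, hgs, hge, hgsm⟩ := exists_openPartialHomeomorph hdim (hopen hJ')
    h'.contDiff_coneMap.contDiffOn (fun x hx v hv => h'.fderiv_coneMap_injective hΩ hJT hx hv) hq₀
  set Ψ : OpenPartialHomeomorph E4 E4 :=
    (f.trans e.toHomeomorph.toOpenPartialHomeomorph).trans g.symm with hΨ
  have hsrc : ∀ x, x ∈ Ψ.source ↔ x ∈ f.source ∧ e (f x) ∈ g.target := by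
    intro x
    simp [hΨ]
  have htgt : ∀ y, y ∈ Ψ.target ↔ y ∈ g.source ∧ e.symm (g y) ∈ f.target := by
    intro y
    simp [hΨ]
  have hΨe : ∀ x, Ψ x = g.symm (e (f x)) := fun x => rfl
  have hΨs : ∀ y, Ψ.symm y = f.symm (e.symm (g y)) := fun x => rfl
  have hcone : ∀ x ∈ Ψ.source, x 1 ∈ J ∧ Ψ x 1 ∈ J' ∧ coneMap P' (Ψ x) = e (coneMap P x) := by
    intro x hx
    have hx' := (hsrc x).1 hx
    refine ⟨hfs hx'.1, hgs (g.map_target hx'.2), ?_⟩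
    rw [← hge, ← hfe, hΨe, g.right_inv hx'.2]
  have hsm : ContDiffOn ℝ ∞ Ψ Ψ.source := by
    refine (hgsm.comp ((e.contDiff.comp h.contDiff_coneMap).contDiffOn (s := Ψ.source))
      fun x hx => ?_).congr fun x hx => ?_
    · have := ((hsrc x).1 hx).2
      rwa [hfe] at this
    · rw [hΨe, hfe]
      rfl
  have hsms : ContDiffOn ℝ ∞ Ψ.symm Ψ.target := by
    refine (hfsm.comp ((e.symm.contDiff.comp h'.contDiff_coneMap).contDiffOn (s := Ψ.target))
      fun y hy => ?_).congr fun y hy => ?_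
    · have := ((htgt y).1 hy).2
      rwa [hge] at this
    · rw [hΨs, hge]
      rfl
  refine ⟨Ψ, ⟨fun x hx => hJS (hcone x hx).1, fun y hy => ?_, hsm, hsms, ?_⟩, ?_, ?_, hcone⟩
  · exact hJT (hgs ((htgt y).1 hy).1)
  · intro x hx v w
    obtain ⟨h1, h2, h3⟩ := hcone x hx
    have d1 : HasFDerivAt Ψ (fderiv ℝ Ψ x) x :=
      ((hsm.contDiffAt (Ψ.open_source.mem_nhds hx)).differentiableAt (by simp)).hasFDerivAt
    have d2 := ((h'.contDiff_coneMap.differentiable (by simp)) (Ψ x)).hasFDerivAt.comp x d1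
    have d3 := e.toContinuousLinearMap.hasFDerivAt.comp x
      ((h.contDiff_coneMap.differentiable (by simp)) x).hasFDerivAt
    have d4 := d2.unique (d3.congr_of_eventuallyEq (by
      filter_upwards [Ψ.open_source.mem_nhds hx] with y hy using (hcone y hy).2.2))
    have d5 (v : E4) : fderiv ℝ (coneMap P') (Ψ x) (fderiv ℝ Ψ x v)
        = e (fderiv ℝ (coneMap P) x v) := DFunLike.congr_fun d4 v
    rw [h'.metric_eq_coneMetric hΩ h2, h.metric_eq_coneMetric hΩ h1, d5, d5, h3]
    simp only [coneMetric, he]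
  · rw [hsrc, hfe, ← h₀, ← hge]
    exact ⟨hf0, g.map_source hg0⟩
  · rw [hΨe, hfe, ← h₀, ← hge, g.left_inv hg0]

end IsDevelopment

end GodelType

end AntiDeSitter

section Limiting

open Complex

theorem exists_generalized_trig (δ : ℝ) : ∃ A B : ℝ → ℝ, (∀ s, HasDerivAt A (δ * B s) s) ∧
    (∀ s, HasDerivAt B (A s) s) ∧ ∀ s, A s ^ 2 - δ * B s ^ 2 = 1 := by
  rcases lt_trichotomy δ 0 with h | rfl | h
  · obtain ⟨k, hk, rfl⟩ : ∃ k : ℝ, 0 < k ∧ δ = -k ^ 2 :=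
      ⟨√(-δ), Real.sqrt_pos.2 (by linarith), by rw [Real.sq_sqrt (by linarith)]; ring⟩
    refine ⟨fun s => Real.cos (k * s), fun s => Real.sin (k * s) / k, fun s => ?_, fun s => ?_,
      fun s => ?_⟩
    · refine ((Real.hasDerivAt_cos _).comp s ((hasDerivAt_id s).const_mul k)).congr_deriv ?_
      field_simp
      simp
    · refine (((Real.hasDerivAt_sin _).comp s ((hasDerivAt_id s).const_mul k)).div_const
        k).congr_deriv ?_
      field_simp
      simp
    · field_simp
      linear_combination Real.sin_sq_add_cos_sq (k * s)
  · exact ⟨fun _ => 1, fun s => s, fun s => by simpa using hasDerivAt_const s (1 : ℝ),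
      fun s => hasDerivAt_id s, fun s => by simp⟩
  · obtain ⟨k, hk, rfl⟩ : ∃ k : ℝ, 0 < k ∧ δ = k ^ 2 :=
      ⟨√δ, Real.sqrt_pos.2 h, (Real.sq_sqrt h.le).symm⟩
    refine ⟨fun s => Real.cosh (k * s), fun s => Real.sinh (k * s) / k, fun s => ?_, fun s => ?_,
      fun s => ?_⟩
    · refine ((Real.hasDerivAt_cosh _).comp s ((hasDerivAt_id s).const_mul k)).congr_deriv ?_
      field_simp
      simp
    · refine (((Real.hasDerivAt_sinh _).comp s ((hasDerivAt_id s).const_mul k)).div_const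
        k).congr_deriv ?_
      field_simp
      simp
    · field_simp
      linear_combination Real.cosh_sq (k * s)

theorem IsOpen.exists_const_of_hasDerivAt_zero {J : Set ℝ} (hJ : IsOpen J) (hc : IsPreconnected J)
    {f : ℝ → ℝ} (hf : ∀ r ∈ J, HasDerivAt f 0 r) : ∃ k, ∀ r ∈ J, f r = k :=
  hJ.exists_is_const_of_deriv_eq_zero hc
    (fun r hr => (hf r hr).differentiableAt.differentiableWithinAt) fun r hr => (hf r hr).deriv

namespace GodelType

theorem exists_isDevelopment {S : GodelType} {Ω : ℝ} (hΩ : Ω ≠ 0) {J : Set ℝ} (hJ : IsOpen J)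
    (hc : IsPreconnected J) (hJS : J ⊆ S.interval)
    (hH : ∀ r ∈ J, deriv S.H r = -2 * Ω * S.D r)
    (hD : ∀ r ∈ J, deriv (deriv S.D) r = 4 * Ω ^ 2 * S.D r) :
    ∃ P Q, S.IsDevelopment Ω J P Q := by
  have dH : ∀ r ∈ J, HasDerivAt S.H (-2 * Ω * S.D r) r := fun r hr => by
    rw [← hH r hr]
    exact hasDerivAt_H (hJS hr)
  have dD : ∀ r ∈ J, HasDerivAt S.D (deriv S.D r) r := fun r hr => hasDerivAt_D (hJS hr)
  have dD' : ∀ r ∈ J, HasDerivAt (deriv S.D) (4 * Ω ^ 2 * S.D r) r := fun r hr => by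
    rw [← hD r hr]
    exact hasDerivAt_of_contDiffOn contDiffOn_deriv_D (hJS hr)
  have e1 (r : ℝ) : HasDerivAt (fun r => Real.exp (Ω * r)) (Real.exp (Ω * r) * Ω) r := by
    simpa using ((hasDerivAt_id r).const_mul Ω).exp
  have e2 (r : ℝ) : HasDerivAt (fun r => Real.exp (-(Ω * r))) (Real.exp (-(Ω * r)) * -Ω) r := by
    simpa using ((hasDerivAt_id r).const_mul Ω).neg.exp
  have hE (r : ℝ) : Real.exp (Ω * r) * Real.exp (-(Ω * r)) = 1 := by
    rw [← Real.exp_add]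
    simp
  obtain ⟨κ, hκ⟩ := hJ.exists_const_of_hasDerivAt_zero hc
    (f := fun r => S.H r + deriv S.D r / (2 * Ω)) fun r hr =>
      ((dH r hr).add ((dD' r hr).div_const (2 * Ω))).congr_deriv (by field_simp; ring)
  obtain ⟨q, hq⟩ := hJ.exists_const_of_hasDerivAt_zero hc
    (f := fun r => (2 * Ω * S.D r + deriv S.D r) / 2 * Real.exp (-(Ω * r)) ^ 2) fun r hr =>
      (((((dD r hr).const_mul (2 * Ω)).add (dD' r hr)).div_const 2).mul
        ((e2 r).pow 2)).congr_deriv (by norm_num; ring)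
  obtain ⟨p, hp⟩ := hJ.exists_const_of_hasDerivAt_zero hc
    (f := fun r => (2 * Ω * S.D r - deriv S.D r) / 2 * Real.exp (Ω * r) ^ 2) fun r hr =>
      (((((dD r hr).const_mul (2 * Ω)).sub (dD' r hr)).div_const 2).mul
        ((e1 r).pow 2)).congr_deriv (by norm_num; ring)
  obtain ⟨A, B, hA, hB, hAB⟩ := exists_generalized_trig (p * q)
  have hq' : ∀ r ∈ J, q * Real.exp (Ω * r) ^ 2 = (2 * Ω * S.D r + deriv S.D r) / 2 := by
    intro r hr
    rw [← hq r hr]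
    linear_combination (2 * Ω * S.D r + deriv S.D r) / 2
      * (Real.exp (Ω * r) * Real.exp (-(Ω * r)) + 1) * hE r
  have hp' : ∀ r ∈ J, p * Real.exp (-(Ω * r)) ^ 2 = (2 * Ω * S.D r - deriv S.D r) / 2 := by
    intro r hr
    rw [← hp r hr]
    linear_combination (2 * Ω * S.D r - deriv S.D r) / 2
      * (Real.exp (Ω * r) * Real.exp (-(Ω * r)) + 1) * hE r
  refine ⟨_, _, isDevelopment_dev (κ := κ) hJ hJS hΩ hA hB hAB (fun r hr => ?_) fun r hr => ?_⟩
  · rw [hq' r hr, hp' r hr]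
    ring
  · rw [hq' r hr, hp' r hr, ← hκ r hr]
    field_simp
    ring

theorem limiting_D (Ω : ℝ) (hΩ : Ω ≠ 0) :
    (limiting Ω hΩ).D = fun r => Real.sinh (2 * Ω * r) / (2 * Ω) := by
  funext r
  change Real.sinh (2 * |Ω| * r) / (2 * |Ω|) = _
  rcases abs_choice Ω with h | h <;> rw [h]
  rw [show 2 * -Ω * r = -(2 * Ω * r) by ring, Real.sinh_neg, mul_neg, neg_div_neg_eq]

theorem limiting_H (Ω : ℝ) (hΩ : Ω ≠ 0) :
    (limiting Ω hΩ).H = fun r => (1 - Real.cosh (2 * Ω * r)) / (2 * Ω) := by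
  funext r
  change 2 * Ω / (2 * |Ω|) ^ 2 * (1 - Real.cosh (2 * |Ω| * r)) = _
  have h1 : Real.cosh (2 * |Ω| * r) = Real.cosh (2 * Ω * r) := by
    rcases abs_choice Ω with h | h <;> rw [h]
    rw [show 2 * -Ω * r = -(2 * Ω * r) by ring, Real.cosh_neg]
  rw [h1, mul_pow, sq_abs]
  field_simp

/-- The standard development of the limiting spacetime. -/
theorem isDevelopment_limiting (Ω : ℝ) (hΩ : Ω ≠ 0) :
    (limiting Ω hΩ).IsDevelopment Ω (Ioi 0)
      (devP Ω (1 / (2 * Ω)) (-1 / 2) (1 / 2) (fun s => Real.cos (s / 2)) fun s => 2 * Real.sin (s / 2))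
      (devQ Ω (1 / (2 * Ω)) (-1 / 2) (1 / 2) (fun s => Real.cos (s / 2))
        fun s => 2 * Real.sin (s / 2)) := by
  have hE (r : ℝ) : Real.exp (2 * Ω * r) = Real.exp (Ω * r) ^ 2 := by
    rw [← Real.exp_nat_mul]
    congr 1
    push_cast
    ring
  have hE' (r : ℝ) : Real.exp (-(2 * Ω * r)) = Real.exp (-(Ω * r)) ^ 2 := by
    rw [← Real.exp_nat_mul]
    congr 1
    push_cast
    ring
  refine isDevelopment_dev isOpen_Ioi subset_rfl hΩ (fun s => ?_) (fun s => ?_) (fun s => ?_)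
    (fun r _ => ?_) fun r _ => ?_
  · refine ((Real.hasDerivAt_cos _).comp s ((hasDerivAt_id s).div_const 2)).congr_deriv ?_
    simp
    ring
  · refine (((Real.hasDerivAt_sin _).comp s ((hasDerivAt_id s).div_const 2)).const_mul
      2).congr_deriv ?_
    simp
    ring
  · linear_combination Real.sin_sq_add_cos_sq (s / 2)
  · simp only [limiting_D, Real.sinh_eq, hE, hE']
    field_simp
    ring
  · simp only [limiting_H, Real.cosh_eq, hE, hE']
    field_simp
    ring

/-- The cone map of the limiting spacetime in complex polar coordinates. -/
theorem coneMap_limiting (Ω : ℝ) (hΩ : Ω ≠ 0) (x : E4) :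
    let z := coneMap (devP Ω (1 / (2 * Ω)) (-1 / 2) (1 / 2) (fun s => Real.cos (s / 2))
      fun s => 2 * Real.sin (s / 2)) x
    z.1 - I * z.2 = (2 * Real.exp (x 3) * Real.cosh (Ω * x 1) : ℝ) * exp ((Ω * x 0 : ℝ) * I) ∧
    z.1 + I * z.2 =
      (2 * Real.exp (x 3) * Real.sinh (Ω * x 1) : ℝ) * exp ((Ω * x 0 + x 2 : ℝ) * I) := by
  have h1 : devPhase Ω (1 / (2 * Ω)) x = exp ((Ω * x 0 : ℝ) * I) * exp ((x 2 / 2 : ℝ) * I) := by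
    rw [devPhase, ← exp_add]
    congr 1
    push_cast
    have : (Ω : ℂ) ≠ 0 := by exact_mod_cast hΩ
    field_simp
  have h2 : exp ((Ω * x 0 + x 2 : ℝ) * I) =
      exp ((Ω * x 0 : ℝ) * I) * exp ((x 2 / 2 : ℝ) * I) * exp ((x 2 / 2 : ℝ) * I) := by
    rw [← exp_add, ← exp_add]
    congr 1
    push_cast
    ring
  have h3 : exp ((x 2 / 2 : ℝ) * I) = Real.cos (x 2 / 2) + Real.sin (x 2 / 2) * I := by
    rw [exp_mul_I]
    push_cast
    rfl
  have h4 : (Real.cos (x 2 / 2) : ℂ) ^ 2 + Real.sin (x 2 / 2) ^ 2 = 1 := by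
    exact_mod_cast Real.cos_sq_add_sin_sq (x 2 / 2)
  simp only [coneMap, devP, devCoeff, h1, h2, Matrix.cons_val_zero, Matrix.cons_val_one,
    Matrix.cons_val_fin_one, h3, Real.cosh_eq, Real.sinh_eq]
  set cs := Real.cos (x 2 / 2)
  set sn := Real.sin (x 2 / 2)
  set E := Real.exp (Ω * x 1)
  set E' := Real.exp (-(Ω * x 1))
  set F := Real.exp (x 3)
  set ph := exp ((Ω * x 0 : ℝ) * I)
  push_cast
  constructor
  · linear_combination F * ph * (E + E') * h4
      + F * ph * (-(cs * E' * (cs + sn * I)) - sn ^ 2 * (E + E')) * I_sq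
  · linear_combination (F * cs * I * sn * E' * ph + F * cs ^ 2 * E' * ph) * I_sq

end GodelType

end Limiting

namespace GodelType

theorem deriv_limiting_D (Ω : ℝ) (hΩ : Ω ≠ 0) :
    deriv (limiting Ω hΩ).D = fun r => Real.cosh (2 * Ω * r) := by
  funext r
  rw [limiting_D]
  refine (HasDerivAt.congr_deriv (((Real.hasDerivAt_sinh _).comp r
    ((hasDerivAt_id r).const_mul (2 * Ω))).div_const (2 * Ω)) ?_).deriv
  field_simp
  simp

theorem deriv_limiting_H (Ω : ℝ) (hΩ : Ω ≠ 0) :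
    deriv (limiting Ω hΩ).H = fun r => -Real.sinh (2 * Ω * r) := by
  funext r
  rw [limiting_H]
  refine (HasDerivAt.congr_deriv ((((Real.hasDerivAt_cosh _).comp r
    ((hasDerivAt_id r).const_mul (2 * Ω))).const_sub 1).div_const (2 * Ω)) ?_).deriv
  field_simp
  simp

theorem deriv_deriv_limiting_D (Ω : ℝ) (hΩ : Ω ≠ 0) :
    deriv (deriv (limiting Ω hΩ).D) = fun r => 2 * Ω * Real.sinh (2 * Ω * r) := by
  funext r
  rw [deriv_limiting_D]
  refine (HasDerivAt.congr_deriv ((Real.hasDerivAt_cosh _).comp r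
    ((hasDerivAt_id r).const_mul (2 * Ω))) ?_).deriv
  simp
  ring

theorem limiting_theta (Ω : ℝ) (hΩ : Ω ≠ 0) (r : ℝ) : (limiting Ω hΩ).theta r = -(Ω * r) := by
  rw [theta, deriv_limiting_D, deriv_limiting_H]
  simp only [sub_neg_eq_add, ← sub_eq_add_neg]
  rw [Real.cosh_sub_sinh, Real.cosh_add_sinh, ← Real.exp_sub, Real.log_exp]
  ring

theorem limiting_conditions (Ω : ℝ) (hΩ : Ω ≠ 0) {r : ℝ} (hr : 0 < r) :
    (limiting Ω hΩ).condNum r = 0 ∧ (limiting Ω hΩ).condDen r = 0 ∧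
      deriv (limiting Ω hΩ).H r ^ 2 < deriv (limiting Ω hΩ).D r ^ 2 := by
  have hs : ∀ r : ℝ, 0 < r → Real.sinh (2 * Ω * r) ≠ 0 := fun r hr h0 => by
    simp [hΩ, hr.ne'] at h0
  refine ⟨?_, ?_, ?_⟩
  · have : (fun s => deriv (limiting Ω hΩ).H s / (limiting Ω hΩ).D s) =ᶠ[𝓝 r] fun _ => -(2 * Ω) := by
      filter_upwards [Ioi_mem_nhds hr] with s hs'
      have := hs s hs'
      rw [deriv_limiting_H, limiting_D]
      field_simp
    rw [condNum, this.deriv_eq, deriv_const]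
  · have := hs r hr
    rw [condDen, deriv_deriv_limiting_D, deriv_limiting_H, limiting_D]
    field_simp
    ring
  · rw [deriv_limiting_H, deriv_limiting_D]
    have := Real.cosh_sq (2 * Ω * r)
    simp only
    linarith

theorem limiting_formC {Ω : ℝ} (hΩ : Ω ≠ 0) {ε κ : ℝ} (hε : ε = 1 ∧ κ = 0 ∨ ε = -1 ∧ κ = -1 / Ω)
    {α β : Fin 3 → ℝ} {X : E3 → E4} (hpos : ∀ r ∈ Ioo (α 0) (β 0), 0 < r)
    (hX : ∀ u ∈ openBox α β, X u = !₂[κ * u 2, u 0, u 2, u 1])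
    (hspace : ε = 1 → (limiting Ω hΩ).IsSpacelikeOn X (openBox α β))
    (htime : ε = -1 → (limiting Ω hΩ).IsTimelikeOn X (openBox α β)) :
    (limiting Ω hΩ).FormC α β X := by
  have hD (r : ℝ) : (limiting Ω hΩ).D r = Real.sinh (Ω * r) * Real.cosh (Ω * r) / Ω := by
    simp only [limiting_D, mul_assoc, Real.sinh_two_mul]
    field_simp
  have hH (r : ℝ) : (limiting Ω hΩ).H r = -(Real.sinh (Ω * r) ^ 2 / Ω) := by
    simp only [limiting_H, mul_assoc, Real.cosh_two_mul]
    field_simp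
    linear_combination -Real.cosh_sq (Ω * r)
  refine ⟨fun r hr => ⟨hpos r hr, ?_, (limiting_conditions Ω hΩ (hpos r hr)).2.2⟩, ?_⟩
  · exact Or.inr ⟨(limiting_conditions Ω hΩ (hpos r hr)).1, (limiting_conditions Ω hΩ (hpos r hr)).2.1⟩
  · have hθ : ∀ r ∈ Ioo (α 0) (β 0), Ω * r ≠ 0 := fun r hr => mul_ne_zero hΩ (hpos r hr).ne'
    rcases hε with ⟨h1, rfl⟩ | ⟨h1, rfl⟩
    · refine Or.inl ⟨fun u hu => ?_, hspace h1⟩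
      have hc := (Real.cosh_pos (Ω * u 0)).ne'
      rw [hX u hu, limiting_theta, hD, hH, Real.tanh_neg, Real.tanh_eq_sinh_div_cosh]
      congr 2
      field_simp
      ring_nf
    · refine Or.inr ⟨fun r hr => ?_, fun u hu => ?_, htime h1⟩
      · rw [limiting_theta]
        exact neg_ne_zero.2 (hθ r hr)
      · have hs : Real.sinh (Ω * u 0) ≠ 0 := fun h0 => hθ _ (hu 0) (Real.sinh_eq_zero.1 h0)
        have hc := Real.cosh_sq (Ω * u 0)
        rw [hX u hu, limiting_theta, hD, hH, Real.cosh_neg, Real.sinh_neg]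
        congr 3
        field_simp
        linear_combination hc

end GodelType

section Hyperplane

open Complex
open scoped ComplexConjugate

/-- A hyperplane with normal `N` is moved to a standard hyperplane. -/
theorem exists_isometry_normal {N : ℂ × ℂ} {ε : ℝ} (hε : ε = 1 ∨ ε = -1) (hN : sform N N = ε) :
    ∃ e : (ℂ × ℂ) ≃L[ℝ] (ℂ × ℂ), (∀ z w, sform (e z) (e w) = sform z w) ∧
      ∀ z, sform z N = 0 → (e z).1.im = ε * (e z).2.re := by
  have hεε : ε * ε = 1 := by rcases hε with rfl | rfl <;> norm_num
  have hN' : N.1.re * N.2.im - N.1.im * N.2.re = ε := by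
    simp [sform] at hN
    linear_combination hN
  have hdet : (-N.2.re) * (ε * N.1.im) - N.1.re * (-ε * N.2.im) = 1 := by
    linear_combination ε * hN' + hεε
  refine ⟨realAct hdet, sform_realAct hdet, fun z hz => ?_⟩
  simp [sform] at hz
  rw [realAct_apply]
  simp
  linear_combination hz + (N.2.im * z.1.re - N.1.im * z.2.re) * hεε

theorem exists_isometry_sign {e : (ℂ × ℂ) ≃L[ℝ] (ℂ × ℂ)}
    (he : ∀ z w, sform (e z) (e w) = sform z w) (L : (ℂ × ℂ) →ₗ[ℝ] ℝ) (z₀ : ℂ × ℂ) :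
    ∃ e' : (ℂ × ℂ) ≃L[ℝ] (ℂ × ℂ), (∀ z w, sform (e' z) (e' w) = sform z w) ∧ 0 ≤ L (e' z₀) ∧
      ((∀ z, e' z = e z) ∨ ∀ z, e' z = -e z) := by
  rcases le_total 0 (L (e z₀)) with h0 | h0
  · exact ⟨e, he, h0, Or.inl fun _ => rfl⟩
  · refine ⟨e.trans (ContinuousLinearEquiv.neg ℝ), fun z w => ?_, by simpa using h0,
      Or.inr fun _ => rfl⟩
    rw [← he z w]
    simp [sform]

theorem sform_self (w : ℂ × ℂ) :
    normSq (w.1 - I * w.2) - normSq (w.1 + I * w.2) = 4 * sform w w := by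
  simp [sform, normSq_apply]
  ring

/-- Surjectivity of the cone map of the limiting spacetime away from the axis. -/
theorem exists_coneMap_limiting_eq {Ω : ℝ} (hΩ : Ω ≠ 0) {ε ζ : ℝ}
    {w : ℂ × ℂ} (hw : sform w w = Real.exp ζ ^ 2) (hB : w.1 + I * w.2 ≠ 0)
    (h1 : ε = 1 → (w.1 - I * w.2).im = 0 ∧ 0 ≤ (w.1 - I * w.2).re)
    (h2 : ε = -1 → (w.1 + I * w.2).im = 0 ∧ 0 ≤ Ω * (w.1 + I * w.2).re) :
    ∃ q : E4, 0 < q 1 ∧ coneMap (devP Ω (1 / (2 * Ω)) (-1 / 2) (1 / 2)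
      (fun s => Real.cos (s / 2)) fun s => 2 * Real.sin (s / 2)) q = w ∧
      (ε = 1 → Ω * q 0 = 0) ∧ (ε = -1 → Ω * q 0 + q 2 = 0) := by
  have hself := sform_self w
  rw [hw] at hself
  set A := w.1 - I * w.2 with hAd
  set B := w.1 + I * w.2 with hBd
  have hE := Real.exp_pos ζ
  set E := Real.exp ζ with hEd
  have hBpos : 0 < ‖B‖ := norm_pos_iff.2 hB
  rw [normSq_eq_norm_sq, normSq_eq_norm_sq] at hself
  obtain ⟨σ, hσ, hσΩ⟩ : ∃ σ : ℝ, (σ = 1 ∨ σ = -1) ∧ 0 < σ * Ω := by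
    rcases hΩ.lt_or_gt with h | h
    · exact ⟨-1, Or.inr rfl, by linarith⟩
    · exact ⟨1, Or.inl rfl, by linarith⟩
  have hσσ : σ * σ = 1 := by rcases hσ with rfl | rfl <;> norm_num
  set ρ := Real.arsinh (‖B‖ / (2 * E)) with hρ
  have hρ0 : 0 < ρ := Real.arsinh_pos_iff.2 (by positivity)
  have hr : Ω * (ρ / (σ * Ω)) = σ * ρ := by
    have : σ ≠ 0 := fun h0 => by simp [h0] at hσσ
    field_simp
    linear_combination -hσσ
  have hsinh : 2 * E * Real.sinh (σ * ρ) = σ * ‖B‖ := by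
    have : 2 * E * Real.sinh ρ = ‖B‖ := by
      rw [hρ, Real.sinh_arsinh]
      field_simp
    rcases hσ with rfl | rfl
    · simpa using this
    · simp only [neg_mul, one_mul, Real.sinh_neg]
      linarith
  have hcosh : 2 * E * Real.cosh (σ * ρ) = ‖A‖ := by
    have h3 := Real.cosh_sq (σ * ρ)
    have h4 : (2 * E * Real.cosh (σ * ρ)) ^ 2 = ‖A‖ ^ 2 := by
      linear_combination 4 * E ^ 2 * h3 - hself + (2 * E * Real.sinh (σ * ρ) + σ * ‖B‖) * hsinh
        + ‖B‖ ^ 2 * hσσ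
    have := Real.cosh_pos (σ * ρ)
    rwa [sq_eq_sq₀ (by positivity) (norm_nonneg _)] at h4
  have hσB : (‖B‖ : ℂ) * exp ((arg (σ * B) : ℝ) * I) = σ * B := by
    have := norm_mul_exp_arg_mul_I (σ * B)
    have hσ1 : ‖(σ : ℂ)‖ = 1 := by
      rcases hσ with rfl | rfl <;> simp
    rwa [norm_mul, hσ1, one_mul] at this
  set q : E4 := !₂[arg A / Ω, ρ / (σ * Ω), arg (σ * B) - arg A, ζ] with hq
  have q0 : q 0 = arg A / Ω := rfl
  have q1 : q 1 = ρ / (σ * Ω) := rfl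
  have q2 : q 2 = arg (σ * B) - arg A := rfl
  have q3 : q 3 = ζ := rfl
  have hΩ0 : Ω * q 0 = arg A := by
    rw [q0]
    field_simp
  obtain ⟨hA', hB'⟩ := GodelType.coneMap_limiting Ω hΩ q
  refine ⟨q, div_pos hρ0 hσΩ, ?_, fun h => ?_, fun h => ?_⟩
  · rw [q3, q1, hr, ← hEd, hΩ0] at hA' hB'
    rw [hcosh, norm_mul_exp_arg_mul_I] at hA'
    rw [hsinh, q2, add_sub_cancel] at hB'
    have hσσ' : (σ : ℂ) * σ = 1 := by exact_mod_cast hσσ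
    have hB'' : (σ * ‖B‖ : ℝ) * exp ((arg (σ * B) : ℝ) * I) = B := by
      push_cast
      linear_combination σ * hσB + B * hσσ'
    rw [hB''] at hB'
    set z := coneMap (devP Ω (1 / (2 * Ω)) (-1 / 2) (1 / 2) (fun s => Real.cos (s / 2))
      fun s => 2 * Real.sin (s / 2)) q
    ext1
    · linear_combination (1 / 2) * (hA' + hB') + (1 / 2) * (hAd + hBd)
    · linear_combination (I / 2) * (hA' - hB') + (I / 2) * (hAd - hBd) + (z.2 - w.2) * I_sq
  · rw [hΩ0]
    exact arg_eq_zero_iff.2 ⟨(h1 h).2, (h1 h).1⟩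
  · rw [hΩ0, q2, add_sub_cancel]
    have : σ * B = ((σ * B.re : ℝ) : ℂ) := by
      apply Complex.ext
      · simp
      · simp [(h2 h).1]
    rw [this, arg_ofReal_of_nonneg]
    have h3 : 0 ≤ (σ * Ω) * (σ * B.re) := by
      have := (h2 h).2
      nlinarith
    exact nonneg_of_mul_nonneg_right h3 hσΩ

end Hyperplane

namespace GodelType

variable {S : GodelType} {X : E3 → E4} {O : Set E3} {ε : ℝ} {a b c d : E3 → ℝ}

/-- A curvature condition that holds when the normal is neither horizontal nor vertical. -/
theorem IsAdapted.exists_constant_curvature (h : S.IsAdapted X ε a b c d O) (hne : O.Nonempty)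
    (hflat : ∀ u ∈ O, ¬ S.IsFlatNear (X u 1))
    (habd : ∀ u ∈ O, a u ≠ 0 ∧ b u ≠ 0 ∧ d u = 0) :
    ∃ Ω : ℝ, Ω ≠ 0 ∧ ∃ B ⊆ O, IsOpen B ∧ B.Nonempty ∧ Convex ℝ B ∧
      (∀ u ∈ B, S.twist (X u 1) = Ω) ∧ ∃ J : Set ℝ, IsOpen J ∧ IsPreconnected J ∧ J ⊆ S.interval ∧
      (∀ u ∈ B, X u 1 ∈ J) ∧ (∀ r ∈ J, deriv S.H r = -2 * Ω * S.D r) ∧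
      ∀ r ∈ J, deriv (deriv S.D) r = 4 * Ω ^ 2 * S.D r := by
  have hrad : ∀ u ∈ O, ∃ v, S.cofX X u v 1 ≠ 0 := by
    intro u hu
    obtain ⟨ha, hb, hd⟩ := habd u hu
    obtain ⟨v, hv⟩ := h.surj u hu ![b u, a u, 0, 0] (by simp; ring)
    exact ⟨v, by rw [hv]; simpa using ha⟩
  have hcurv : ∀ u ∈ O, S.f2 (X u 1) = 0 ∧ S.f1 (X u 1) + S.f3 (X u 1) = 0 := by
    intro u hu
    obtain ⟨ha, hb, hd⟩ := habd u hu
    obtain ⟨v, hv⟩ := h.surj u hu ![b u, a u, 0, 0] (by simp; ring)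
    obtain ⟨w, hw⟩ := h.surj u hu ![0, -c u, b u, 0] (by simp; ring)
    obtain ⟨h1, h2, h3⟩ := h.codazzi hu v w
    simp only [wedgeX, hv, hw] at h1 h2 h3
    simp at h1 h2 h3
    have e1 : S.f2 (X u 1) = 0 := by
      have : S.f2 (X u 1) * (a u * b u ^ 2) = 0 := by linear_combination h1
      simpa [ha, hb] using this
    rw [e1] at h3
    refine ⟨e1, ?_⟩
    have : (S.f1 (X u 1) + S.f3 (X u 1)) * (a u * b u ^ 2) = 0 := by linear_combination h3
    simpa [ha, hb] using this
  obtain ⟨u₀, hu₀⟩ := hne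
  obtain ⟨u₁, hu₁, hnf⟩ := h.exists_not_flat hu₀ (hflat u₀ hu₀) (hrad u₀ hu₀)
  have htw₁ : S.twist (X u₁ 1) ≠ 0 := by
    intro h0
    obtain ⟨e1, e2⟩ := hcurv u₁ hu₁
    have e3 := S.twist_sq (X u₁ 1)
    rw [h0] at e3
    exact hnf ⟨by linarith, e1, by linarith⟩
  have hsm := h.smooth_comp contDiffOn_twist
  obtain ⟨B, hB, hBo, ⟨x₀, hx₀⟩, hBc⟩ := exists_ball_subset
    (hsm.continuousOn.isOpen_inter_preimage h.isOpen (isOpen_compl_singleton (x := (0 : ℝ))))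
    ⟨u₁, hu₁, htw₁⟩
  have hBO : B ⊆ O := fun u hu => (hB hu).1
  have hA := h.mono hBo hBO
  obtain ⟨Ω, hΩ⟩ := exists_const_of_hasLineDerivAt hBo hBc (hsm.mono hBO) fun u hu v =>
    (hA.hasLineDerivAt_comp_radius hu (hasDerivAt_twist (h.mem u (hBO hu))) v).congr_deriv (by
      rw [(hcurv u (hBO hu)).1, zero_mul])
  refine ⟨Ω, hΩ x₀ hx₀ ▸ (hB hx₀).2, B, hBO, hBo, ⟨x₀, hx₀⟩, hBc, hΩ, (fun u => X u 1) '' B, ?_,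
    hBc.isPreconnected.image _ (hA.smooth_apply 1).continuousOn, ?_,
    fun u hu => mem_image_of_mem _ hu, ?_, ?_⟩
  · rw [isOpen_iff_mem_nhds]
    rintro _ ⟨u, hu, rfl⟩
    have hst := ((hA.smooth_apply 1).contDiffAt (hBo.mem_nhds hu)).hasStrictFDerivAt (by simp)
    rw [← hst.map_nhds_eq_of_surj]
    · exact image_mem_map (hBo.mem_nhds hu)
    · rw [LinearMap.range_eq_top]
      refine LinearMap.surjective_of_ne_zero fun h0 => ?_
      obtain ⟨v, hv⟩ := hrad u (hBO hu)
      apply hv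
      have h1 := fderiv_euclidean_apply (hA.differentiableAt hu) v 1
      rw [show S.cofX X u v 1 = fderiv ℝ X u v 1 from rfl, ← h1]
      exact DFunLike.congr_fun h0 v
  · rintro _ ⟨u, hu, rfl⟩
    exact hA.mem u hu
  · rintro _ ⟨u, hu, rfl⟩
    simp only
    rw [deriv_H_eq (hA.mem u hu), hΩ u hu]
  · rintro _ ⟨u, hu, rfl⟩
    have hD := S.D_ne_zero _ (hA.mem u hu)
    have e2 := (hcurv u (hBO hu)).2
    have e3 := S.twist_sq (X u 1)
    rw [hΩ u hu] at e3
    rw [f3, ← e3] at e2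
    simp only
    field_simp at e2
    linear_combination -e2

section Normal

open Complex

variable {J : Set ℝ} {Ω : ℝ} {P Q : Fin 2 → E4 → ℂ}

/-- The image of the unit normal under the development is parallel. -/
theorem IsAdapted.exists_normal_eq (h : S.IsAdapted X ε a b c d O) (hconv : Convex ℝ O)
    (hd : ∀ u ∈ O, d u = 0) (htw : ∀ u ∈ O, S.twist (X u 1) = Ω) (hJ : ∀ u ∈ O, X u 1 ∈ J)
    (hdev : S.IsDevelopment Ω J P Q) (k : Fin 2) :
    ∃ N, ∀ u ∈ O, I * a u * P k (X u) + (b u + I * c u) * Q k (X u) = N := by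
  have hof {f : E3 → ℝ} (hf : ContDiffOn ℝ ∞ f O) : ContDiffOn ℝ ∞ (fun u => (f u : ℂ)) O :=
    ofRealCLM.contDiff.comp_contDiffOn hf
  have hsm : ContDiffOn ℝ ∞
      (fun u => I * a u * P k (X u) + (b u + I * c u) * Q k (X u)) O :=
    ((contDiffOn_const.mul (hof h.smooth_a)).mul ((hdev.smooth_P k).comp_contDiffOn h.smooth)).add
      (((hof h.smooth_b).add (contDiffOn_const.mul (hof h.smooth_c))).mul
        ((hdev.smooth_Q k).comp_contDiffOn h.smooth))
  refine h.isOpen.exists_is_const_of_fderiv_eq_zero hconv.isPreconnected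
    (hsm.differentiableOn (by simp)) fun u hu => ?_
  ext v
  have hO := h.isOpen
  have da : HasDerivAt (fun t : ℝ => a (u + t • v)) _ 0 :=
    (ContDiffOn.hasLineDerivAt hO h.smooth_a hu v).congr_deriv (h.fderiv_a u hu v)
  have db : HasDerivAt (fun t : ℝ => b (u + t • v)) _ 0 :=
    (ContDiffOn.hasLineDerivAt hO h.smooth_b hu v).congr_deriv (h.fderiv_b u hu v)
  have dc : HasDerivAt (fun t : ℝ => c (u + t • v)) _ 0 :=
    (ContDiffOn.hasLineDerivAt hO h.smooth_c hu v).congr_deriv (h.fderiv_c u hu v)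
  have dX := (h.differentiableAt hu).hasFDerivAt
  have dP : HasDerivAt (fun t : ℝ => P k (X (u + t • v))) _ 0 :=
    ((((hdev.smooth_P k).differentiable (by simp)) (X u)).hasFDerivAt.comp u dX).hasLineDerivAt v
  have dQ : HasDerivAt (fun t : ℝ => Q k (X (u + t • v))) _ 0 :=
    ((((hdev.smooth_Q k).differentiable (by simp)) (X u)).hasFDerivAt.comp u dX).hasLineDerivAt v
  have hsum := ((da.ofReal_comp.const_mul I).mul dP).add
    ((db.ofReal_comp.add (dc.ofReal_comp.const_mul I)).mul dQ)
  have htot : HasDerivAt (fun t : ℝ => I * a (u + t • v) * P k (X (u + t • v))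
      + (b (u + t • v) + I * c (u + t • v)) * Q k (X (u + t • v))) _ 0 :=
    ((hsm.contDiffAt (hO.mem_nhds hu)).differentiableAt (by simp)).hasFDerivAt.hasLineDerivAt v
  rw [htot.unique hsum]
  have ht : (a u : ℂ) * S.cofX X u v 0 = b u * S.cofX X u v 1 + c u * S.cofX X u v 2 := by
    have := h.tangent u hu v
    rw [hd u hu, zero_mul, add_zero] at this
    exact_mod_cast this
  simp only [ContinuousLinearMap.comp_apply, hdev.fderiv_P k _ _ (hJ u hu),
    hdev.fderiv_Q k _ _ (hJ u hu), htw u hu, zero_smul, add_zero, Pi.add_apply]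
  change (_ : ℂ) = 0
  rw [show S.cof (X u) (fderiv ℝ X u v) = S.cofX X u v from rfl]
  push_cast
  linear_combination (I ^ 2 * Ω * P k (X u)) * ht
    + (Ω * S.cofX X u v 0 * c u * Q k (X u) + S.logDeriv (X u 1) * S.cofX X u v 2 * c u * Q k (X u)
      + Ω * b u * S.cofX X u v 1 * P k (X u) + Ω * a u * S.cofX X u v 2 * Q k (X u)) * I_sq

/-- The normal is a unit vector orthogonal to the position. -/
theorem IsAdapted.sform_normal (h : S.IsAdapted X ε a b c d O) (hd : ∀ u ∈ O, d u = 0)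
    (hdev : S.IsDevelopment Ω J P Q) {u : E3} (hu : u ∈ O) {N : ℂ × ℂ}
    (hN : N = (I * a u * P 0 (X u) + (b u + I * c u) * Q 0 (X u),
      I * a u * P 1 (X u) + (b u + I * c u) * Q 1 (X u))) :
    sform N N = ε ∧ sform (coneMap P (X u)) N = 0 := by
  have hf := sform_frame (hdev.im_P (X u)) (hdev.im_Q (X u)) (hdev.conj_mul (X u))
  have hun := h.unit u hu
  rw [hd u hu] at hun
  rw [hN]
  constructor
  · rw [hf]
    simp
    linear_combination hun
  · have := hf (Real.exp (X u 3)) 0 (I * a u) (b u + I * c u)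
    simp only [zero_mul, add_zero] at this
    rw [coneMap, this]
    simp [-ofReal_exp]

/-- The developed hypersurface is not contained in the axis. -/
theorem IsAdapted.exists_add_mul_ne_zero (h : S.IsAdapted X ε a b c d O) (hne : O.Nonempty)
    (hJ : ∀ u ∈ O, X u 1 ∈ J) (hJS : J ⊆ S.interval) (hΩ : Ω ≠ 0)
    (hdev : S.IsDevelopment Ω J P Q) (e : (ℂ × ℂ) ≃L[ℝ] (ℂ × ℂ)) :
    ∃ u ∈ O, (e (coneMap P (X u))).1 + I * (e (coneMap P (X u))).2 ≠ 0 := by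
  by_contra! hcon
  obtain ⟨u, hu⟩ := hne
  have d1 := e.toContinuousLinearMap.hasFDerivAt.comp u
    (((hdev.contDiff_coneMap.differentiable (by simp)) (X u)).hasFDerivAt.comp u
      (h.differentiableAt hu).hasFDerivAt)
  set A := e.toContinuousLinearMap.comp ((fderiv ℝ (coneMap P) (X u)).comp (fderiv ℝ X u))
  have hA : ∀ v, A v = 0 → v = 0 := by
    intro v hv
    have h1 : fderiv ℝ (coneMap P) (X u) (fderiv ℝ X u v) = 0 := by
      simpa [A] using hv
    have h2 := hdev.fderiv_coneMap_injective hΩ hJS (hJ u hu) h1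
    refine h.inj u hu v ?_
    ext i
    rw [cofX, h2]
    fin_cases i <;> simp [cof]
  have hlin : ∀ v, (A v).1 + I * (A v).2 = 0 := by
    intro v
    have d3 := ((ContinuousLinearMap.fst ℝ ℂ ℂ + (I : ℂ) • (ContinuousLinearMap.snd ℝ ℂ ℂ :
      ℂ × ℂ →L[ℝ] ℂ)).hasFDerivAt.comp u d1)
    have d4 : HasFDerivAt (fun _ : E3 => (0 : ℂ)) (0 : E3 →L[ℝ] ℂ) u := hasFDerivAt_const _ _
    have d5 := d3.unique (d4.congr_of_eventuallyEq (by
      filter_upwards [h.isOpen.mem_nhds hu] with x hx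
      simpa using hcon x hx))
    simpa using DFunLike.congr_fun d5 v
  have hinj : Function.Injective ((ContinuousLinearMap.snd ℝ ℂ ℂ).comp A).toLinearMap := by
    refine (injective_iff_map_eq_zero _).2 fun v hv => hA v ?_
    have h2 : (A v).2 = 0 := hv
    have h1 := hlin v
    rw [h2, mul_zero, add_zero] at h1
    exact Prod.ext h1 h2
  have := LinearMap.finrank_le_finrank_of_injective hinj
  simp at this

end Normal

end GodelType

namespace GodelType

variable {S : GodelType} {X : E3 → E4} {O : Set E3} {ε : ℝ} {a b c d : E3 → ℝ}

section Normal

open Complex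

/-- On the preimage of a standard hyperplane of the cone, a combination of the first two angular
coordinates is an angle with vanishing sine. -/
theorem sin_eq_zero_of_coneMap {Ω : ℝ} (hΩ : Ω ≠ 0) {x : E4} (hx : 0 < x 1) {w : ℂ × ℂ}
    (hw : coneMap (devP Ω (1 / (2 * Ω)) (-1 / 2) (1 / 2)
      (fun s => Real.cos (s / 2)) fun s => 2 * Real.sin (s / 2)) x = w) :
    ((w.1 - I * w.2).im = 0 → Real.sin (Ω * x 0) = 0) ∧
    ((w.1 + I * w.2).im = 0 → Real.sin (Ω * x 0 + x 2) = 0) := by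
  obtain ⟨hA, hB⟩ := coneMap_limiting Ω hΩ x
  rw [hw] at hA hB
  have hE := Real.exp_pos (x 3)
  have him (k t : ℝ) : ((k : ℂ) * exp ((t : ℂ) * I)).im = k * Real.sin t := by
    rw [im_ofReal_mul, exp_ofReal_mul_I_im]
  constructor
  · intro h0
    rw [hA, him] at h0
    have := Real.cosh_pos (Ω * x 1)
    exact (mul_eq_zero.1 h0).resolve_left (by positivity)
  · intro h0
    rw [hB, him] at h0
    refine (mul_eq_zero.1 h0).resolve_left (mul_ne_zero (by positivity) ?_)
    simp [hΩ, hx.ne']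

theorem IsAdapted.hasListedChart_of_development (h : S.IsAdapted X ε a b c d O)
    (hd : ∀ u ∈ O, d u = 0) (hne : O.Nonempty) (hconv : Convex ℝ O) {Ω : ℝ} (hΩ : Ω ≠ 0)
    (htw : ∀ u ∈ O, S.twist (X u 1) = Ω) {J : Set ℝ} (hJ : IsOpen J) (hJc : IsPreconnected J)
    (hJS : J ⊆ S.interval) (hXJ : ∀ u ∈ O, X u 1 ∈ J)
    (hH : ∀ r ∈ J, deriv S.H r = -2 * Ω * S.D r)
    (hD : ∀ r ∈ J, deriv (deriv S.D) r = 4 * Ω ^ 2 * S.D r) : S.HasListedChart X O := by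
  obtain ⟨P, Q, hdev⟩ := exists_isDevelopment hΩ hJ hJc hJS hH hD
  have hlim := isDevelopment_limiting Ω hΩ
  set P' := devP Ω (1 / (2 * Ω)) (-1 / 2) (1 / 2) (fun s => Real.cos (s / 2))
    fun s => 2 * Real.sin (s / 2)
  obtain ⟨N₀, hN₀⟩ := h.exists_normal_eq hconv hd htw hXJ hdev 0
  obtain ⟨N₁, hN₁⟩ := h.exists_normal_eq hconv hd htw hXJ hdev 1
  have hN : ∀ u ∈ O, sform (N₀, N₁) (N₀, N₁) = ε ∧ sform (coneMap P (X u)) (N₀, N₁) = 0 :=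
    fun u hu => h.sform_normal hd hdev hu (by rw [hN₀ u hu, hN₁ u hu])
  have hNN := (hN _ hne.some_mem).1
  obtain ⟨e₀, he₀, he₀'⟩ := exists_isometry_normal h.sign hNN
  obtain ⟨u₀, hu₀, hBu₀⟩ := h.exists_add_mul_ne_zero hne hXJ hJS hΩ hdev e₀
  obtain ⟨η, τ, hcase⟩ : ∃ η τ : ℝ, (ε = 1 ∧ η = 0 ∧ τ = 1) ∨ (ε = -1 ∧ η = 1 ∧ τ = Ω) := by
    rcases h.sign with h1 | h1
    · exact ⟨0, 1, Or.inl ⟨h1, rfl, rfl⟩⟩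
    · exact ⟨1, Ω, Or.inr ⟨h1, rfl, rfl⟩⟩
  obtain ⟨e, he, hpos, hsign⟩ := exists_isometry_sign he₀
    (τ • (reLm ∘ₗ LinearMap.fst ℝ ℂ ℂ + ε • (imLm ∘ₗ LinearMap.snd ℝ ℂ ℂ))) (coneMap P (X u₀))
  have himZ : ∀ u ∈ O, (e (coneMap P (X u))).1.im = ε * (e (coneMap P (X u))).2.re := by
    intro u hu
    have := he₀' _ (hN u hu).2
    rcases hsign with hs | hs <;> rw [hs]
    · exact this
    · simp [this]
  have hB₀ : (e (coneMap P (X u₀))).1 + I * (e (coneMap P (X u₀))).2 ≠ 0 := by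
    rcases hsign with hs | hs <;> rw [hs]
    · exact hBu₀
    · intro h0
      apply hBu₀
      simp only [Prod.fst_neg, Prod.snd_neg] at h0
      linear_combination -h0
  simp only [LinearMap.smul_apply, LinearMap.add_apply, LinearMap.comp_apply, LinearMap.fst_apply,
    LinearMap.snd_apply, smul_eq_mul, reLm_coe, imLm_coe] at hpos
  obtain ⟨q₀, hq₀, hq₀', hang1, hang2⟩ := exists_coneMap_limiting_eq hΩ (ε := ε)
    (w := e (coneMap P (X u₀))) (by rw [he, hdev.sform_coneMap]) hB₀
    (fun h1 => by
      have := himZ u₀ hu₀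
      rcases hcase with ⟨h2, -, h3⟩ | ⟨h2, -, h3⟩
      · rw [h2] at this hpos
        rw [h3] at hpos
        simp [this]
        linarith
      · linarith)
    (fun h1 => by
      have := himZ u₀ hu₀
      rcases hcase with ⟨h2, -, h3⟩ | ⟨h2, -, h3⟩
      · linarith
      · rw [h2] at this hpos
        rw [h3] at hpos
        simp [this]
        linarith)
  have hang₀ : Ω * q₀ 0 + η * q₀ 2 = 0 := by
    rcases hcase with ⟨h1, rfl, -⟩ | ⟨h1, rfl, -⟩
    · simpa using hang1 h1
    · simpa using hang2 h1
  obtain ⟨Ψ, hΨ, hsrc, hΨ₀, hcone⟩ := hdev.exists_isLocalIsometry hlim hΩ hJ isOpen_Ioi hJS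
    subset_rfl e he (hXJ u₀ hu₀) hq₀ hq₀'
  have hO₁ : IsOpen (O ∩ X ⁻¹' Ψ.source) :=
    h.smooth.continuousOn.isOpen_inter_preimage h.isOpen Ψ.open_source
  have hΨX : ContDiffOn ℝ ∞ (fun u => Ψ (X u)) (O ∩ X ⁻¹' Ψ.source) :=
    hΨ.smooth.comp (h.smooth.mono inter_subset_left) fun u hu => hu.2
  have hΨXi (i : Fin 4) : ContDiffOn ℝ ∞ (fun u => Ψ (X u) i) (O ∩ X ⁻¹' Ψ.source) :=
    contDiffOn_euclidean.1 hΨX i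
  set V : Set E3 := (O ∩ X ⁻¹' Ψ.source) ∩
    (fun u => Ω * Ψ (X u) 0 + η * Ψ (X u) 2) ⁻¹' Ioo (-Real.pi) Real.pi with hV
  have hVo : IsOpen V := ((contDiffOn_const.mul (hΨXi 0)).add
    (contDiffOn_const.mul (hΨXi 2))).continuousOn.isOpen_inter_preimage hO₁ isOpen_Ioo
  have hVO : V ⊆ O := fun u hu => hu.1.1
  have hVs : ∀ u ∈ V, X u ∈ Ψ.source := fun u hu => hu.1.2
  have hu₀V : u₀ ∈ V := by
    refine ⟨⟨hu₀, hsrc⟩, ?_⟩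
    change _ < Ω * Ψ (X u₀) 0 + η * Ψ (X u₀) 2 ∧ Ω * Ψ (X u₀) 0 + η * Ψ (X u₀) 2 < _
    rw [hΨ₀, hang₀]
    exact ⟨by linarith [Real.pi_pos], Real.pi_pos⟩
  have hang : ∀ u ∈ V, Ψ (X u) 0 = -η / Ω * Ψ (X u) 2 := by
    intro u hu
    obtain ⟨-, h2, h3⟩ := hcone _ (hVs u hu)
    have hsin := sin_eq_zero_of_coneMap hΩ h2 h3
    have him := himZ u (hVO hu)
    have h0 : Real.sin (Ω * Ψ (X u) 0 + η * Ψ (X u) 2) = 0 := by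
      rcases hcase with ⟨h1, rfl, -⟩ | ⟨h1, rfl, -⟩ <;> rw [h1] at him
      · simpa using hsin.1 (by simp [him])
      · simpa using hsin.2 (by simp [him])
    have h4 := (Real.sin_eq_zero_iff_of_lt_of_lt hu.2.1 hu.2.2).1 h0
    field_simp
    linear_combination h4
  have hA := h.mono hVo hVO
  have hsub : V ⊆ O ∩ X ⁻¹' Ψ.source := fun u hu => hu.1
  obtain ⟨χ, α, β, h1, h2, h3, h4, h5, h6, h7, -, h8, h9⟩ := hA.exists_chart hΨ hVs
    (G := fun u => !₂[Ψ (X u) 1, Ψ (X u) 3, Ψ (X u) 2])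
    (contDiffOn_vec3 ((hΨXi 1).mono hsub) ((hΨXi 3).mono hsub) ((hΨXi 2).mono hsub)) (by
      intro u hu v hv
      have hdΨ : DifferentiableAt ℝ Ψ (X u) :=
        (hΨ.smooth.contDiffAt (Ψ.open_source.mem_nhds (hVs u hu))).differentiableAt (by simp)
      have hd1 : DifferentiableAt ℝ (fun u => Ψ (X u)) u :=
        (hΨX.contDiffAt (hO₁.mem_nhds (hsub hu))).differentiableAt (by simp)
      have hl := HasFDerivAt.hasLineDerivAt_apply hd1 v
      have e1 : fderiv ℝ (fun u => Ψ (X u)) u v 1 = 0 := (hl 1).unique (hv 0)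
      have e3 : fderiv ℝ (fun u => Ψ (X u)) u v 3 = 0 := (hl 3).unique (hv 1)
      have e2 : fderiv ℝ (fun u => Ψ (X u)) u v 2 = 0 := (hl 2).unique (hv 2)
      have e0 : fderiv ℝ (fun u => Ψ (X u)) u v 0 = 0 := by
        have := (hl 0).unique (((hasLineDerivAt_const (-η / Ω)).mul (hl 2)).congr_on hVo hu hang)
        rw [this, e2]
        ring
      have e : fderiv ℝ Ψ (X u) (fderiv ℝ X u v) = 0 := by
        have := (hdΨ.hasFDerivAt.comp u (hA.differentiableAt hu).hasFDerivAt).fderiv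
        rw [← ContinuousLinearMap.comp_apply, ← this]
        ext i
        fin_cases i
        · exact e0
        · exact e1
        · exact e2
        · exact e3
      refine hA.isNondegenerateAt hu v fun w => ?_
      rw [inducedMetric, ← hΨ.isometry _ (hVs u hu), e]
      simp [metric]) hu₀V
  refine ⟨χ, ⟨u₀, h1⟩, h2.trans hVO, h3, h4, α, β, h5, Or.inr ⟨Ω, hΩ, Ψ, hΨ,
    fun q hq => hVs q (h2 hq), fun x hx => ?_, Or.inr (Or.inr (Or.inl ?_))⟩⟩
  · exact ⟨hH _ (hcone x hx).1, hD _ (hcone x hx).1⟩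
  · refine limiting_formC hΩ (ε := ε) (κ := -η / Ω) ?_ (fun r hr => ?_) (fun u hu => ?_) h8 h9
    · rcases hcase with ⟨h1, rfl, -⟩ | ⟨h1, rfl, -⟩
      · exact Or.inl ⟨h1, by simp⟩
      · exact Or.inr ⟨h1, rfl⟩
    · obtain ⟨u, hu, rfl⟩ := exists_mem_openBox h6 hr
      obtain ⟨e1, e2⟩ := h7 u hu
      rw [← (vec3_eq_iff.1 e2).1]
      exact (hcone _ (hVs _ e1)).2.1
    · obtain ⟨e1, e2⟩ := h7 u hu
      obtain ⟨f1, f3, f2⟩ := vec3_eq_iff.1 e2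
      have f0 := hang _ e1
      rw [f2] at f0
      ext i
      fin_cases i
      · exact f0
      · exact f1
      · exact f2
      · exact f3

theorem IsAdapted.hasListedChart_of_ab_ne_zero (h : S.IsAdapted X ε a b c d O) (hne : O.Nonempty)
    (hflat : ∀ u ∈ O, ¬ S.IsFlatNear (X u 1))
    (habd : ∀ u ∈ O, a u ≠ 0 ∧ b u ≠ 0 ∧ d u = 0) : S.HasListedChart X O := by
  obtain ⟨Ω, hΩ, B, hBO, hBo, hBne, hBc, htw, J, hJ, hJc, hJS, hXJ, hH, hD⟩ :=
    h.exists_constant_curvature hne hflat habd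
  exact ((h.mono hBo hBO).hasListedChart_of_development (fun u hu => (habd u (hBO hu)).2.2) hBne hBc
    hΩ htw hJ hJc hJS hXJ hH hD).mono hBO

end Normal

end GodelType

namespace GodelType

variable {S : GodelType}

theorem IsAdapted.exists_hasListedChart {X : E3 → E4} {O : Set E3} {ε : ℝ} {a b c d : E3 → ℝ}
    (h : S.IsAdapted X ε a b c d O) (hne : O.Nonempty)
    (hflat : ∀ u ∈ O, ¬ S.IsFlatNear (X u 1)) : S.HasListedChart X O := by
  rcases exists_open_ne_or_forall_eq h.isOpen h.smooth_d.continuousOn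
    with hd | ⟨O₁, hsub, ho, hne', hd⟩
  · rcases exists_open_ne_or_forall_eq h.isOpen h.smooth_a.continuousOn
      with ha | ⟨O₁, hsub, ho, hne', ha⟩
    · exact h.hasListedChart_of_a_eq_zero hne fun u hu => ⟨ha u hu, hd u hu⟩
    · have h' := h.mono ho hsub
      rcases exists_open_ne_or_forall_eq h'.isOpen h'.smooth_b.continuousOn
        with hb | ⟨O₂, hsub', ho', hne'', hb⟩
      · exact (h'.hasListedChart_of_b_eq_zero hne' (fun u hu => hflat u (hsub hu))
          (fun u hu => ⟨hb u hu, hd u (hsub hu)⟩) ha).mono hsub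
      · exact ((h'.mono ho' hsub').hasListedChart_of_ab_ne_zero hne''
          (fun u hu => hflat u (hsub (hsub' hu)))
          fun u hu => ⟨ha u (hsub' hu), hb u hu, hd u (hsub (hsub' hu))⟩).mono (hsub'.trans hsub)
  · exact ((h.mono ho hsub).hasListedChart_of_d_ne_zero hne'
      (fun u hu => hflat u (hsub hu)) hd).mono hsub

theorem exists_hasListedChart {X : E3 → E4} {O : Set E3} (hO : IsOpen O) (hne : O.Nonempty)
    (hX : ContDiffOn ℝ ∞ X O) (hmem : ∀ u ∈ O, X u 1 ∈ S.interval)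
    (himm : ∀ u ∈ O, Function.Injective (fderiv ℝ X u))
    (hnd : ∀ u ∈ O, S.IsNondegenerateAt X u)
    (hgeo : ∀ u ∈ O, ∀ ξ, S.IsUnitNormal X u ξ → ∀ v w, S.secondFundamentalForm X u ξ v w = 0)
    (hflat : ∀ u ∈ O, ¬ S.IsFlatNear (X u 1)) : S.HasListedChart X O := by
  obtain ⟨O', hsub, hne', ε, a, b, c, d, h⟩ := exists_isAdapted hO hne hX hmem himm hnd hgeo
  exact (h.exists_hasListedChart hne' fun u hu => hflat u (hsub hu)).mono hsub

end GodelType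

theorem StructureGroupoid.trans_mem_maximalAtlas {H M : Type*} [TopologicalSpace H]
    [TopologicalSpace M] [ChartedSpace H M] {G : StructureGroupoid H}
    {e : OpenPartialHomeomorph M H} (he : e ∈ G.maximalAtlas M) {χ : OpenPartialHomeomorph H H}
    (hχ : χ ∈ G) : e.trans χ ∈ G.maximalAtlas M := by
  refine mem_maximalAtlas_iff.2 fun e' he' => ?_
  obtain ⟨h1, h2⟩ := mem_maximalAtlas_iff.1 he e' he'
  constructor
  · rw [OpenPartialHomeomorph.trans_symm_eq_symm_trans_symm, OpenPartialHomeomorph.trans_assoc]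
    exact G.trans (G.symm hχ) h1
  · rw [← OpenPartialHomeomorph.trans_assoc]
    exact G.trans h2 hχ

theorem mem_contDiffGroupoid_euclidean {n : ℕ} {χ : OpenPartialHomeomorph
    (EuclideanSpace ℝ (Fin n)) (EuclideanSpace ℝ (Fin n))} (hχ : ContDiffOn ℝ ∞ χ χ.source)
    (hχs : ContDiffOn ℝ ∞ χ.symm χ.target) : χ ∈ contDiffGroupoid ∞ (𝓡 n) := by
  rw [contDiffGroupoid, mem_groupoid_of_pregroupoid]
  simpa [contDiffPregroupoid] using ⟨hχ, hχs⟩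

end

theorem mainTheorem3 (S : GodelType)
    {M : Type*} [TopologicalSpace M] [ChartedSpace E3 M] [IsManifold (𝓡 3) ∞ M]
    (F : M → E4) (hF : S.IsHypersurface F) (hgeo : S.IsTotallyGeodesic F)
    (hflat : ∀ p, ¬ S.IsFlatNear (F p 1)) :
    ∃ W : Set M, IsOpen W ∧ Dense W ∧ ∀ p ∈ W,
      ∃ φ ∈ IsManifold.maximalAtlas (𝓡 3) ∞ M, p ∈ φ.source ∧
      ∃ α β : Fin 3 → ℝ, φ.target = openBox α β ∧
      ((∃ Ψ : OpenPartialHomeomorph E4 E4, GodelType.IsLocalIsometry S S Ψ ∧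
          Ψ.source = S.domain ∧ Ψ.target = S.domain ∧
          S.IsListed α β (Ψ ∘ F ∘ φ.symm)) ∨
        (∃ (Ω : ℝ) (hΩ : Ω ≠ 0) (Ψ : OpenPartialHomeomorph E4 E4),
          GodelType.IsLocalIsometry S (GodelType.limiting Ω hΩ) Ψ ∧
          (∀ q ∈ φ.source, F q ∈ Ψ.source) ∧
          (∀ x ∈ Ψ.source, deriv S.H (x 1) = -2 * Ω * S.D (x 1) ∧
            deriv (deriv S.D) (x 1) = 4 * Ω ^ 2 * S.D (x 1)) ∧
          (GodelType.limiting Ω hΩ).IsListed α β (Ψ ∘ F ∘ φ.symm))) := by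
  set W : Set M := {p | ∃ φ ∈ IsManifold.maximalAtlas (𝓡 3) ∞ M, p ∈ φ.source ∧
      ∃ α β : Fin 3 → ℝ, φ.target = openBox α β ∧
      ((∃ Ψ : OpenPartialHomeomorph E4 E4, GodelType.IsLocalIsometry S S Ψ ∧
          Ψ.source = S.domain ∧ Ψ.target = S.domain ∧
          S.IsListed α β (Ψ ∘ F ∘ φ.symm)) ∨
        (∃ (Ω : ℝ) (hΩ : Ω ≠ 0) (Ψ : OpenPartialHomeomorph E4 E4),
          GodelType.IsLocalIsometry S (GodelType.limiting Ω hΩ) Ψ ∧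
          (∀ q ∈ φ.source, F q ∈ Ψ.source) ∧
          (∀ x ∈ Ψ.source, deriv S.H (x 1) = -2 * Ω * S.D (x 1) ∧
            deriv (deriv S.D) (x 1) = 4 * Ω ^ 2 * S.D (x 1)) ∧
          (GodelType.limiting Ω hΩ).IsListed α β (Ψ ∘ F ∘ φ.symm)))} with hW
  refine ⟨W, isOpen_iff_mem_nhds.2 ?_, dense_iff_inter_open.2 ?_, fun p hp => hp⟩
  · rintro p ⟨φ, hφ, hp, h⟩
    filter_upwards [φ.open_source.mem_nhds hp] with q hq using ⟨φ, hφ, hq, h⟩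
  · rintro V hV ⟨p, hp⟩
    set e := chartAt E3 p with he
    have hO : IsOpen (e.target ∩ e.symm ⁻¹' V) := e.isOpen_inter_preimage_symm hV
    have hX : ContDiffOn ℝ ∞ (F ∘ e.symm) e.target :=
      (hF.smooth.comp_contMDiffOn (contMDiffOn_chart_symm (I := 𝓡 3))).contDiffOn
    have hat := chart_mem_atlas E3 p
    obtain ⟨χ, ⟨x, hx⟩, h2, h3, h4, α, β, h5, h6⟩ := GodelType.exists_hasListedChart (S := S) hO
      ⟨e p, e.map_source (mem_chart_source E3 p), by
        simpa [e.left_inv (mem_chart_source E3 p)] using hp⟩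
      (hX.mono inter_subset_left) (fun u _ => hF.mem_domain _)
      (fun u hu => hF.immersion e hat u hu.1) (fun u hu => hF.nondegenerate e hat u hu.1)
      (fun u hu => hgeo e hat u hu.1) fun u _ => hflat _
    have hsrc : ∀ q, q ∈ (e.trans χ).source ↔ q ∈ e.source ∧ e q ∈ χ.source := fun q => by simp
    refine ⟨e.symm x, (h2 hx).2, e.trans χ,
      StructureGroupoid.trans_mem_maximalAtlas (IsManifold.chart_mem_maximalAtlas p)
        (mem_contDiffGroupoid_euclidean h3 h4), ?_, α, β, ?_, ?_⟩
    · rw [hsrc, e.right_inv (h2 hx).1]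
      exact ⟨e.map_target (h2 hx).1, hx⟩
    · rw [OpenPartialHomeomorph.trans_target, ← h5]
      exact inter_eq_left.2 fun y hy => (h2 (χ.map_target hy)).1
    · rcases h6 with h6 | ⟨Ω, hΩ, Ψ, hΨ, hmem, h7⟩
      · exact Or.inl h6
      · refine Or.inr ⟨Ω, hΩ, Ψ, hΨ, fun q hq => ?_, h7⟩
        have hq' := (hsrc q).1 hq
        have := hmem _ hq'.2
        rwa [Function.comp_apply, e.left_inv hq'.1] at this
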